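/- A (discrete) timed automaton has finite sets of locations, initial and final locations and clocks, and finitely many transitions $(\ell,g,op,Y,\ell')$, where $g$ is a finite conjunction of constraints $x\bowtie k$ ($x$ a clock, $k\in\mathbb N$, ${\bowtie}\in\{<,\le,=,>,\ge\}$) and $Y$ is the set of clocks that are reset; clocks take values in $\mathbb N$. A communicating timed automaton $\mathcal N$ of the kind considered consists of two discrete timed automata $A$ and $B$ with disjoint clock sets (no global clocks), a finite message alphabet $\Sigma$, and one unbounded, lossless FIFO channel from $A$ to $B$ holding messages with ages in $\mathbb N$. A transition of $A$ may, besides checking $g$ and resetting $Y$, append a message $a\in\Sigma$ of age $0$ to the tail of the channel; a transition of $B$ may remove the message $a$ at the head of the channel if its age lies in a given interval with endpoints in $\mathbb N\cup\{\infty\}$. A time step of $t\in\mathbb N$ adds $t$ to all clocks of $A$ and $B$ and to the ages of all messages in the channel; discrete steps are transitions of one of the automata. A configuration consists of the locations and clock valuations of $A$ and $B$ and the channel contents; in an initial configuration both automata are in initial locations, all clocks are $0$ and the channel is empty. The reachability problem asks, given $\mathcal N$ and a target, which is a location of $A$, a location of $B$, a pair of locations (one of each automaton), or a configuration, whether some run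 from an initial configuration ends in a configuration which has the given location or locations, or is the given configuration. All numbers in an instance (constants, clock values, ages, and the indices that name locations, clocks and messages) are written in binary; the sizes of the sets of locations, of clocks and of messages are written in unary. Theorem. The reachability problem is decidable in $\mathsf{EXPTIME}$: there are a deterministic Turing machine and a polynomial $p$ such that the machine decides every instance of size $n$ within $2^{p(n)}$ steps. -/

import Mathlib

/-! ## Discrete timed automata -/

namespace TimedChannel

/-- The comparison operators `<`, `≤`, `=`, `>`, `≥`. -/
inductive Cmp where
  | lt | le | eq | gt | ge

/-- `op.Holds v k` says `v ⋈ k`. -/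
def Cmp.Holds : Cmp → ℕ → ℕ → Prop
  | .lt, v, k => v < k
  | .le, v, k => v ≤ k
  | .eq, v, k => v = k
  | .gt, v, k => v > k
  | .ge, v, k => v ≥ k

/-- An atomic constraint `clock ⋈ bound`. -/
structure Atom (X : Type) where
  clock : X
  op : Cmp
  bound : ℕ

/-- A clock constraint: a finite conjunction of atomic constraints. -/
abbrev Guard (X : Type) := List (Atom X)

/-- The valuation `ν` satisfies every conjunct of `g`. -/
def Guard.Sat {X : Type} (g : Guard X) (ν : X → ℕ) : Prop :=
  ∀ c ∈ g, c.op.Holds (ν c.clock) c.bound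

/-- The valuation `ν[Y := 0]`. -/
def resetVal {X : Type} [DecidableEq X] (ν : X → ℕ) (Y : List X) : X → ℕ :=
  fun x => if x ∈ Y then 0 else ν x

/-- The valuation `ν + t`. -/
def delayVal {X : Type} (ν : X → ℕ) (t : ℕ) : X → ℕ :=
  fun x => ν x + t

/-- A transition `(ℓ, g, op, Y, ℓ')`; the list `reset` presents the finite set `Y`. -/
structure Transition (L X Op : Type) where
  source : L
  guard : Guard X
  op : Op
  reset : List X
  target : L

/-- A timed automaton with locations `L`, clocks `X` and operations `Op`.  The finite sets of
initial locations, final locations and transitions are presented by lists. -/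
structure TimedAutomaton (L X Op : Type) where
  initial : List L
  final : List L
  transitions : List (Transition L X Op)

/-! ## Two timed automata joined by a channel -/

/-- An interval of ages, open or closed at either end; `upper = none` stands for `∞`
(and then `upperClosed` is irrelevant). -/
structure AgeInterval where
  lower : ℕ
  lowerClosed : Bool
  upper : Option ℕ
  upperClosed : Bool

/-- `I.Contains t` says `t ∈ I`. -/
def AgeInterval.Contains (I : AgeInterval) (t : ℕ) : Prop :=
  (if I.lowerClosed then I.lower ≤ t else I.lower < t) ∧
    ∀ u ∈ I.upper, if I.upperClosed then t ≤ u else t < u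

/-- Operations of the sender: `nop`, or `c!a`. -/
inductive SendOp (M : Type) where
  | nop
  | write (a : M)

/-- Operations of the receiver: `nop`, or `c?(a ∈ I)`. -/
inductive RecvOp (M : Type) where
  | nop
  | read (a : M) (I : AgeInterval)

/-- A communicating timed automaton consisting of two discrete timed automata, a sender and a
receiver, and one channel from the sender to the receiver.  Each automaton has its own clocks;
there are no global clocks. -/
structure CTA where
  senderLocs : ℕ
  senderClocks : ℕ
  receiverLocs : ℕ
  receiverClocks : ℕ
  messages : ℕ
  sender : TimedAutomaton (Fin senderLocs) (Fin senderClocks) (SendOp (Fin messages))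
  receiver : TimedAutomaton (Fin receiverLocs) (Fin receiverClocks) (RecvOp (Fin messages))

/-- A configuration: locations and clock valuations of both automata, and the channel contents,
a word of messages with their ages, newest message first. -/
structure Config (N : CTA) where
  sLoc : Fin N.senderLocs
  sVal : Fin N.senderClocks → ℕ
  rLoc : Fin N.receiverLocs
  rVal : Fin N.receiverClocks → ℕ
  chan : List (Fin N.messages × ℕ)

/-- The channel contents `c + t`: every age is increased by `t`. -/
def delayChan {M : Type} (c : List (M × ℕ)) (t : ℕ) : List (M × ℕ) :=
  c.map fun p => (p.1, p.2 + t)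

/-- The transition relation on configurations: passage of time, and discrete transitions of the
sender or of the receiver. -/
inductive Step (N : CTA) : Config N → Config N → Prop
  | delay (γ : Config N) (t : ℕ) :
      Step N γ ⟨γ.sLoc, delayVal γ.sVal t, γ.rLoc, delayVal γ.rVal t, delayChan γ.chan t⟩
  | senderNop (γ : Config N) (e) (he : e ∈ N.sender.transitions) (hop : e.op = .nop)
      (hsrc : γ.sLoc = e.source) (hg : e.guard.Sat γ.sVal) :
      Step N γ ⟨e.target, resetVal γ.sVal e.reset, γ.rLoc, γ.rVal, γ.chan⟩
  | receiverNop (γ : Config N) (e) (he : e ∈ N.receiver.transitions) (hop : e.op = .nop)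
      (hsrc : γ.rLoc = e.source) (hg : e.guard.Sat γ.rVal) :
      Step N γ ⟨γ.sLoc, γ.sVal, e.target, resetVal γ.rVal e.reset, γ.chan⟩
  | write (γ : Config N) (e) (he : e ∈ N.sender.transitions) (a) (hop : e.op = .write a)
      (hsrc : γ.sLoc = e.source) (hg : e.guard.Sat γ.sVal) :
      Step N γ ⟨e.target, resetVal γ.sVal e.reset, γ.rLoc, γ.rVal, (a, 0) :: γ.chan⟩
  | read (γ : Config N) (e) (he : e ∈ N.receiver.transitions) (a) (I) (hop : e.op = .read a I)
      (hsrc : γ.rLoc = e.source) (hg : e.guard.Sat γ.rVal)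
      (w : List (Fin N.messages × ℕ)) (t : ℕ) (hw : γ.chan = w ++ [(a, t)]) (ht : I.Contains t) :
      Step N γ ⟨γ.sLoc, γ.sVal, e.target, resetVal γ.rVal e.reset, w⟩

/-- Initial configurations: initial locations, all clocks zero, empty channel. -/
def Config.IsInitial {N : CTA} (γ : Config N) : Prop :=
  γ.sLoc ∈ N.sender.initial ∧ γ.sVal = 0 ∧
    γ.rLoc ∈ N.receiver.initial ∧ γ.rVal = 0 ∧ γ.chan = []

/-- `γ` is reachable from an initial configuration. -/
def Config.Reachable {N : CTA} (γ : Config N) : Prop :=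
  ∃ γ₀ : Config N, γ₀.IsInitial ∧ Relation.ReflTransGen (Step N) γ₀ γ

/-! ## The reachability problem -/

/-- What is to be reached: a control location of one of the automata, a pair of control
locations, or a configuration. -/
inductive Target (N : CTA) where
  | senderLocation (l : Fin N.senderLocs)
  | receiverLocation (l : Fin N.receiverLocs)
  | locations (l : Fin N.senderLocs) (l' : Fin N.receiverLocs)
  | configuration (γ : Config N)

/-- The target is met in the configuration `γ`. -/
def Target.MetBy {N : CTA} : Target N → Config N → Prop
  | .senderLocation l, γ => γ.sLoc = l
  | .receiverLocation l, γ => γ.rLoc = l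
  | .locations l l', γ => γ.sLoc = l ∧ γ.rLoc = l'
  | .configuration γ', γ => γ = γ'

/-- An instance of the reachability problem. -/
structure ReachInstance where
  net : CTA
  target : Target net

/-- The yes-instances of the reachability problem. -/
def Reachability (x : ReachInstance) : Prop :=
  ∃ γ : Config x.net, γ.Reachable ∧ x.target.MetBy γ

/-! ## Writing instances as strings

An instance is written as a sequence of natural numbers.  The elements of a list are each
announced by `1`, and the end of a list is marked by `0`; the sizes of the finite sets of
locations, clocks and messages are written in unary, as lists of that length. -/

/-- The code of a list, given the code of its elements. -/
def codeList {α : Type} (f : α → List ℕ) : List α → List ℕ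
  | [] => [0]
  | a :: l => 1 :: (f a ++ codeList f l)

/-- Unary code of a size. -/
def codeSize (n : ℕ) : List ℕ := List.replicate n 1 ++ [0]

def codeFin {n : ℕ} (i : Fin n) : List ℕ := [i.val]

def codeBool (b : Bool) : List ℕ := [if b then 1 else 0]

def codeCmp : Cmp → List ℕ
  | .lt => [0]
  | .le => [1]
  | .eq => [2]
  | .gt => [3]
  | .ge => [4]

def codeAtom {n : ℕ} (c : Atom (Fin n)) : List ℕ :=
  codeFin c.clock ++ (codeCmp c.op ++ [c.bound])

def codeUpper : Option ℕ → List ℕ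
  | none => [0]
  | some u => [1, u]

def codeInterval (I : AgeInterval) : List ℕ :=
  [I.lower] ++ (codeBool I.lowerClosed ++ (codeUpper I.upper ++ codeBool I.upperClosed))

def codeSendOp {m : ℕ} : SendOp (Fin m) → List ℕ
  | .nop => [0]
  | .write a => 1 :: codeFin a

def codeRecvOp {m : ℕ} : RecvOp (Fin m) → List ℕ
  | .nop => [0]
  | .read a I => 1 :: (codeFin a ++ codeInterval I)

def codeTransition {n k : ℕ} {Op : Type} (f : Op → List ℕ)
    (e : Transition (Fin n) (Fin k) Op) : List ℕ :=
  codeFin e.source ++ (codeList codeAtom e.guard ++ (f e.op ++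
    (codeList codeFin e.reset ++ codeFin e.target)))

def codeAutomaton {n k : ℕ} {Op : Type} (f : Op → List ℕ)
    (A : TimedAutomaton (Fin n) (Fin k) Op) : List ℕ :=
  codeList codeFin A.initial ++ (codeList codeFin A.final ++
    codeList (codeTransition f) A.transitions)

def codeCTA (N : CTA) : List ℕ :=
  codeSize N.senderLocs ++ (codeSize N.senderClocks ++ (codeSize N.receiverLocs ++
    (codeSize N.receiverClocks ++ (codeSize N.messages ++
      (codeAutomaton codeSendOp N.sender ++ codeAutomaton codeRecvOp N.receiver)))))

def codeVal {k : ℕ} (ν : Fin k → ℕ) : List ℕ := codeList (fun v => [v]) (List.ofFn ν)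

def codeConfig {N : CTA} (γ : Config N) : List ℕ :=
  codeFin γ.sLoc ++ (codeVal γ.sVal ++ (codeFin γ.rLoc ++ (codeVal γ.rVal ++
    codeList (fun p => codeFin p.1 ++ [p.2]) γ.chan)))

def codeTarget {N : CTA} : Target N → List ℕ
  | .senderLocation l => 0 :: codeFin l
  | .receiverLocation l => 1 :: codeFin l
  | .locations l l' => 2 :: (codeFin l ++ codeFin l')
  | .configuration γ => 3 :: codeConfig γ

def codeInstance (x : ReachInstance) : List ℕ := codeCTA x.net ++ codeTarget x.target

/-- The string of a sequence of numbers: each number is written in binary and followed by the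
separator `none`. -/
def writeNumbers (l : List ℕ) : List (Option Bool) :=
  l.flatMap fun n => (Computability.encodeNat n).map some ++ [none]

/-- The string of an instance, over the alphabet of the two bits and a separator. -/
def writeInstance (x : ReachInstance) : List (Option Bool) := writeNumbers (codeInstance x)

/-! ### Distinct instances have distinct strings -/

/-- No code is a proper prefix of another one, and distinct objects have distinct codes. -/
def PrefixInj {α β : Type} (f : α → List β) : Prop :=
  ∀ a b r s, f a ++ r = f b ++ s → a = b ∧ r = s

theorem prefixInj_list {α : Type} {f : α → List ℕ} (hf : PrefixInj f) :
    PrefixInj (codeList f) := by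
  intro a
  induction a with
  | nil =>
    intro b r s h
    cases b <;> simp_all [codeList]
  | cons a l ih =>
    intro b r s h
    cases b with
    | nil => simp [codeList] at h
    | cons b l' =>
      simp only [codeList, List.cons_append, List.append_assoc, List.cons.injEq, true_and] at h
      replace h := hf _ _ _ _ h
      obtain ⟨rfl, h⟩ := h
      obtain ⟨h1, h2⟩ := ih _ _ _ h
      exact ⟨by rw [h1], h2⟩

theorem prefixInj_size : PrefixInj codeSize := by
  intro a
  induction a with
  | zero =>
    intro b r s h
    cases b <;> simp_all [codeSize, List.replicate_succ]
  | succ a ih =>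
    intro b r s h
    cases b with
    | zero => simp [codeSize, List.replicate_succ] at h
    | succ b =>
      have h' : codeSize a ++ r = codeSize b ++ s := by
        simpa [codeSize, List.replicate_succ] using h
      obtain ⟨rfl, rfl⟩ := ih _ _ _ h'
      exact ⟨rfl, rfl⟩

theorem prefixInj_fin {n : ℕ} : PrefixInj (codeFin (n := n)) := by
  intro a b r s h
  simpa [codeFin, Fin.ext_iff] using h

theorem prefixInj_bool : PrefixInj codeBool := by
  intro a b r s h
  cases a <;> cases b <;> simp_all [codeBool]

theorem prefixInj_cmp : PrefixInj codeCmp := by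
  intro a b r s h
  cases a <;> cases b <;> simp_all [codeCmp]

theorem prefixInj_upper : PrefixInj codeUpper := by
  intro a b r s h
  cases a <;> cases b <;> simp_all [codeUpper]

theorem prefixInj_atom {n : ℕ} : PrefixInj (codeAtom (n := n)) := by
  rintro ⟨x, o, k⟩ ⟨x', o', k'⟩ r s h
  simp only [codeAtom, List.append_assoc] at h
  replace h := prefixInj_fin _ _ _ _ h
  obtain ⟨rfl, h⟩ := h
  replace h := prefixInj_cmp _ _ _ _ h
  obtain ⟨rfl, h⟩ := h
  simpa using h

theorem prefixInj_interval : PrefixInj codeInterval := by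
  rintro ⟨l, p, u, q⟩ ⟨l', p', u', q'⟩ r s h
  simp only [codeInterval, List.append_assoc, List.cons_append, List.nil_append,
    List.cons.injEq] at h
  obtain ⟨rfl, h⟩ := h
  replace h := prefixInj_bool _ _ _ _ h
  obtain ⟨rfl, h⟩ := h
  replace h := prefixInj_upper _ _ _ _ h
  obtain ⟨rfl, h⟩ := h
  replace h := prefixInj_bool _ _ _ _ h
  obtain ⟨rfl, h⟩ := h
  exact ⟨rfl, h⟩

theorem prefixInj_sendOp {m : ℕ} : PrefixInj (codeSendOp (m := m)) := by
  intro a b r s h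
  cases a <;> cases b <;> simp_all [codeSendOp, codeFin, Fin.ext_iff]

theorem prefixInj_recvOp {m : ℕ} : PrefixInj (codeRecvOp (m := m)) := by
  intro a b r s h
  rcases a with _ | ⟨a, I⟩ <;> rcases b with _ | ⟨b, J⟩
  · simpa [codeRecvOp] using h
  · simp [codeRecvOp] at h
  · simp [codeRecvOp] at h
  · simp only [codeRecvOp, List.cons_append, List.append_assoc, List.cons.injEq, true_and] at h
    replace h := prefixInj_fin _ _ _ _ h
    obtain ⟨rfl, h⟩ := h
    replace h := prefixInj_interval _ _ _ _ h
    obtain ⟨rfl, h⟩ := h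
    exact ⟨rfl, h⟩

theorem prefixInj_transition {n k : ℕ} {Op : Type} {f : Op → List ℕ} (hf : PrefixInj f) :
    PrefixInj (codeTransition (n := n) (k := k) f) := by
  rintro ⟨a, g, o, y, b⟩ ⟨a', g', o', y', b'⟩ r s h
  simp only [codeTransition, List.append_assoc] at h
  replace h := prefixInj_fin _ _ _ _ h
  obtain ⟨rfl, h⟩ := h
  replace h := prefixInj_list prefixInj_atom _ _ _ _ h
  obtain ⟨rfl, h⟩ := h
  replace h := hf _ _ _ _ h
  obtain ⟨rfl, h⟩ := h
  replace h := prefixInj_list prefixInj_fin _ _ _ _ h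
  obtain ⟨rfl, h⟩ := h
  replace h := prefixInj_fin _ _ _ _ h
  obtain ⟨rfl, h⟩ := h
  exact ⟨rfl, h⟩

theorem prefixInj_automaton {n k : ℕ} {Op : Type} {f : Op → List ℕ} (hf : PrefixInj f) :
    PrefixInj (codeAutomaton (n := n) (k := k) f) := by
  rintro ⟨a, b, c⟩ ⟨a', b', c'⟩ r s h
  simp only [codeAutomaton, List.append_assoc] at h
  replace h := prefixInj_list prefixInj_fin _ _ _ _ h
  obtain ⟨rfl, h⟩ := h
  replace h := prefixInj_list prefixInj_fin _ _ _ _ h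
  obtain ⟨rfl, h⟩ := h
  replace h := prefixInj_list (prefixInj_transition hf) _ _ _ _ h
  obtain ⟨rfl, h⟩ := h
  exact ⟨rfl, h⟩

theorem prefixInj_cta : PrefixInj codeCTA := by
  rintro ⟨a, b, c, d, e, A, B⟩ ⟨a', b', c', d', e', A', B'⟩ r s h
  simp only [codeCTA, List.append_assoc] at h
  replace h := prefixInj_size _ _ _ _ h
  obtain ⟨rfl, h⟩ := h
  replace h := prefixInj_size _ _ _ _ h
  obtain ⟨rfl, h⟩ := h
  replace h := prefixInj_size _ _ _ _ h
  obtain ⟨rfl, h⟩ := h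
  replace h := prefixInj_size _ _ _ _ h
  obtain ⟨rfl, h⟩ := h
  replace h := prefixInj_size _ _ _ _ h
  obtain ⟨rfl, h⟩ := h
  replace h := prefixInj_automaton prefixInj_sendOp _ _ _ _ h
  obtain ⟨rfl, h⟩ := h
  replace h := prefixInj_automaton prefixInj_recvOp _ _ _ _ h
  obtain ⟨rfl, h⟩ := h
  exact ⟨rfl, h⟩

theorem prefixInj_val {k : ℕ} : PrefixInj (codeVal (k := k)) := by
  intro a b r s h
  have hv : PrefixInj (fun v : ℕ => [v]) := by
    intro a b r s h
    simpa using h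
  obtain ⟨h1, h2⟩ := prefixInj_list hv _ _ _ _ h
  exact ⟨List.ofFn_injective h1, h2⟩

theorem prefixInj_config {N : CTA} : PrefixInj (codeConfig (N := N)) := by
  rintro ⟨a, v, b, w, c⟩ ⟨a', v', b', w', c'⟩ r s h
  have hp : PrefixInj (fun p : Fin N.messages × ℕ => codeFin p.1 ++ [p.2]) := by
    rintro ⟨a, t⟩ ⟨b, t'⟩ r s h
    simpa [codeFin, Fin.ext_iff, and_assoc] using h
  simp only [codeConfig, List.append_assoc] at h
  replace h := prefixInj_fin _ _ _ _ h
  obtain ⟨rfl, h⟩ := h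
  replace h := prefixInj_val _ _ _ _ h
  obtain ⟨rfl, h⟩ := h
  replace h := prefixInj_fin _ _ _ _ h
  obtain ⟨rfl, h⟩ := h
  replace h := prefixInj_val _ _ _ _ h
  obtain ⟨rfl, h⟩ := h
  replace h := prefixInj_list hp _ _ _ _ h
  obtain ⟨rfl, h⟩ := h
  exact ⟨rfl, h⟩

theorem prefixInj_target {N : CTA} : PrefixInj (codeTarget (N := N)) := by
  intro a b r s h
  rcases a with a | a | ⟨a, a'⟩ | a <;> rcases b with b | b | ⟨b, b'⟩ | b <;>
    simp [codeTarget] at h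
  · replace h := prefixInj_fin _ _ _ _ h
    obtain ⟨rfl, h⟩ := h
    exact ⟨rfl, h⟩
  · replace h := prefixInj_fin _ _ _ _ h
    obtain ⟨rfl, h⟩ := h
    exact ⟨rfl, h⟩
  · replace h := prefixInj_fin _ _ _ _ h
    obtain ⟨rfl, h⟩ := h
    replace h := prefixInj_fin _ _ _ _ h
    obtain ⟨rfl, h⟩ := h
    exact ⟨rfl, h⟩
  · replace h := prefixInj_config _ _ _ _ h
    obtain ⟨rfl, h⟩ := h
    exact ⟨rfl, h⟩

theorem prefixInj_instance : PrefixInj codeInstance := by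
  rintro ⟨N, T⟩ ⟨N', T'⟩ r s h
  simp only [codeInstance, List.append_assoc] at h
  replace h := prefixInj_cta _ _ _ _ h
  obtain ⟨rfl, h⟩ := h
  replace h := prefixInj_target _ _ _ _ h
  obtain ⟨rfl, h⟩ := h
  exact ⟨rfl, h⟩

theorem map_some_append_none_inj {u v : List Bool} {r s : List (Option Bool)}
    (h : u.map some ++ none :: r = v.map some ++ none :: s) : u = v ∧ r = s := by
  induction u generalizing v with
  | nil => cases v <;> simp_all
  | cons a u ih =>
    cases v with
    | nil => simp at h
    | cons b v =>
      simp only [List.map_cons, List.cons_append, List.cons.injEq, Option.some.injEq] at h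
      obtain ⟨rfl, h⟩ := h
      obtain ⟨rfl, rfl⟩ := ih h
      exact ⟨rfl, rfl⟩

theorem writeNumbers_injective : Function.Injective writeNumbers := by
  intro l
  induction l with
  | nil =>
    intro l' h
    cases l' <;> simp_all [writeNumbers]
  | cons a l ih =>
    intro l' h
    cases l' with
    | nil => simp [writeNumbers] at h
    | cons b l' =>
      simp only [writeNumbers, List.flatMap_cons, List.append_assoc, List.cons_append,
        List.nil_append] at h
      obtain ⟨h1, h2⟩ := map_some_append_none_inj h
      have h3 : a = b := by
        rw [← Computability.decode_encodeNat a, ← Computability.decode_encodeNat b, h1]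
      rw [h3, ih h2]

theorem writeInstance_injective : Function.Injective writeInstance := by
  intro x y h
  have h' := writeNumbers_injective h
  exact (prefixInj_instance x y [] [] (by rw [h'])).1

/-- The encoding of instances as strings. -/
noncomputable def instanceEncoding : Computability.Encoding ReachInstance (Option Bool) where
  encode := writeInstance
  decode := Function.partialInv writeInstance
  decode_encode := Function.partialInv_left writeInstance_injective

end TimedChannel

/-! ## The class EXPTIME -/

open Classical in
/-- The decision problem `P` is in EXPTIME: for some polynomial `p`, some (deterministic,
multi-tape) Turing machine decides, on every instance whose string has length `n`, whether `P`
holds, within `2 ^ p(n)` steps.  All tape alphabets are finite. -/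
def InEXPTIME {α Γ : Type} [Fintype Γ] (e : Computability.Encoding α Γ) (P : α → Prop) : Prop :=
  ∃ (M : Turing.TM2ComputableInTime e.encode Computability.encodeBool (fun a => decide (P a)))
    (p : Polynomial ℕ),
    (∀ k, Finite (M.tm.Γ k)) ∧ ∀ n, M.time n ≤ 2 ^ p.eval n

/-! The sender never depends on the receiver, so the receiver can be run ahead in time. In a `Lag`
configuration it is `ahead` time units ahead of the sender, and a message is read in the same step
in which it is written: if the sender writes at its time `t` and the receiver, standing at time `t +
d`, reads, then the message has age `d`. The channel thus disappears; the lead is the age of the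
message being passed. Messages that a target configuration leaves in the channel are written after
the receiver has stopped for good; the lead is then the time left to the sender, hence the age they
have at the end. `exists_reachable_iff` expresses reachability by such runs; its two directions are
the simulations `LagBehind.step` and `LagAhead.step`.

Let `cap` exceed all constants. Truncating the clocks at `cap` loses nothing, so the lead is a
counter attached to finitely many control states. It changes by at most one in a step, and values
from `cap` on cannot be told apart (`LagStep.up_iff`). In such a one-counter system a run between
configurations with lead zero can be replaced by one whose lead stays within `cap + c ^ 2`, where
`c` is the number of control states (`bounded_of_shift_above`). Constants are below an exponential
in the input length, while the numbers of clocks and locations are below the length itself, so `c`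
is exponential in a polynomial (`ctrls_finite_card`, `ReachInstance.ncard_ctrls_le`). An exhaustive
search through control states with bounded lead decides the problem (`exists_reachable_iff_search`,
`decideB_iff`).

The time bound needs actual Turing machines. Stack programs acting on binary trees are executed by a
machine built from the program (`steps_machine`). `Feas` is polynomial time for such programs; it is
closed under composition, case distinction and folds with polynomially bounded accumulators. Numbers
are unary on trees. The exponential cost is isolated in a padding: an instance is first paired with
a number exponential in a polynomial of its length, and relative to that number decoding, parsing
and search are all polynomial (`inEXPTIME_of_feas`). -/

/-! ## Binary trees on stacks -/

/-- Finite binary trees, the data of the programs below. -/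
inductive BTree where
  | leaf
  | node (l r : BTree)

namespace BTree

/-- The prefix code of a tree. -/
def toks : BTree → List Bool
  | leaf => [false]
  | node l r => true :: (l.toks ++ r.toks)

/-- The number of nodes and leaves. -/
def size : BTree → ℕ
  | leaf => 1
  | node l r => l.size + r.size + 1

theorem length_toks (x : BTree) : x.toks.length = x.size := by
  induction x with
  | leaf => rfl
  | node l r ihl ihr => simp [toks, size, ihl, ihr]

theorem size_pos (x : BTree) : 0 < x.size := by
  cases x <;> simp [size]

end BTree

/-! ## Stack programs and a Turing machine that runs them -/

namespace StackMachine

open BTree Function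

/-- Programs working on a main stack and two auxiliary stacks of bits. -/
inductive Op where
  | move (b : Bool)
  | restore (b : Bool)
  | clear (b : Bool)
  | copy
  | transfer
  | push (t : Bool)
  | pop
  | seq (p q : Op)
  | branch (p q : Op)
  | iter (p : Op)

/-- `Exec p m a m' a' t`: run on the main stack `m` and the auxiliary stacks `a`, the program `p`
ends with the stacks `m'` and `a'` at cost `t`. -/
inductive Exec : Op → List Bool → (Bool → List Bool) → List Bool → (Bool → List Bool) → ℕ → Prop
  | move (b x m a) :
      Exec (.move b) (toks x ++ m) a m (update a b ((toks x).reverse ++ a b)) (x.size + 1)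
  | restore (b m a) :
      Exec (.restore b) m a ((a b).reverse ++ m) (update a b []) ((a b).length + 2)
  | clear (b m a) : Exec (.clear b) m a m (update a b []) ((a b).length + 2)
  | copy (m a) : Exec .copy m a ((a false).reverse ++ m)
      (update (update a false []) true ((a false).reverse ++ a true)) ((a false).length + 2)
  | transfer (m a) : Exec .transfer m a m
      (update (update a true []) false ((a true).reverse ++ a false)) ((a true).length + 2)
  | push (t m a) : Exec (.push t) m a (t :: m) a 2
  | pop (t m a) : Exec .pop (t :: m) a m a 2
  | seq {p q m a m' a' m'' a'' s t} : Exec p m a m' a' s → Exec q m' a' m'' a'' t →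
      Exec (.seq p q) m a m'' a'' (s + t + 2)
  -- `branch` is meant for a pair, whose code starts with `true`; the next bit tells whether the
  -- first component is a leaf. Nothing is consumed.
  | branchLeaf {p q m a m' a' s} : Exec p (true :: false :: m) a m' a' s →
      Exec (.branch p q) (true :: false :: m) a m' a' (s + 2)
  | branchNode {p q m a m' a' s} : Exec q (true :: true :: m) a m' a' s →
      Exec (.branch p q) (true :: true :: m) a m' a' (s + 2)
  -- `iter` consumes the list constructor on top: `false` is the end of the list, `true` leaves head
  -- and tail to the body.
  | iterStop {p m a} : Exec (.iter p) (false :: m) a m a 2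
  | iterNext {p m a m' a' m'' a'' s t} : Exec p m a m' a' s → Exec (.iter p) m' a' m'' a'' t →
      Exec (.iter p) (true :: m) a m'' a'' (s + t + 2)

/-- The subprograms of a program. -/
def Op.subs : Op → List Op
  | .seq p q => .seq p q :: (p.subs ++ q.subs)
  | .branch p q => .branch p q :: (p.subs ++ q.subs)
  | .iter p => .iter p :: p.subs
  | p => [p]

theorem Op.self_mem_subs (p : Op) : p ∈ p.subs := by
  cases p <;> simp [Op.subs]

theorem Op.subs_trans {p q r : Op} (h : p ∈ q.subs) (h' : q ∈ r.subs) : p ∈ r.subs := by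
  induction r with
  | seq a b iha ihb | branch a b iha ihb =>
    simp only [Op.subs, List.mem_cons, List.mem_append] at h' ⊢
    rcases h' with rfl | h' | h'
    · simpa [Op.subs] using h
    · exact .inr (.inl (iha h'))
    · exact .inr (.inr (ihb h'))
  | iter a iha =>
    simp only [Op.subs, List.mem_cons] at h' ⊢
    rcases h' with rfl | h'
    · simpa [Op.subs] using h
    · exact .inr (iha h')
  | _ => simp only [Op.subs, List.mem_singleton] at h'; subst h'; exact h

/-- The stacks of the machine. -/
inductive Stack where
  | inp
  | ctl
  | main
  | aux (b : Bool)
  | cnt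
  | out
  deriving DecidableEq, Fintype

/-! ### The Turing machine running a stack program -/

section Machine

variable (c : Op)

/-- The items on the control stack of the machine for the program `c`. -/
abbrev Item := {p : Op // p ∈ c.subs}

noncomputable instance : Fintype (Item c) :=
  have : Finite (Item c) := List.finite_toSet c.subs
  Fintype.ofFinite _

/-- The stack alphabets. -/
abbrev Alpha : Stack → Type
  | .inp => Option Bool
  | .ctl => Item c
  | _ => Bool

instance (k : Stack) : Finite (Alpha c k) := by
  cases k <;> simp only [Alpha] <;> infer_instance

/-- The labels of the machine. -/
inductive Label where
  | start
  | load
  | dispatch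
  | exec (i : Item c)
  | clean

noncomputable instance : Fintype (Label c) :=
  Fintype.ofInjective
    (fun l : Label c => match l with
      | .start => (Sum.inl 0 : Fin 4 ⊕ Item c)
      | .load => Sum.inl 1
      | .dispatch => Sum.inl 2
      | .exec i => Sum.inr i
      | .clean => Sum.inl 3)
    (by rintro (_ | _ | _ | _ | _) (_ | _ | _ | _ | _) h <;> simp_all)

/-- The registers of the machine. -/
structure Reg where
  tok : Option Bool
  item : Option (Item c)
  sym : Option (Option Bool)

noncomputable instance : Fintype (Reg c) :=
  Fintype.ofInjective (fun r : Reg c => (r.tok, r.item, r.sym))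
    (by rintro ⟨_, _, _⟩ ⟨_, _, _⟩ h; simp_all)

/-- The statements of the machine. -/
abbrev MStmt := Turing.TM2.Stmt (Alpha c) (Label c) (Reg c)

variable {c}

open Classical in
/-- The control item of a subprogram. -/
noncomputable def toItem (p : Op) : Item c := if h : p ∈ c.subs then ⟨p, h⟩ else ⟨c, c.self_mem_subs⟩

theorem toItem_val {p : Op} (h : p ∈ c.subs) : (toItem p : Item c).1 = p := by
  simp [toItem, h]

open Turing.TM2.Stmt

/-- Jump back to the dispatcher. -/
def back : MStmt c := goto fun _ => .dispatch

/-- The statement executing one control item. -/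
noncomputable def execStmt (i : Item c) : MStmt c :=
  match i.1 with
  -- The end of one tree must be found in a sequence of bits. `cnt` counts the right subtrees still
  -- to come: a node adds one, a leaf takes one off, and a leaf that finds `cnt` empty completes the
  -- move.
  | .move b =>
    pop .main (fun s x => { s with tok := x }) <|
    push (.aux b) (fun s => s.tok.getD false) <|
    branch (fun s => s.tok.getD false)
      (push .cnt (fun _ => true) <| goto fun _ => .exec i)
      (pop .cnt (fun s x => { s with tok := x }) <|
        branch (fun s => s.tok.isSome) (goto fun _ => .exec i) back)
  | .restore b =>
    pop (.aux b) (fun s x => { s with tok := x }) <|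
    branch (fun s => s.tok.isSome)
      (push .main (fun s => s.tok.getD false) <| goto fun _ => .exec i) back
  | .clear b =>
    pop (.aux b) (fun s x => { s with tok := x }) <|
    branch (fun s => s.tok.isSome) (goto fun _ => .exec i) back
  | .copy =>
    pop (.aux false) (fun s x => { s with tok := x }) <|
    branch (fun s => s.tok.isSome)
      (push .main (fun s => s.tok.getD false) <| push (.aux true) (fun s => s.tok.getD false) <|
        goto fun _ => .exec i) back
  | .transfer =>
    pop (.aux true) (fun s x => { s with tok := x }) <|
    branch (fun s => s.tok.isSome)
      (push (.aux false) (fun s => s.tok.getD false) <| goto fun _ => .exec i) back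
  | .push t => push .main (fun _ => t) back
  | .pop => pop .main (fun s _ => s) back
  | .seq p q => push .ctl (fun _ => toItem q) <| push .ctl (fun _ => toItem p) back
  | .branch p q =>
    pop .main (fun s _ => s) <|
    peek .main (fun s x => { s with tok := x }) <|
    -- In every situation covered by `Exec` the bit popped was `true`, so pushing the constant
    -- restores it.
    push .main (fun _ => true) <|
    branch (fun s => s.tok.getD false)
      (push .ctl (fun _ => toItem q) back) (push .ctl (fun _ => toItem p) back)
  | .iter p =>
    pop .main (fun s x => { s with tok := x }) <|
    branch (fun s => s.tok.getD false)
      (push .ctl (fun _ => i) <| push .ctl (fun _ => toItem p) back) back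

/-- Push the code of a symbol and a list constructor. -/
def loadSym (q : MStmt c) : MStmt c :=
  -- The bits are pushed in the reverse order of the prefix code, its first bit last.
  branch (fun s => s.sym = some none)
    (push .main (fun _ => false) <| push .main (fun _ => true) q)
    (branch (fun s => s.sym = some (some false))
      (push .main (fun _ => false) <| push .main (fun _ => false) <| push .main (fun _ => true) <|
        push .main (fun _ => true) q)
      (push .main (fun _ => false) <| push .main (fun _ => false) <| push .main (fun _ => true) <|
        push .main (fun _ => false) <| push .main (fun _ => true) <| push .main (fun _ => true) q))

/-- The initial register contents. -/
def Reg.init : Reg c := ⟨none, none, none⟩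

/-- The program of the machine. -/
noncomputable def machineStmt : Label c → MStmt c
  | .start => push .main (fun _ => false) <| goto fun _ => .load
  | .load =>
    pop .inp (fun s x => { s with sym := x }) <|
    branch (fun s => s.sym.isSome) (loadSym <| goto fun _ => .load)
      (push .ctl (fun _ => toItem c) back)
  | .dispatch =>
    pop .ctl (fun s x => { s with item := x }) <|
    branch (fun s => s.item.isSome) (goto fun s => .exec (s.item.getD (toItem c)))
      -- An empty control stack means the program has finished. The top bit of the result says
      -- whether it is a node, and is the answer.
      (pop .main (fun s x => { s with tok := x }) <|
        push .out (fun s => s.tok.getD false) <| goto fun _ => .clean)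
  | .exec i => execStmt i
  -- The halting configuration is prescribed exactly, so the main stack is emptied and the registers
  -- are reset.
  | .clean =>
    pop .main (fun s x => { s with tok := x }) <|
    branch (fun s => s.tok.isSome) (goto fun _ => .clean) (load (fun _ => .init) halt)

variable (c) in
/-- The machine loading its input, reversed, as a tree, running the program `c` on it, and
returning whether the resulting tree is not a leaf. -/
noncomputable def machine : Turing.FinTM2 where
  K := Stack
  k₀ := .inp
  k₁ := .out
  Γ := Alpha c
  Λ := Label c
  main := .start
  σ := Reg c
  initialState := .init
  Γk₀Fin := (inferInstance : Fintype (Option Bool))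
  m := machineStmt

/-- The stacks of the machine, listed. -/
def stk (i : List (Option Bool)) (r : List (Item c)) (m : List Bool) (a : Bool → List Bool)
    (n o : List Bool) : ∀ k, List (Alpha c k)
  | .inp => i
  | .ctl => r
  | .main => m
  | .aux b => a b
  | .cnt => n
  | .out => o

section Update

variable (i : List (Option Bool)) (r : List (Item c)) (m : List Bool) (a : Bool → List Bool)
    (n o : List Bool)

@[simp] theorem update_stk_inp (x : List (Option Bool)) :
    update (stk i r m a n o) .inp x = stk x r m a n o := by
  funext k; cases k <;> simp [stk, update]
@[simp] theorem update_stk_ctl (x : List (Item c)) :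
    update (stk i r m a n o) .ctl x = stk i x m a n o := by
  funext k; cases k <;> simp [stk, update]
@[simp] theorem update_stk_main (x : List Bool) :
    update (stk i r m a n o) .main x = stk i r x a n o := by
  funext k; cases k <;> simp [stk, update]
@[simp] theorem update_stk_aux (b : Bool) (x : List Bool) :
    update (stk i r m a n o) (.aux b) x = stk i r m (update a b x) n o := by
  funext k
  rcases k with _ | _ | _ | b' | _ | _ <;> simp [stk, update]
  split_ifs with h
  · subst h; rfl
  · rfl
@[simp] theorem update_stk_cnt (x : List Bool) :
    update (stk i r m a n o) .cnt x = stk i r m a x o := by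
  funext k; cases k <;> simp [stk, update]
@[simp] theorem update_stk_out (x : List Bool) :
    update (stk i r m a n o) .out x = stk i r m a n x := by
  funext k; cases k <;> simp [stk, update]

end Update

/-- Configurations of the machine. -/
abbrev MCfg (c : Op) := Turing.TM2.Cfg (Alpha c) (Label c) (Reg c)

/-- `c₂` is reached from `c₁` in exactly `t` steps. -/
def Steps (t : ℕ) (c₁ c₂ : MCfg c) : Prop :=
  (flip bind (Turing.TM2.step machineStmt))^[t] (some c₁) = some c₂

theorem Steps.trans {s t : ℕ} {x y z : MCfg c} (h : Steps s x y) (h' : Steps t y z) :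
    Steps (s + t) x z := by
  unfold Steps at *
  rw [Nat.add_comm, iterate_add_apply, h, h']

theorem Steps.one {l v S} {y : MCfg c} (h : Turing.TM2.stepAux (machineStmt l) v S = y) :
    Steps 1 ⟨some l, v, S⟩ y := by
  subst h; rfl

theorem Steps.head {t l v S} {y z : MCfg c} (h' : Steps t y z)
    (h : Turing.TM2.stepAux (machineStmt l) v S = y) :
    Steps (t + 1) ⟨some l, v, S⟩ z := by
  rw [Nat.add_comm]; exact (Steps.one h).trans h'

theorem Steps.cast {s t : ℕ} {x y : MCfg c} (h : Steps s x y) (e : s = t) : Steps t x y := e ▸ h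

/-- The configuration about to execute the topmost control item. -/
def dcfg (v : Reg c) (r : List (Item c)) (m : List Bool) (a : Bool → List Bool) : MCfg c :=
  ⟨some .dispatch, v, stk [] r m a [] []⟩

/-- The counter `n` is arbitrary to make the induction work. A node pushes a mark, which the move of
its left subtree removes; the move of its right subtree then finds the original counter again. -/
theorem steps_move {b : Bool} {i : Item c} (hi : i.1 = .move b) (x : BTree) (v : Reg c)
    (r m a) (n : List Bool) : ∃ v', Steps x.size
      ⟨some (.exec i), v, stk [] r (x.toks ++ m) a n []⟩
      ⟨some (if n = [] then .dispatch else .exec i), v',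
        stk [] r m (update a b (x.toks.reverse ++ a b)) n.tail []⟩ := by
  induction x generalizing v m a n with
  | leaf =>
    cases n with
    | nil =>
      exact ⟨_, Steps.one (by simp [machineStmt, execStmt, hi, stk, toks, back]; rfl)⟩
    | cons k n =>
      exact ⟨_, Steps.one (by simp [machineStmt, execStmt, hi, stk, toks, back]; rfl)⟩
  | node l r' ihl ihr =>
    obtain ⟨v₁, h₁⟩ := ihl { v with tok := some true } (r'.toks ++ m)
      (update a b (true :: a b)) (true :: n)
    obtain ⟨v₂, h₂⟩ := ihr v₁ m (update a b (l.toks.reverse ++ true :: a b)) n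
    simp only [List.cons_ne_nil, if_false, List.tail_cons, update_self, update_idem] at h₁ h₂
    refine ⟨v₂, Steps.cast (s := l.size + r'.size + 1) ?_ rfl⟩
    simp only [toks, List.cons_append, List.append_assoc, List.reverse_cons, List.reverse_append,
      List.nil_append]
    exact (h₁.trans h₂).head (by simp [machineStmt, execStmt, hi, stk])

theorem steps_restore {b : Bool} {i : Item c} (hi : i.1 = .restore b) (l : List Bool) (v : Reg c)
    (r m a) : ∃ v', Steps (l.length + 1)
      ⟨some (.exec i), v, stk [] r m (update a b l) [] []⟩
      (dcfg v' r (l.reverse ++ m) (update a b [])) := by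
  induction l generalizing v m with
  | nil => exact ⟨_, Steps.one (by simp [machineStmt, execStmt, hi, stk, back]; rfl)⟩
  | cons t l ih =>
    obtain ⟨v', h⟩ := ih { v with tok := some t } (t :: m)
    refine ⟨v', ?_⟩
    simp only [List.reverse_cons, List.append_assoc, List.cons_append, List.nil_append]
    exact h.head (by simp [machineStmt, execStmt, hi, stk])

theorem steps_clear {b : Bool} {i : Item c} (hi : i.1 = .clear b) (l : List Bool) (v : Reg c)
    (r m a) : ∃ v', Steps (l.length + 1)
      ⟨some (.exec i), v, stk [] r m (update a b l) [] []⟩ (dcfg v' r m (update a b [])) := by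
  induction l generalizing v with
  | nil => exact ⟨_, Steps.one (by simp [machineStmt, execStmt, hi, stk, back]; rfl)⟩
  | cons t l ih =>
    obtain ⟨v', h⟩ := ih { v with tok := some t }
    exact ⟨v', h.head (by simp [machineStmt, execStmt, hi, stk])⟩

theorem update_update_aux (a : Bool → List Bool) (l k l' k' : List Bool) :
    update (update (update (update a false l) true k) false l') true k' =
      update (update a false l') true k' := by
  funext b; cases b <;> simp

theorem steps_copy {i : Item c} (hi : i.1 = .copy) (l k : List Bool) (v : Reg c) (r m a) :
    ∃ v', Steps (l.length + 1)
      ⟨some (.exec i), v, stk [] r m (update (update a false l) true k) [] []⟩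
      (dcfg v' r (l.reverse ++ m) (update (update a false []) true (l.reverse ++ k))) := by
  induction l generalizing v m k with
  | nil =>
    refine ⟨{ v with tok := none }, Steps.one ?_⟩
    simp [machineStmt, execStmt, hi, stk, back, dcfg]
    congr 1
    funext b; cases b <;> simp
  | cons t l ih =>
    obtain ⟨v', h⟩ := ih (t :: k) { v with tok := some t } (t :: m)
    refine ⟨v', ?_⟩
    simp only [List.reverse_cons, List.append_assoc, List.cons_append, List.nil_append]
    exact h.head (by simp [machineStmt, execStmt, hi, stk, update_update_aux])

theorem steps_transfer {i : Item c} (hi : i.1 = .transfer) (l k : List Bool) (v : Reg c) (r m a) :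
    ∃ v', Steps (l.length + 1)
      ⟨some (.exec i), v, stk [] r m (update (update a true l) false k) [] []⟩
      (dcfg v' r m (update (update a true []) false (l.reverse ++ k))) := by
  have key : ∀ (a : Bool → List Bool) (l k l' k' : List Bool),
      update (update (update (update a true l) false k) true l') false k' =
        update (update a true l') false k' := by
    intro a l k l' k'
    funext b; cases b <;> simp
  induction l generalizing v k with
  | nil =>
    refine ⟨{ v with tok := none }, Steps.one ?_⟩
    simp [machineStmt, execStmt, hi, stk, back, dcfg]
    congr 1
    funext b; cases b <;> simp
  | cons t l ih =>
    obtain ⟨v', h⟩ := ih (t :: k) { v with tok := some t }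
    refine ⟨v', ?_⟩
    simp only [List.reverse_cons, List.append_assoc, List.cons_append, List.nil_append]
    exact h.head (by simp [machineStmt, execStmt, hi, stk, key])

/-- The machine executes the topmost control item. -/
theorem steps_exec {p : Op} {m a m' a' t} (h : Exec p m a m' a' t) (hp : p ∈ c.subs) (v : Reg c)
    (r : List (Item c)) :
    ∃ v', ∃ s ≤ t, Steps s (dcfg v (toItem p :: r) m a) (dcfg v' r m' a') := by
  have hv := toItem_val hp
  induction h generalizing v r with
  | move b x m a =>
    obtain ⟨v', h⟩ := steps_move hv x { v with item := some (toItem (.move b)) } r m a []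
    exact ⟨v', _, le_rfl, h.head (by simp [machineStmt, stk])⟩
  | restore b m a =>
    obtain ⟨v', h⟩ := steps_restore hv (a b) { v with item := some (toItem (.restore b)) } r m a
    rw [update_eq_self] at h
    exact ⟨v', _, le_rfl, h.head (by simp [machineStmt, stk])⟩
  | clear b m a =>
    obtain ⟨v', h⟩ := steps_clear hv (a b) { v with item := some (toItem (.clear b)) } r m a
    rw [update_eq_self] at h
    exact ⟨v', _, le_rfl, h.head (by simp [machineStmt, stk])⟩
  | copy m a =>
    obtain ⟨v', h⟩ := steps_copy hv (a false) (a true)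
      { v with item := some (toItem .copy) } r m a
    rw [update_eq_self, update_eq_self] at h
    exact ⟨v', _, le_rfl, h.head (by simp [machineStmt, stk])⟩
  | transfer m a =>
    obtain ⟨v', h⟩ := steps_transfer hv (a true) (a false)
      { v with item := some (toItem .transfer) } r m a
    rw [update_eq_self, update_eq_self] at h
    exact ⟨v', _, le_rfl, h.head (by simp [machineStmt, stk])⟩
  | push t m a =>
    refine ⟨{ v with item := some (toItem (.push t)) }, 2, le_rfl, (Steps.one ?_).head
      (l := .dispatch) (y := ⟨some (.exec (toItem (.push t))), { v with item := some (toItem (.push t)) }, stk [] r m a [] []⟩) ?_⟩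
    · simp [machineStmt, execStmt, hv, stk, back, dcfg]
    · simp [machineStmt, stk]
  | pop t m a =>
    refine ⟨{ v with item := some (toItem (.pop)) }, 2, le_rfl, (Steps.one ?_).head
      (l := .dispatch) (y := ⟨some (.exec (toItem (.pop))), { v with item := some (toItem (.pop)) }, stk [] r (t :: m) a [] []⟩) ?_⟩
    · simp [machineStmt, execStmt, hv, stk, back, dcfg]
    · simp [machineStmt, stk]
  | @seq p q m a m' a' m'' a'' s t h₁ h₂ ih₁ ih₂ =>
    have hp' : p ∈ c.subs := Op.subs_trans (by simp [Op.subs, Op.self_mem_subs]) hp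
    have hq' : q ∈ c.subs := Op.subs_trans (by simp [Op.subs, Op.self_mem_subs]) hp
    obtain ⟨v₁, s₁, hs₁, h₁⟩ := ih₁ hp' { v with item := some (toItem (.seq p q)) }
      (toItem q :: r) (toItem_val hp')
    obtain ⟨v₂, s₂, hs₂, h₂⟩ := ih₂ hq' v₁ r (toItem_val hq')
    refine ⟨v₂, s₁ + s₂ + 1 + 1, by omega, (((h₁.trans h₂)).head ?_).head
      (l := .dispatch) (y := ⟨some (.exec (toItem (.seq p q))),
        { v with item := some (toItem (.seq p q)) }, stk [] r m a [] []⟩) ?_⟩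
    · simp [machineStmt, execStmt, hv, stk, back, dcfg]
    · simp [machineStmt, stk]
  | @branchLeaf p q m a m' a' s h₁ ih₁ =>
    have hp' : p ∈ c.subs := Op.subs_trans (by simp [Op.subs, Op.self_mem_subs]) hp
    obtain ⟨v₁, s₁, hs₁, h₁⟩ := ih₁ hp' ⟨some false, some (toItem (.branch p q)), v.sym⟩
      r (toItem_val hp')
    refine ⟨v₁, s₁ + 1 + 1, by omega, (h₁.head ?_).head
      (l := .dispatch) (y := ⟨some (.exec (toItem (.branch p q))),
        { v with item := some (toItem (.branch p q)) },
        stk [] r (true :: false :: m) a [] []⟩) ?_⟩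
    · simp [machineStmt, execStmt, hv, stk, back, dcfg]
    · simp [machineStmt, stk]
  | @branchNode p q m a m' a' s h₁ ih₁ =>
    have hp' : q ∈ c.subs := Op.subs_trans (by simp [Op.subs, Op.self_mem_subs]) hp
    obtain ⟨v₁, s₁, hs₁, h₁⟩ := ih₁ hp' ⟨some true, some (toItem (.branch p q)), v.sym⟩
      r (toItem_val hp')
    refine ⟨v₁, s₁ + 1 + 1, by omega, (h₁.head ?_).head
      (l := .dispatch) (y := ⟨some (.exec (toItem (.branch p q))),
        { v with item := some (toItem (.branch p q)) },
        stk [] r (true :: true :: m) a [] []⟩) ?_⟩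
    · simp [machineStmt, execStmt, hv, stk, back, dcfg]
    · simp [machineStmt, stk]
  | @iterStop p m a =>
    refine ⟨⟨some false, some (toItem (.iter p)), v.sym⟩, 2, le_rfl, (Steps.one ?_).head
      (l := .dispatch) (y := ⟨some (.exec (toItem (.iter p))),
        { v with item := some (toItem (.iter p)) }, stk [] r (false :: m) a [] []⟩) ?_⟩
    · simp [machineStmt, execStmt, hv, stk, back, dcfg]
    · simp [machineStmt, stk]
  | @iterNext p m a m' a' m'' a'' s t h₁ h₂ ih₁ ih₂ =>
    have hp' : p ∈ c.subs := Op.subs_trans (by simp [Op.subs, Op.self_mem_subs]) hp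
    obtain ⟨v₁, s₁, hs₁, h₁⟩ := ih₁ hp' ⟨some true, some (toItem (.iter p)), v.sym⟩
      (toItem (.iter p) :: r) (toItem_val hp')
    obtain ⟨v₂, s₂, hs₂, h₂⟩ := ih₂ hp v₁ r hv
    refine ⟨v₂, s₁ + s₂ + 1 + 1, by omega, ((h₁.trans h₂).head ?_).head
      (l := .dispatch) (y := ⟨some (.exec (toItem (.iter p))),
        { v with item := some (toItem (.iter p)) },
        stk [] r (true :: m) a [] []⟩) ?_⟩
    · simp [machineStmt, execStmt, hv, stk, back, dcfg]
    · simp [machineStmt, stk]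

/-- The tree of an input symbol. -/
def symTree : Option Bool → BTree
  | none => .leaf
  | some b => .node .leaf (if b then .node .leaf .leaf else .leaf)

/-- The tree of the reversed input, put in front of a tree. -/
def loadTree : List (Option Bool) → BTree → BTree
  | [], x => x
  | s :: l, x => loadTree l (.node (symTree s) x)

theorem steps_load (l : List (Option Bool)) (x : BTree) (v : Reg c) :
    ∃ v', Steps (l.length + 1) ⟨some .load, v, stk l [] x.toks (fun _ => []) [] []⟩
      (dcfg v' [toItem c] (loadTree l x).toks fun _ => []) := by
  induction l generalizing v x with
  | nil =>
    exact ⟨_, Steps.one (by simp [machineStmt, stk, back, loadTree]; rfl)⟩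
  | cons s l ih =>
    obtain ⟨v', h⟩ := ih (.node (symTree s) x) { v with sym := some s }
    refine ⟨v', h.head ?_⟩
    rcases s with _ | _ | _ <;> simp [machineStmt, stk, loadSym, symTree, toks]

theorem steps_clean (m : List Bool) (v : Reg c) (o : List Bool) :
    Steps (m.length + 1) ⟨some .clean, v, stk [] [] m (fun _ => []) [] o⟩
      ⟨none, .init, stk [] [] [] (fun _ => []) [] o⟩ := by
  induction m generalizing v with
  | nil => exact Steps.one (by simp [machineStmt, stk])
  | cons t m ih =>
    exact (ih { v with tok := some t }).head (by simp [machineStmt, stk])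

/-- Whether a tree is a node. -/
def _root_.BTree.isNode : BTree → Bool
  | .leaf => false
  | .node _ _ => true

theorem steps_machine {l : List (Option Bool)} {y : BTree} {t : ℕ}
    (h : Exec c (loadTree l .leaf).toks (fun _ => []) y.toks (fun _ => []) t) :
    ∃ s ≤ l.length + y.size + t + 4, Steps s
      (⟨some .start, .init, stk l [] [] (fun _ => []) [] []⟩ : MCfg c)
      ⟨none, .init, stk [] [] [] (fun _ => []) [] [y.isNode]⟩ := by
  obtain ⟨v₁, h₁⟩ := steps_load (c := c) l .leaf .init
  obtain ⟨v₂, s, hs, h₂⟩ := steps_exec h c.self_mem_subs v₁ []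
  obtain ⟨k, m, hk⟩ : ∃ k m, y.toks = k :: m := by cases y <;> simp [toks]
  have hk' : k = y.isNode := by
    cases y <;> simp [toks] at hk <;> simp [BTree.isNode, hk.1]
  have h₃ := steps_clean (c := c) m ⟨some k, none, v₂.sym⟩ [y.isNode]
  have h₄ : Steps (m.length + 1 + 1) (dcfg v₂ [] y.toks fun _ => [])
      (⟨none, .init, stk [] [] [] (fun _ => []) [] [y.isNode]⟩ : MCfg c) :=
    h₃.head (by simp [machineStmt, stk, hk, hk'])
  have hl : m.length + 1 = y.size := by rw [← length_toks, hk]; rfl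
  refine ⟨_, ?_, (h₁.trans (h₂.trans h₄)).head ?_⟩
  · omega
  · simp [machineStmt, stk, toks]

end Machine

/-- A predicate decided by a program is decided by a Turing machine. -/
theorem inEXPTIME_of_exec {α : Type} (e : Computability.Encoding α (Option Bool)) (P : α → Prop)
    (c : Op) (p : Polynomial ℕ)
    (h : ∀ a, ∃ (y : BTree) (t : ℕ), Exec c (loadTree (e.encode a) .leaf).toks (fun _ => [])
      y.toks (fun _ => []) t ∧ (y.isNode = true ↔ P a) ∧
      (e.encode a).length + y.size + t + 4 ≤ 2 ^ p.eval (e.encode a).length) :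
    InEXPTIME e P := by
  classical
  refine ⟨{ tm := machine c
            inputAlphabet := Equiv.refl _
            outputAlphabet := Equiv.refl _
            time := fun n => 2 ^ p.eval n
            outputsFun := fun a => Classical.choice ?_ }, p, ?_, fun n => le_rfl⟩
  · obtain ⟨y, t, hx, hy, ht⟩ := h a
    obtain ⟨s, hs, hst⟩ := steps_machine hx
    refine ⟨⟨⟨s, ?_⟩, hs.trans ht⟩⟩
    have hd : decide (P a) = y.isNode := by
      by_cases hP : P a
      · simp [hP, hy.2 hP]
      · simp only [hP, decide_false]
        cases hn : y.isNode
        · rfl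
        · exact absurd (hy.1 hn) hP
    rw [hd]
    have e₁ : Turing.initList (machine c) (List.map (Equiv.refl _).invFun (e.encode a)) =
        (⟨some .start, .init, stk (e.encode a) [] [] (fun _ => []) [] []⟩ : MCfg c) := by
      simp only [Turing.initList]
      congr 1
      funext k
      cases k <;> simp [machine, stk]
      rfl
    have e₂ : Turing.haltList (machine c)
        (List.map (Equiv.refl _).invFun (Computability.encodeBool y.isNode)) =
        (⟨none, .init, stk [] [] [] (fun _ => []) [] [y.isNode]⟩ : MCfg c) := by
      simp only [Turing.haltList]
      congr 1
      funext k
      cases k <;> simp [machine, stk]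
      rfl
    have := hst
    unfold Steps at this
    rw [← e₁, ← e₂] at this
    exact this
  · exact (inferInstance : ∀ k : Stack, Finite (Alpha c k))

end StackMachine

/-! ## Running programs on trees -/

namespace StackMachine

open BTree Function

/-- No instruction adds more bits than it costs. Hence results are no larger than input plus running
time, so polynomial time entails polynomial output size. -/
theorem Exec.length_le {p m a m' a' t} (h : Exec p m a m' a' t) :
    m'.length + (a' false).length + (a' true).length ≤
      m.length + (a false).length + (a true).length + t := by
  induction h with
  | move b x m a => cases b <;> simp [length_toks] <;> omega
  | restore b m a | clear b m a => cases b <;> simp <;> omega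
  | copy m a | transfer m a => simp; omega
  | push t m a | pop t m a | iterStop => simp only [List.length_cons]; omega
  | _ => first | omega | (simp only [List.length_cons] at *; omega)

/-- The auxiliary stacks with contents `l` and `k`. -/
def auxOf (l k : List Bool) : Bool → List Bool := fun b => cond b k l

@[simp] theorem auxOf_false (l k) : auxOf l k false = l := rfl
@[simp] theorem auxOf_true (l k) : auxOf l k true = k := rfl
@[simp] theorem update_auxOf_false (l k x) : update (auxOf l k) false x = auxOf x k := by
  funext b; cases b <;> simp
@[simp] theorem update_auxOf_true (l k x) : update (auxOf l k) true x = auxOf l x := by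
  funext b; cases b <;> simp

theorem auxOf_nil : auxOf [] [] = fun _ => [] := by funext b; cases b <;> rfl

/-- `Does p m l k m' l' k' t`: the program `p` turns the stacks `m`, `l`, `k` into `m'`, `l'`, `k'`
at cost at most `t`. -/
def Does (p : Op) (m l k m' l' k' : List Bool) (t : ℕ) : Prop :=
  ∃ s ≤ t, Exec p m (auxOf l k) m' (auxOf l' k') s

theorem Does.mono {p m l k m' l' k' s t} (h : Does p m l k m' l' k' s) (hst : s ≤ t) :
    Does p m l k m' l' k' t := by
  obtain ⟨u, hu, h⟩ := h
  exact ⟨u, hu.trans hst, h⟩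

theorem Does.seq {p q m l k m' l' k' m'' l'' k'' s t} (h : Does p m l k m' l' k' s)
    (h' : Does q m' l' k' m'' l'' k'' t) : Does (.seq p q) m l k m'' l'' k'' (s + t + 2) := by
  obtain ⟨u, hu, h⟩ := h
  obtain ⟨v, hv, h'⟩ := h'
  exact ⟨_, by omega, .seq h h'⟩

theorem does_move_false (x : BTree) (m l k) :
    Does (.move false) (toks x ++ m) l k m ((toks x).reverse ++ l) k (x.size + 1) :=
  ⟨_, le_rfl, by simpa using Exec.move false x m (auxOf l k)⟩

theorem does_move_true (x : BTree) (m l k) :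
    Does (.move true) (toks x ++ m) l k m l ((toks x).reverse ++ k) (x.size + 1) :=
  ⟨_, le_rfl, by simpa using Exec.move true x m (auxOf l k)⟩

theorem does_restore_false (m l k) :
    Does (.restore false) m l k (l.reverse ++ m) [] k (l.length + 2) :=
  ⟨_, le_rfl, by simpa using Exec.restore false m (auxOf l k)⟩

theorem does_restore_true (m l k) :
    Does (.restore true) m l k (k.reverse ++ m) l [] (k.length + 2) :=
  ⟨_, le_rfl, by simpa using Exec.restore true m (auxOf l k)⟩

theorem does_clear_false (m l k) : Does (.clear false) m l k m [] k (l.length + 2) :=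
  ⟨_, le_rfl, by simpa using Exec.clear false m (auxOf l k)⟩

theorem does_clear_true (m l k) : Does (.clear true) m l k m l [] (k.length + 2) :=
  ⟨_, le_rfl, by simpa using Exec.clear true m (auxOf l k)⟩

theorem does_copy (m l k) :
    Does .copy m l k (l.reverse ++ m) [] (l.reverse ++ k) (l.length + 2) :=
  ⟨_, le_rfl, by simpa using Exec.copy m (auxOf l k)⟩

theorem does_transfer (m l k) :
    Does .transfer m l k m (k.reverse ++ l) [] (k.length + 2) :=
  ⟨_, le_rfl, by simpa using Exec.transfer m (auxOf l k)⟩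

theorem does_push (t m l k) : Does (.push t) m l k (t :: m) l k 2 := ⟨_, le_rfl, .push ..⟩

theorem does_pop (t m l k) : Does .pop (t :: m) l k m l k 2 := ⟨_, le_rfl, .pop ..⟩

/-- `Runs p xs ys t`: the program `p` replaces the trees `xs` on top of the main stack by the trees
`ys`, at cost at most `t`. -/
def Runs (p : Op) (xs ys : List BTree) (t : ℕ) : Prop :=
  ∀ r, Does p (xs.flatMap toks ++ r) [] [] (ys.flatMap toks ++ r) [] [] t

theorem Runs.mono {p xs ys s t} (h : Runs p xs ys s) (hst : s ≤ t) : Runs p xs ys t :=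
  fun r => (h r).mono hst

theorem Runs.frame {p xs ys t} (h : Runs p xs ys t) (zs) : Runs p (xs ++ zs) (ys ++ zs) t := by
  intro r
  simpa using h (zs.flatMap toks ++ r)

theorem Runs.seq {p q xs ys zs s t} (h : Runs p xs ys s) (h' : Runs q ys zs t) :
    Runs (.seq p q) xs zs (s + t + 2) := fun r => (h r).seq (h' r)

theorem Runs.exec {p x y t} (h : Runs p [x] [y] t) :
    ∃ s ≤ t, Exec p (toks x) (fun _ => []) (toks y) (fun _ => []) s := by
  simpa [Does, auxOf_nil] using h []

theorem Runs.size_le {p x y t} (h : Runs p [x] [y] t) : y.size ≤ x.size + t := by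
  obtain ⟨s, hs, h⟩ := h.exec
  have := h.length_le
  simp [length_toks] at this
  omega

/-- Duplicate the topmost tree. -/
def dup : Op := .seq (.move false) <| .seq .copy <| .seq .transfer <| .restore false

theorem runs_dup (x : BTree) : Runs dup [x] [x, x] (5 * x.size + 20) := by
  intro r
  have h₁ := does_move_false x r [] []
  have h₂ := does_copy r ((toks x).reverse ++ []) []
  have h₃ := does_transfer (toks x ++ r) [] (toks x)
  have h₄ := does_restore_false (toks x ++ r) (toks x).reverse []
  simp only [List.append_nil, List.reverse_reverse, List.length_reverse, length_toks] at *
  simp only [List.flatMap_cons, List.flatMap_nil, List.append_nil, List.append_assoc]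
  exact (h₁.seq (h₂.seq (h₃.seq h₄))).mono (by omega)

/-- Exchange the two topmost trees. -/
def swap : Op := .seq (.move false) <| .seq (.move true) <| .seq (.restore false) <| .restore true

theorem runs_swap (x y : BTree) : Runs swap [x, y] [y, x] (5 * (x.size + y.size) + 20) := by
  intro r
  have h₁ := does_move_false x (toks y ++ r) [] []
  have h₂ := does_move_true y r ((toks x).reverse ++ []) []
  have h₃ := does_restore_false r (toks x).reverse (toks y).reverse
  have h₄ := does_restore_true (toks x ++ r) [] (toks y).reverse
  simp only [List.append_nil, List.reverse_reverse, List.length_reverse, length_toks] at *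
  simp only [List.flatMap_cons, List.flatMap_nil, List.append_nil, List.append_assoc]
  exact (h₁.seq (h₂.seq (h₃.seq h₄))).mono (by omega)

/-- The left subtree. -/
def left : Op :=
  .seq .pop <| .seq (.move false) <| .seq (.move true) <| .seq (.clear true) <| .restore false

theorem runs_left (x y : BTree) : Runs left [node x y] [x] (5 * (x.size + y.size) + 20) := by
  intro r
  have h₀ := does_pop true (toks x ++ (toks y ++ r)) [] []
  have h₁ := does_move_false x (toks y ++ r) [] []
  have h₂ := does_move_true y r ((toks x).reverse ++ []) []
  have h₃ := does_clear_true r (toks x).reverse (toks y).reverse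
  have h₄ := does_restore_false r (toks x).reverse []
  simp only [List.append_nil, List.reverse_reverse, List.length_reverse, length_toks] at *
  simp only [List.flatMap_cons, List.flatMap_nil, List.append_nil, List.append_assoc, toks,
    List.cons_append]
  exact (h₀.seq (h₁.seq (h₂.seq (h₃.seq h₄)))).mono (by omega)

/-- The right subtree. -/
def right : Op := .seq .pop <| .seq (.move false) <| .clear false

theorem runs_right (x y : BTree) : Runs right [node x y] [y] (5 * (x.size + y.size) + 20) := by
  intro r
  have h₀ := does_pop true (toks x ++ (toks y ++ r)) [] []
  have h₁ := does_move_false x (toks y ++ r) [] []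
  have h₃ := does_clear_false (toks y ++ r) (toks x).reverse []
  simp only [List.append_nil, List.length_reverse, length_toks] at *
  simp only [List.flatMap_cons, List.flatMap_nil, List.append_nil, List.append_assoc, toks,
    List.cons_append]
  exact (h₀.seq (h₁.seq h₃)).mono (by omega)

/-- The leaf. -/
def mkLeaf : Op := .seq (.move false) <| .seq (.clear false) <| .push false

theorem runs_mkLeaf (x : BTree) : Runs mkLeaf [x] [leaf] (5 * x.size + 20) := by
  intro r
  have h₁ := does_move_false x r [] []
  have h₂ := does_clear_false r (toks x).reverse []
  have h₃ := does_push false r [] []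
  simp only [List.append_nil, List.length_reverse, length_toks] at *
  simp only [List.flatMap_cons, List.flatMap_nil, List.append_nil, toks,
    List.cons_append, List.nil_append]
  exact (h₁.seq (h₂.seq h₃)).mono (by omega)

theorem runs_push_true (x y : BTree) : Runs (.push true) [x, y] [node x y] 2 := by
  intro r
  simpa [toks] using does_push true (toks x ++ (toks y ++ r)) [] []

/-- The tree of the results of two programs. -/
def mkNode (p q : Op) : Op := .seq dup <| .seq p <| .seq swap <| .seq q <| .seq swap <| .push true

theorem runs_mkNode {p q x y z s t} (hp : Runs p [x] [y] s) (hq : Runs q [x] [z] t) :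
    Runs (mkNode p q) [x] [node y z] (s + t + 15 * (x.size + y.size + z.size) + 100) :=
  ((runs_dup x).seq ((hp.frame [x]).seq ((runs_swap y x).seq ((hq.frame [y]).seq
    ((runs_swap z y).seq (runs_push_true y z)))))).mono (by omega)

/-- The identity. -/
def skip : Op := .seq (.push false) .pop

theorem runs_skip (x : BTree) : Runs skip [x] [x] 6 := fun r => by
  simpa [skip] using (does_push false (toks x ++ r) [] []).seq (does_pop false (toks x ++ r) [] [])

theorem runs_branch_leaf {p q x ys t} (hp : Runs p [node leaf x] ys t) :
    Runs (.branch p q) [node leaf x] ys (t + 2) := fun r => by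
  obtain ⟨s, hs, h⟩ := hp r
  refine ⟨s + 2, by omega, ?_⟩
  simp only [List.flatMap_cons, toks, List.cons_append, List.nil_append] at h ⊢
  exact .branchLeaf h

theorem runs_branch_node {p q x y z ys t} (hp : Runs q [node (node x y) z] ys t) :
    Runs (.branch p q) [node (node x y) z] ys (t + 2) := fun r => by
  obtain ⟨s, hs, h⟩ := hp r
  refine ⟨s + 2, by omega, ?_⟩
  simp only [List.flatMap_cons, toks, List.cons_append] at h ⊢
  exact .branchNode h

theorem runs_iter_leaf (p x) : Runs (.iter p) [leaf, x] [x] 2 := fun r => by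
  refine ⟨_, le_rfl, ?_⟩
  simpa [toks] using Exec.iterStop

theorem runs_iter_node {p x y z ys zs s t} (hp : Runs p [x, y, z] ys s)
    (h : Runs (.iter p) ys zs t) : Runs (.iter p) [node x y, z] zs (s + t + 2) := fun r => by
  obtain ⟨u, hu, h₁⟩ := hp r
  obtain ⟨v, hv, h₂⟩ := h r
  refine ⟨u + v + 2, by omega, ?_⟩
  simp only [List.flatMap_cons, toks, List.cons_append, List.append_assoc] at h₁ ⊢
  exact .iterNext h₁ h₂

/-- Arrange the next element and the state as the argument of a loop body. -/
def arrange : Op := .seq (.move false) <| .seq (.move true) <| .seq (.move false) <|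
  .seq (.restore true) <| .seq (.restore false) <| .push true

theorem runs_arrange (x y z : BTree) :
    Runs arrange [x, y, z] [node x z, y] (5 * (x.size + y.size + z.size) + 30) := by
  intro r
  have h₁ := does_move_false x (toks y ++ (toks z ++ r)) [] []
  have h₂ := does_move_true y (toks z ++ r) ((toks x).reverse ++ []) []
  have h₃ := does_move_false z r (toks x).reverse (toks y).reverse
  have h₄ := does_restore_true r ((toks z).reverse ++ (toks x).reverse) (toks y).reverse
  have h₅ := does_restore_false (toks y ++ r) ((toks z).reverse ++ (toks x).reverse) []
  have h₆ := does_push true (toks x ++ (toks z ++ (toks y ++ r))) [] []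
  simp only [List.append_nil, List.reverse_reverse, List.length_reverse, length_toks,
    List.reverse_append, List.append_assoc, List.length_append] at *
  simp only [List.flatMap_cons, List.flatMap_nil, List.append_nil, List.append_assoc, toks,
    List.cons_append]
  exact (h₁.seq (h₂.seq (h₃.seq (h₄.seq (h₅.seq h₆))))).mono (by omega)

/-- Run a program for each element of a list, updating a state. -/
def forEach (p : Op) : Op := .seq .pop <| .iter <| .seq arrange <| .seq p swap

end StackMachine

/-! ## Feasible functions -/

/-- Representations of the elements of a type by trees. -/
class TEnc (α : Type) where
  enc : α → BTree

open TEnc StackMachine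

instance : TEnc Unit := ⟨fun _ => .leaf⟩

instance : TEnc Bool := ⟨fun b => if b then .node .leaf .leaf else .leaf⟩

instance {α β : Type} [TEnc α] [TEnc β] : TEnc (α × β) := ⟨fun p => .node (enc p.1) (enc p.2)⟩

instance {α : Type} [TEnc α] : TEnc (Option α) :=
  ⟨fun o => match o with
    | none => .leaf
    | some a => .node .leaf (enc a)⟩

/-- The tree of a list. -/
def encList {α : Type} [TEnc α] : List α → BTree
  | [] => .leaf
  | a :: l => .node (enc a) (encList l)

instance {α : Type} [TEnc α] : TEnc (List α) := ⟨encList⟩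

/-- Unary on purpose: arithmetic reduces to list operations, and the exponential blow-up against
binary is paid for by the padding. -/
instance : TEnc ℕ := ⟨fun n => encList (List.replicate n ())⟩

/-- A restricted domain keeps the same trees. This expresses that a branch of a program has to be
correct only where it is taken. -/
instance {α : Type} [TEnc α] {p : α → Prop} : TEnc {a // p a} := ⟨fun a => enc a.1⟩

/-- The size of the tree of an element. -/
def sz {α : Type} [TEnc α] (a : α) : ℕ := (enc a).size

/-- Case distinction on lists. -/
def lcase {β γ : Type} (l : List β) (n : γ) (c : β → List β → γ) : γ :=
  match l with
  | [] => n
  | b :: t => c b t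

@[simp] theorem lcase_nil {β γ : Type} (n : γ) (c : β → List β → γ) : lcase [] n c = n := rfl
@[simp] theorem lcase_cons {β γ : Type} (b : β) (t : List β) (n : γ) (c : β → List β → γ) :
    lcase (b :: t) n c = c b t := rfl

/-- Case distinction on numbers. -/
def ncase {γ : Type} (m : ℕ) (n : γ) (c : ℕ → γ) : γ :=
  match m with
  | 0 => n
  | m + 1 => c m

/-! ### Sizes, polynomial bounds and the basic closure properties -/

section Basic

variable {α β γ δ σ : Type} [TEnc α] [TEnc β] [TEnc γ] [TEnc δ] [TEnc σ]

theorem sz_pos (a : α) : 0 < sz a := BTree.size_pos _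

@[simp] theorem sz_pair (p : α × β) : sz p = sz p.1 + sz p.2 + 1 := rfl
@[simp] theorem sz_nil : sz ([] : List α) = 1 := rfl
@[simp] theorem sz_cons (a : α) (l : List α) : sz (a :: l) = sz a + sz l + 1 := rfl
@[simp] theorem sz_none : sz (none : Option α) = 1 := rfl
@[simp] theorem sz_some (a : α) : sz (some a) = sz a + 2 := by
  simp [sz, enc, BTree.size]; omega
@[simp] theorem sz_unit (a : Unit) : sz a = 1 := rfl
@[simp] theorem sz_subtype {p : α → Prop} (a : {a // p a}) : sz a = sz a.1 := rfl

theorem sz_bool_le (b : Bool) : sz b ≤ 3 := by cases b <;> simp [sz, enc, BTree.size]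

@[simp] theorem sz_nat (n : ℕ) : sz n = 2 * n + 1 := by
  induction n with
  | zero => rfl
  | succ n ih =>
    have : sz (n + 1) = 1 + sz n + 1 := rfl
    omega

theorem sz_append (l k : List α) : sz (l ++ k) + 1 = sz l + sz k := by
  induction l with
  | nil => simp; omega
  | cons a l ih => simp only [List.cons_append, sz_cons]; omega

theorem sz_reverse (l : List α) : sz l.reverse = sz l := by
  induction l with
  | nil => rfl
  | cons a l ih =>
    have := sz_append l.reverse [a]
    simp only [List.reverse_cons, sz_cons, sz_nil] at *
    omega

theorem length_le_sz (l : List α) : l.length ≤ sz l := by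
  induction l with
  | nil => simp
  | cons a l ih => simp only [List.length_cons, sz_cons]; omega

theorem sz_le_of_mem {a : α} {l : List α} (h : a ∈ l) : sz a ≤ sz l := by
  induction l with
  | nil => simp at h
  | cons b l ih =>
    rcases List.mem_cons.1 h with rfl | h
    · simp only [sz_cons]; omega
    · have := ih h; simp only [sz_cons]; omega

theorem sz_list_le {l : List α} {B : ℕ} (h : ∀ a ∈ l, sz a ≤ B) : sz l ≤ l.length * (B + 1) + 1 := by
  induction l with
  | nil => simp
  | cons a l ih =>
    have h₁ := h a (by simp)
    have h₂ := ih fun b hb => h b (by simp [hb])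
    simp only [List.length_cons, sz_cons, Nat.add_mul]
    omega

theorem sz_prefix_le {l l' : List α} (h : l' <+: l) : sz l' ≤ sz l := by
  obtain ⟨k, rfl⟩ := h
  have := sz_append l' k
  have := sz_pos k
  omega

/-- Functions bounded by a polynomial in the size of the argument. -/
@[fun_prop]
def PolyBdd (f : α → ℕ) : Prop := ∃ k, ∀ a, f a ≤ (sz a + 2) ^ k

theorem PolyBdd.of_le {f g : α → ℕ} (hg : PolyBdd g) (h : ∀ a, f a ≤ g a) : PolyBdd f := by
  obtain ⟨k, hk⟩ := hg
  exact ⟨k, fun a => (h a).trans (hk a)⟩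

@[fun_prop]
theorem PolyBdd.const (n : ℕ) : PolyBdd fun _ : α => n :=
  ⟨n, fun _ => n.lt_two_pow_self.le.trans (Nat.pow_le_pow_left (by omega) n)⟩

@[fun_prop]
theorem PolyBdd.mul {f g : α → ℕ} (hf : PolyBdd f) (hg : PolyBdd g) : PolyBdd fun a => f a * g a := by
  obtain ⟨j, hj⟩ := hf
  obtain ⟨k, hk⟩ := hg
  exact ⟨j + k, fun a => by rw [pow_add]; exact Nat.mul_le_mul (hj a) (hk a)⟩

@[fun_prop]
theorem PolyBdd.add {f g : α → ℕ} (hf : PolyBdd f) (hg : PolyBdd g) : PolyBdd fun a => f a + g a := by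
  obtain ⟨j, hj⟩ := hf
  obtain ⟨k, hk⟩ := hg
  refine ⟨j + k + 1, fun a => ?_⟩
  have h₁ : (sz a + 2) ^ j ≤ (sz a + 2) ^ (j + k) := Nat.pow_le_pow_right (by omega) (by omega)
  have h₂ : (sz a + 2) ^ k ≤ (sz a + 2) ^ (j + k) := Nat.pow_le_pow_right (by omega) (by omega)
  calc f a + g a ≤ (sz a + 2) ^ (j + k) * 2 := by linarith [hj a, hk a]
    _ ≤ (sz a + 2) ^ (j + k) * (sz a + 2) := Nat.mul_le_mul_left _ (by omega)
    _ = _ := by rw [pow_succ]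

@[fun_prop]
theorem PolyBdd.pow {f : α → ℕ} (hf : PolyBdd f) (n : ℕ) : PolyBdd fun a => f a ^ n := by
  obtain ⟨j, hj⟩ := hf
  exact ⟨j * n, fun a => by rw [pow_mul]; exact Nat.pow_le_pow_left (hj a) n⟩

theorem PolyBdd.sz_id : PolyBdd fun a : α => sz a :=
  ⟨1, fun a => by simp⟩

theorem PolyBdd.comp {f : α → β} {g : β → ℕ} (hg : PolyBdd g) (hf : PolyBdd fun a => sz (f a)) :
    PolyBdd fun a => g (f a) := by
  obtain ⟨k, hk⟩ := hg
  exact ((hf.add (.const 2)).pow k).of_le fun a => hk (f a)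

/-- Functions computed by a program in polynomial time. -/
@[fun_prop]
def Feas (f : α → β) : Prop :=
  ∃ (p : Op) (T : α → ℕ), PolyBdd T ∧ ∀ a, Runs p [enc a] [enc (f a)] (T a)

-- A program cannot write more than it is paid for (`Runs.size_le`); this is what makes costs
-- compose.
@[fun_prop]
theorem Feas.poly_sz {f : α → β} (hf : Feas f) : PolyBdd fun a => sz (f a) := by
  obtain ⟨p, T, hT, h⟩ := hf
  exact (PolyBdd.sz_id.add hT).of_le fun a => (h a).size_le

/-- Only the trees of the results matter. -/
theorem Feas.of_enc_eq {f : α → β} {g : α → γ} (hf : Feas f) (h : ∀ a, enc (g a) = enc (f a)) :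
    Feas g := by
  obtain ⟨p, T, hT, hp⟩ := hf
  exact ⟨p, T, hT, fun a => by rw [h]; exact hp a⟩

theorem Feas.congr {f g : α → β} (hf : Feas f) (h : ∀ a, g a = f a) : Feas g :=
  hf.of_enc_eq fun a => by rw [h]

@[fun_prop]
theorem Feas.id : Feas fun a : α => a :=
  ⟨skip, fun _ => 6, .const 6, fun _ => runs_skip _⟩

@[fun_prop]
theorem Feas.comp {f : α → β} {g : β → γ} (hg : Feas g) (hf : Feas f) :
    Feas fun a => g (f a) := by
  have hf' := hf.poly_sz
  obtain ⟨p, T, hT, hp⟩ := hf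
  obtain ⟨q, U, hU, hq⟩ := hg
  exact ⟨.seq p q, fun a => T a + U (f a) + 2, (hT.add (hU.comp hf')).add (.const 2),
    fun a => (hp a).seq (hq (f a))⟩

@[fun_prop]
theorem Feas.prodMk {f : α → β} {g : α → γ} (hf : Feas f) (hg : Feas g) :
    Feas fun a => (f a, g a) := by
  have hf' := hf.poly_sz
  have hg' := hg.poly_sz
  obtain ⟨p, T, hT, hp⟩ := hf
  obtain ⟨q, U, hU, hq⟩ := hg
  refine ⟨mkNode p q, fun a => T a + U a + 15 * (sz a + sz (f a) + sz (g a)) + 100, ?_,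
    fun a => runs_mkNode (hp a) (hq a)⟩
  exact ((hT.add hU).add ((PolyBdd.const 15).mul ((PolyBdd.sz_id.add hf').add hg'))).add (.const 100)

@[fun_prop]
theorem Feas.fst {f : α → β × γ} (hf : Feas f) : Feas fun a => (f a).1 := by
  refine Feas.comp (g := Prod.fst) ⟨left, fun p : β × γ => 5 * sz p + 20,
    ((PolyBdd.const 5).mul PolyBdd.sz_id).add (.const 20), fun a => (runs_left _ _).mono ?_⟩ hf
  have e := sz_pair a
  simp only [sz] at e ⊢
  omega

@[fun_prop]
theorem Feas.snd {f : α → β × γ} (hf : Feas f) : Feas fun a => (f a).2 := by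
  refine Feas.comp (g := Prod.snd) ⟨right, fun p : β × γ => 5 * sz p + 20,
    ((PolyBdd.const 5).mul PolyBdd.sz_id).add (.const 20), fun a => (runs_right _ _).mono ?_⟩ hf
  have e := sz_pair a
  simp only [sz] at e ⊢
  omega

/-- A program replacing a tree by a given one. -/
theorem exists_runs_const (y : BTree) : ∃ p C, ∀ x, Runs p [x] [y] (C * x.size + C) := by
  induction y with
  | leaf => exact ⟨mkLeaf, 20, fun x => (runs_mkLeaf x).mono (by omega)⟩
  | node y z ihy ihz =>
    obtain ⟨p, C, hp⟩ := ihy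
    obtain ⟨q, D, hq⟩ := ihz
    refine ⟨mkNode p q, C + D + 15 * (y.size + z.size) + 200, fun x =>
      (runs_mkNode (hp x) (hq x)).mono ?_⟩
    nlinarith [x.size_pos]

@[fun_prop]
theorem Feas.const (b : β) : Feas fun _ : α => b := by
  obtain ⟨p, C, hp⟩ := exists_runs_const (enc b)
  exact ⟨p, fun a => C * sz a + C, ((PolyBdd.const C).mul PolyBdd.sz_id).add (.const C),
    fun a => hp _⟩

@[fun_prop]
theorem Feas.subtype_val {p : β → Prop} {f : α → {b // p b}} (hf : Feas f) :
    Feas fun a => (f a).1 := hf.of_enc_eq fun _ => rfl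

/-- Case distinction on whether the tree of an element is a leaf. -/
theorem Feas.ofBranch {c : α → γ} (hc : Feas c) {P₀ P₁ : α → Prop} {F : α → β}
    {n : {a // P₀ a} → β} {g : δ × {a // P₁ a} → β} (hn : Feas n) (hg : Feas g)
    (h : ∀ a, (∃ h₀ : P₀ a, enc (c a) = .leaf ∧ F a = n ⟨a, h₀⟩) ∨
      ∃ (h₁ : P₁ a) (d : δ), enc (c a) = enc d ∧ (∃ x y, enc d = .node x y) ∧
        F a = g (d, ⟨a, h₁⟩)) : Feas F := by
  have hs := (hc.prodMk Feas.id).poly_sz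
  obtain ⟨p₀, T₀, ⟨k₀, hT₀⟩, h₀⟩ := hn
  obtain ⟨p₁, T₁, ⟨k₁, hT₁⟩, h₁⟩ := hg
  obtain ⟨p, T, hT, hp⟩ := hc.prodMk Feas.id
  -- The branch sees the tree of `(c a, a)`. A leaf `c a` is discarded; a node is handed on, reread
  -- as an element `d` of another type with the same tree. `T₀` and `T₁` exist only on the
  -- restricted domains, so their polynomial bounds stand in for them.
  refine ⟨.seq p (.branch (.seq right p₀) p₁), fun a => T a + (5 * sz (c a, a) + 24 +
    (sz (c a, a) + 2) ^ k₀ + (sz (c a, a) + 2) ^ k₁) + 2, ?_, fun a => ?_⟩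
  · exact (hT.add (((((PolyBdd.const 5).mul hs).add (.const 24)).add
      ((hs.add (.const 2)).pow k₀)).add ((hs.add (.const 2)).pow k₁))).add (.const 2)
  · refine (hp a).seq ?_
    have e : enc (c a, a) = .node (enc (c a)) (enc a) := rfl
    rcases h a with ⟨ha, hl, hF⟩ | ⟨ha, d, hd, ⟨x, y, hxy⟩, hF⟩
    · rw [e, hl, hF]
      refine (runs_branch_leaf ((runs_right _ (enc a)).seq (h₀ ⟨a, ha⟩))).mono ?_
      have h₂ := hT₀ ⟨a, ha⟩
      have h₃ : (sz a + 2) ^ k₀ ≤ (sz (c a, a) + 2) ^ k₀ :=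
        Nat.pow_le_pow_left (by simp; omega) _
      simp only [sz_subtype] at h₂
      have h₄ : BTree.leaf.size + (enc a).size ≤ sz (c a, a) := by
        have e₁ := sz_pair (c a, a)
        have e₂ := sz_pos (c a)
        simp only [sz] at e₁ e₂ ⊢
        simp only [BTree.size]
        omega
      have e₃ : enc (⟨a, ha⟩ : {a // P₀ a}) = enc a := rfl
      rw [e₃] at *
      omega
    · have e' : enc (d, (⟨a, ha⟩ : {a // P₁ a})) = .node (enc d) (enc a) := rfl
      have h₂ := hT₁ (d, ⟨a, ha⟩)
      have h₄ := h₁ (d, ⟨a, ha⟩)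
      have e'' : sz (d, (⟨a, ha⟩ : {a // P₁ a})) = sz (c a, a) := by
        rw [sz, sz, e', e, hd]
      rw [e''] at h₂
      rw [e', hxy] at h₄
      rw [e, hd, hxy, hF]
      exact (runs_branch_node h₄).mono (by omega)

theorem Feas.restrict {f : α → β} (hf : Feas f) (p : α → Prop) :
    Feas fun a : {a // p a} => f a.1 := hf.comp (Feas.id.subtype_val)

@[fun_prop]
theorem Feas.lcase {l : α → List β} {n : α → γ} {c : α → β → List β → γ} (hl : Feas l)
    (hn : Feas n) (hc : Feas fun p : α × β × List β => c p.1 p.2.1 p.2.2) :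
    Feas fun a => lcase (l a) (n a) (c a) := by
  refine Feas.ofBranch hl (δ := β × List β) (P₀ := fun _ => True) (P₁ := fun _ => True)
    (hn.restrict _)
    (g := fun p => c p.2.1 p.1.1 p.1.2)
    (hc.comp (f := fun p : (β × List β) × {_a : α // True} => (p.2.1, p.1)) (by fun_prop))
    fun a => ?_
  cases h : l a with
  | nil => exact .inl ⟨trivial, rfl, rfl⟩
  | cons b t => exact .inr ⟨trivial, (b, t), rfl, ⟨_, _, rfl⟩, rfl⟩

@[fun_prop]
theorem Feas.option_elim {o : α → Option β} {n : α → γ} {c : α → β → γ} (ho : Feas o)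
    (hn : Feas n) (hc : Feas fun p : α × β => c p.1 p.2) :
    Feas fun a => (o a).elim (n a) (c a) := by
  refine Feas.ofBranch ho (δ := Unit × β) (P₀ := fun _ => True) (P₁ := fun _ => True)
    (hn.restrict _)
    (g := fun p => c p.2.1 p.1.2)
    (hc.comp (f := fun p : (Unit × β) × {_a : α // True} => (p.2.1, p.1.2)) (by fun_prop))
    fun a => ?_
  cases h : o a with
  | none => exact .inl ⟨trivial, rfl, rfl⟩
  | some b => exact .inr ⟨trivial, ((), b), rfl, ⟨_, _, rfl⟩, rfl⟩

@[fun_prop]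
theorem Feas.ncase {o : α → ℕ} {n : α → γ} {c : α → ℕ → γ} (ho : Feas o)
    (hn : Feas n) (hc : Feas fun p : α × ℕ => c p.1 p.2) :
    Feas fun a => ncase (o a) (n a) (c a) := by
  refine Feas.ofBranch ho (δ := Unit × ℕ) (P₀ := fun _ => True) (P₁ := fun _ => True)
    (hn.restrict _)
    (g := fun p => c p.2.1 p.1.2)
    (hc.comp (f := fun p : (Unit × ℕ) × {_a : α // True} => (p.2.1, p.1.2)) (by fun_prop))
    fun a => ?_
  cases h : o a with
  | zero => exact .inl ⟨trivial, rfl, rfl⟩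
  | succ b => exact .inr ⟨trivial, ((), b), rfl, ⟨_, _, rfl⟩, rfl⟩

/-- Case distinction on a Boolean, where each case only has to be feasible on its domain. -/
theorem Feas.cond_restrict {b : α → Bool} {F : α → β} (hb : Feas b)
    (h₀ : Feas fun a : {a // b a = false} => F a.1) (h₁ : Feas fun a : {a // b a = true} => F a.1) :
    Feas F := by
  refine Feas.ofBranch hb (δ := Unit × Unit) h₀
    (g := fun p => F p.2.1)
    (h₁.comp (f := fun p : (Unit × Unit) × {a : α // b a = true} => p.2) (by fun_prop))
    fun a => ?_
  by_cases h : b a = true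
  · exact .inr ⟨h, ((), ()), by rw [h]; rfl, ⟨_, _, rfl⟩, rfl⟩
  · exact .inl ⟨by simpa using h, by rw [Bool.eq_false_iff.2 h]; rfl, rfl⟩

@[fun_prop]
theorem Feas.cond {b : α → Bool} {f g : α → β} (hb : Feas b) (hf : Feas f) (hg : Feas g) :
    Feas fun a => cond (b a) (f a) (g a) :=
  Feas.cond_restrict hb ((hg.restrict _).congr fun a => by simp [a.2])
    ((hf.restrict _).congr fun a => by simp [a.2])

end Basic

section

open TEnc StackMachine

/-! ### Folds with bounded accumulators, and list and number functions obtained from them -/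

section Loops

variable {α β γ δ σ : Type} [TEnc α] [TEnc β] [TEnc γ] [TEnc δ] [TEnc σ]

/-- The cost of a loop. -/
theorem runs_forEach {p : Op} {f : σ → β → σ} {l : List β} {s : σ} {B C : ℕ}
    (hB : ∀ l', l' <+: l → sz (l'.foldl f s) ≤ B)
    (hp : ∀ pre b, pre ++ [b] <+: l →
      Runs p [enc (b, pre.foldl f s)] [enc ((pre ++ [b]).foldl f s)] C) :
    Runs (forEach p) [enc (l, s)] [enc (l.foldl f s)]
      (l.length * (C + 10 * (sz l + B) + 60) + 10) := by
  have key : ∀ suf pre, pre ++ suf = l →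
      Runs (.iter (.seq arrange (.seq p swap))) [enc suf, enc (pre.foldl f s)]
        [enc (l.foldl f s)] (suf.length * (C + 10 * (sz l + B) + 60) + 2) := by
    intro suf
    induction suf with
    | nil =>
      rintro pre rfl
      rw [List.append_nil, List.length_nil, Nat.zero_mul]
      exact runs_iter_leaf _ _
    | cons b suf ih =>
      intro pre h
      have h' : pre ++ [b] <+: l := ⟨suf, by simpa using h⟩
      have h₁ := runs_arrange (enc b) (enc suf) (enc (pre.foldl f s))
      have h₂ := (hp pre b h').frame [enc suf]
      have h₃ := runs_swap (enc ((pre ++ [b]).foldl f s)) (enc suf)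
      have h₄ := ih (pre ++ [b]) (by simpa using h)
      have h₅ := runs_iter_node (h₁.seq (h₂.seq h₃)) h₄
      refine h₅.mono ?_
      have e₁ := hB pre ((List.prefix_append _ _).trans h')
      have e₂ := hB _ h'
      have e₃ : sz b + sz suf ≤ sz l := by
        rw [← h]
        have := sz_append pre (b :: suf)
        have := sz_pos pre
        simp only [sz_cons] at *
        omega
      simp only [sz, List.length_cons, Nat.add_mul] at *
      omega
  have h₁ : Runs Op.pop [enc (l, s)] [enc l, enc s] 2 := fun r => by
    simpa [enc, BTree.toks] using does_pop true ((enc l).toks ++ ((enc s).toks ++ r)) [] []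
  exact (h₁.seq (key l [] rfl)).mono (by omega)

@[fun_prop]
theorem PolyBdd.id : PolyBdd fun n : ℕ => n := PolyBdd.sz_id.of_le fun n => by simp; omega

@[fun_prop]
theorem Feas.polyBdd {f : α → ℕ} (hf : Feas f) : PolyBdd f :=
  hf.poly_sz.of_le fun a => by simp; omega

/-- Loops over lists, with a polynomial bound on the cost in terms of the sizes of the list, of the
parameter and of the intermediate results. -/
theorem exists_runs_foldl {f : α → σ → β → σ} (hf : Feas fun p : α × σ × β => f p.1 p.2.1 p.2.2) :
    ∃ p k, ∀ a l s B, (∀ l', l' <+: l → sz (l'.foldl (f a) s) ≤ B) →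
      Runs p [enc (l, (s, a))] [enc (l.foldl (f a) s)] ((sz l + sz a + B + 2) ^ k) := by
  -- A loop body sees only the next element and the state, so the parameter travels in the state and
  -- is dropped by `left` at the end.
  obtain ⟨p, T, ⟨k, hT⟩, hp⟩ : Feas fun t : β × σ × α => (f t.2.2 t.2.1 t.1, t.2.2) :=
    (hf.comp (f := fun t : β × σ × α => (t.2.2, t.2.1, t.1)) (by fun_prop)).prodMk (by fun_prop)
  obtain ⟨j, hj⟩ : PolyBdd fun X : ℕ =>
      X * ((X + 2) ^ k + 10 * (X + X) + 60) + 10 + (5 * X + 20) + 2 := by fun_prop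
  refine ⟨.seq (forEach p) left, 2 * j, fun a l s B hB => ?_⟩
  have hfold : ∀ (l : List β) (s : σ), l.foldl (fun t b => (f t.2 t.1 b, t.2)) (s, a) =
      (l.foldl (f a) s, a) := by
    intro l
    induction l with
    | nil => exact fun s => rfl
    | cons b l ih => exact fun s => ih _
  set X := sz l + sz a + B + 2 with hX
  have h₁ := runs_forEach (p := p) (f := fun t b => (f t.2 t.1 b, t.2)) (l := l) (s := (s, a))
    (B := X) (C := (X + 2) ^ k) (fun l' h => by
      have := hB l' h
      rw [hfold, sz_pair]
      simp only
      omega) (fun pre b h => by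
      have h₂ := hp (b, pre.foldl (f a) s, a)
      have h₃ := hT (b, pre.foldl (f a) s, a)
      have h₄ := hB pre ((List.prefix_append _ _).trans h)
      have h₅ : sz b ≤ sz l := sz_le_of_mem (h.subset (by simp))
      rw [List.foldl_append, hfold]
      refine h₂.mono (h₃.trans (Nat.pow_le_pow_left ?_ k))
      simp only [sz_pair]
      omega)
  rw [hfold] at h₁
  refine (h₁.seq (runs_left _ _)).mono ?_
  have h₂ := hj X
  -- The unary tree of `X` has size `2 * X + 1`, and `2 * X + 3 ≤ X ^ 2` as soon as `X ≥ 3`; hence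
  -- the exponent `2 * j`.
  have h₃ : (sz X + 2) ^ j ≤ X ^ (2 * j) := by
    rw [pow_mul]
    refine Nat.pow_le_pow_left ?_ j
    rw [sz_nat]
    have : 3 ≤ X := by have := sz_pos a; omega
    nlinarith
  refine le_trans ?_ (h₂.trans h₃)
  have h₄ : l.length * ((X + 2) ^ k + 10 * (sz l + X) + 60) ≤
      X * ((X + 2) ^ k + 10 * (X + X) + 60) := by
    refine Nat.mul_le_mul ?_ ?_
    · have := length_le_sz l
      omega
    · omega
  have h₅ := hB l List.prefix_rfl
  simp only [sz] at *
  omega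

/-- The bound on all intermediate accumulators cannot be dispensed with: iterating a feasible body,
doubling for instance, may produce exponentially large results. -/
theorem Feas.foldl {l : α → List β} {s : α → σ} {f : α → σ → β → σ} (hl : Feas l) (hs : Feas s)
    (hf : Feas fun p : α × σ × β => f p.1 p.2.1 p.2.2) {B : α → ℕ} (hB : PolyBdd B)
    (h : ∀ a l', l' <+: l a → sz (l'.foldl (f a) (s a)) ≤ B a) :
    Feas fun a => (l a).foldl (f a) (s a) := by
  obtain ⟨p, k, hp⟩ := exists_runs_foldl hf
  have hl' := hl.poly_sz
  obtain ⟨q, T, hT, hq⟩ : Feas fun a => (l a, (s a, a)) := by fun_prop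
  refine ⟨.seq q p, fun a => T a + (sz (l a) + sz a + B a + 2) ^ k + 2, ?_,
    fun a => (hq a).seq (hp a (l a) (s a) (B a) (h a))⟩
  have := PolyBdd.sz_id (α := α)
  fun_prop

/-! ### Lists -/

@[fun_prop]
theorem Feas.cons {f : α → β} {l : α → List β} (hf : Feas f) (hl : Feas l) :
    Feas fun a => f a :: l a := (hf.prodMk hl).of_enc_eq fun _ => rfl

@[fun_prop]
theorem Feas.some {f : α → β} (hf : Feas f) : Feas fun a => some (f a) :=
  ((Feas.const ()).prodMk hf).of_enc_eq fun _ => rfl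

@[fun_prop]
theorem Feas.reverse {l : α → List β} (hl : Feas l) : Feas fun a => (l a).reverse := by
  have key : ∀ l k : List β, l.foldl (fun s b => b :: s) k = l.reverse ++ k := by
    intro l
    induction l with
    | nil => simp
    | cons b l ih => simp [ih]
  refine (Feas.foldl (f := fun _ s b => b :: s) hl (.const []) (by fun_prop) hl.poly_sz ?_).congr
    (g := fun a => (l a).reverse) fun a => by rw [key]; simp
  intro a l' h
  rw [key, List.append_nil, sz_reverse]
  exact sz_prefix_le h

@[fun_prop]
theorem Feas.append {l k : α → List β} (hl : Feas l) (hk : Feas k) : Feas fun a => l a ++ k a := by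
  have key : ∀ l k : List β, l.foldl (fun s b => b :: s) k = l.reverse ++ k := by
    intro l
    induction l with
    | nil => simp
    | cons b l ih => simp [ih]
  refine (Feas.foldl (f := fun _ s b => b :: s) hl.reverse hk (by fun_prop)
    (hl.poly_sz.add hk.poly_sz) ?_).congr fun a => by rw [key]; simp
  intro a l' h
  rw [key]
  have h₁ := sz_prefix_le h
  have h₂ := sz_append l'.reverse (k a)
  rw [sz_reverse] at h₁ h₂
  omega

@[fun_prop]
theorem Feas.flatMap {l : α → List β} {g : α → β → List γ} (hl : Feas l)
    (hg : Feas fun p : α × β => g p.1 p.2) : Feas fun a => (l a).flatMap (g a) := by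
  obtain ⟨k, hk⟩ := hg.poly_sz
  have key : ∀ a (l : List β) s, l.foldl (fun s b => s ++ g a b) s = s ++ l.flatMap (g a) := by
    intro a l
    induction l with
    | nil => simp
    | cons b l ih => simp [ih]
  have hl' := hl.poly_sz
  have hid := PolyBdd.sz_id (α := α)
  refine (Feas.foldl (f := fun a s b => s ++ g a b) (s := fun _ => [])
    (B := fun a => sz (l a) * (sz a + sz (l a) + 1 + 2) ^ k + 1) hl (.const [])
    ?_ ?_ ?_).congr fun a => by rw [key]; simp
  · exact Feas.append (by fun_prop)
      (hg.comp (f := fun p : α × List γ × β => (p.1, p.2.2)) (by fun_prop))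
  · fun_prop
  · intro a l' h
    rw [key, List.nil_append]
    have h₁ : sz (l'.flatMap (g a)) ≤ l'.length * (sz a + sz (l a) + 1 + 2) ^ k + 1 := by
      have hmem : ∀ b ∈ l', sz b ≤ sz (l a) := fun b hb => sz_le_of_mem (h.subset hb)
      clear h
      induction l' with
      | nil => simp
      | cons b l' ih =>
        have h₂ := ih fun c hc => hmem c (by simp [hc])
        have h₃ := hk (a, b)
        have h₄ : (sz (a, b) + 2) ^ k ≤ (sz a + sz (l a) + 1 + 2) ^ k := by
          refine Nat.pow_le_pow_left ?_ k
          have := hmem b (by simp)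
          simp only [sz_pair]; omega
        have h₅ := sz_append (g a b) (l'.flatMap (g a))
        simp only [List.flatMap_cons, List.length_cons, Nat.add_mul, Nat.one_mul] at *
        omega
    have h₂ : l'.length ≤ sz (l a) := h.length_le.trans (length_le_sz _)
    exact h₁.trans (Nat.add_le_add_right (Nat.mul_le_mul_right _ h₂) 1)

@[fun_prop]
theorem Feas.map {l : α → List β} {g : α → β → γ} (hl : Feas l)
    (hg : Feas fun p : α × β => g p.1 p.2) : Feas fun a => (l a).map (g a) :=
  (Feas.flatMap (g := fun a b => [g a b]) hl (hg.cons (.const []))).congr fun a => by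
    rw [List.map_eq_flatMap]

@[fun_prop]
theorem Feas.filter {l : α → List β} {g : α → β → Bool} (hl : Feas l)
    (hg : Feas fun p : α × β => g p.1 p.2) : Feas fun a => (l a).filter (g a) := by
  refine (Feas.flatMap (g := fun a b => bif g a b then [b] else []) hl (by fun_prop)).congr
    fun a => ?_
  induction l a with
  | nil => rfl
  | cons b l ih => rw [List.filter_cons, List.flatMap_cons, ih]; cases g a b <;> rfl

@[fun_prop]
theorem Feas.or {f g : α → Bool} (hf : Feas f) (hg : Feas g) : Feas fun a => f a || g a :=
  (Feas.cond hf (.const true) hg).congr fun a => by cases f a <;> rfl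

@[fun_prop]
theorem Feas.and {f g : α → Bool} (hf : Feas f) (hg : Feas g) : Feas fun a => f a && g a :=
  (Feas.cond hf hg (.const false)).congr fun a => by cases f a <;> rfl

@[fun_prop]
theorem Feas.not {f : α → Bool} (hf : Feas f) : Feas fun a => !f a :=
  (Feas.cond hf (.const false) (.const true)).congr fun a => by cases f a <;> rfl

@[fun_prop]
theorem Feas.any {l : α → List β} {g : α → β → Bool} (hl : Feas l)
    (hg : Feas fun p : α × β => g p.1 p.2) : Feas fun a => (l a).any (g a) := by
  have key : ∀ a (l : List β) s, l.foldl (fun s b => s || g a b) s = (s || l.any (g a)) := by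
    intro a l
    induction l with
    | nil => simp
    | cons b l ih => intro s; simp [ih, Bool.or_assoc]
  refine (Feas.foldl (f := fun a s b => s || g a b) (s := fun _ => false) hl (.const false)
    ?_ (.const 3) fun a l' _ => sz_bool_le _).congr fun a => by rw [key]; simp
  exact Feas.or (by fun_prop)
    (hg.comp (f := fun p : α × Bool × β => (p.1, p.2.2)) (by fun_prop))

@[fun_prop]
theorem Feas.all {l : α → List β} {g : α → β → Bool} (hl : Feas l)
    (hg : Feas fun p : α × β => g p.1 p.2) : Feas fun a => (l a).all (g a) :=
  (Feas.any (g := fun a b => !g a b) hl hg.not).not.congr fun a => by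
    simp [List.not_any_eq_all_not]

@[fun_prop]
theorem Feas.tail {l : α → List β} (hl : Feas l) : Feas fun a => (l a).tail :=
  (Feas.lcase (c := fun _ _ t => t) hl (.const []) (by fun_prop)).congr fun a => by
    cases l a <;> rfl

@[fun_prop]
theorem Feas.headD {l : α → List β} {d : α → β} (hl : Feas l) (hd : Feas d) :
    Feas fun a => (l a).headD (d a) :=
  (Feas.lcase (c := fun _ b _ => b) hl hd (by fun_prop)).congr fun a => by
    cases l a <;> rfl

/-! ### Numbers -/

/-- A number and the list of that many units have the same tree, so arithmetic and bounded loops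
come from list operations. -/
theorem Feas.units {f : α → ℕ} (hf : Feas f) : Feas fun a => List.replicate (f a) () :=
  hf.of_enc_eq fun _ => rfl

theorem Feas.length_units {l : α → List Unit} (hl : Feas l) : Feas fun a => (l a).length :=
  hl.of_enc_eq fun a => by
    change encList _ = encList _
    congr 1
    exact (List.eq_replicate_of_mem fun _ _ => rfl).symm

@[fun_prop]
theorem Feas.length {l : α → List β} (hl : Feas l) : Feas fun a => (l a).length :=
  (Feas.length_units (Feas.map (g := fun _ _ => ()) hl (by fun_prop))).congr fun a => by simp

@[fun_prop]
theorem Feas.succ {f : α → ℕ} (hf : Feas f) : Feas fun a => f a + 1 :=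
  ((Feas.const ()).cons hf.units).of_enc_eq fun _ => rfl

@[fun_prop]
theorem Feas.pred {f : α → ℕ} (hf : Feas f) : Feas fun a => f a - 1 :=
  (Feas.ncase (c := fun _ m => m) hf (.const 0) (by fun_prop)).congr fun a => by
    cases f a <;> rfl

@[fun_prop]
theorem Feas.add {f g : α → ℕ} (hf : Feas f) (hg : Feas g) : Feas fun a => f a + g a :=
  (hf.units.append hg.units).length_units.congr fun a => by simp

@[fun_prop]
theorem Feas.mul {f g : α → ℕ} (hf : Feas f) (hg : Feas g) : Feas fun a => f a * g a :=
  (Feas.flatMap (g := fun a _ => List.replicate (g a) ()) hf.units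
    (Feas.units (hg.comp Feas.id.fst))).length_units.congr fun a => by simp

@[fun_prop]
theorem Feas.sub {f g : α → ℕ} (hf : Feas f) (hg : Feas g) : Feas fun a => f a - g a := by
  have key : ∀ (l : List Unit) (n : ℕ), l.foldl (fun s _ => s - 1) n = n - l.length := by
    intro l
    induction l with
    | nil => simp
    | cons b l ih => intro n; simp [ih]; omega
  refine (Feas.foldl (f := fun _ s _ => s - 1) hg.units hf (by fun_prop) hf.poly_sz ?_).congr
    fun a => by rw [key]; simp
  intro a l' _
  rw [key]
  simp

@[fun_prop]
theorem Feas.le {f g : α → ℕ} (hf : Feas f) (hg : Feas g) : Feas fun a => decide (f a ≤ g a) :=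
  (Feas.ncase (c := fun _ _ => false) (hf.sub hg) (.const true) (.const false)).congr fun a => by
    rcases h : f a - g a with _ | n
    · simp only [_root_.ncase, decide_eq_true_eq]; omega
    · simp only [_root_.ncase, decide_eq_false_iff_not]; omega

@[fun_prop]
theorem Feas.lt {f g : α → ℕ} (hf : Feas f) (hg : Feas g) : Feas fun a => decide (f a < g a) :=
  (hf.succ.le hg).congr fun _ => rfl

@[fun_prop]
theorem Feas.min {f g : α → ℕ} (hf : Feas f) (hg : Feas g) : Feas fun a => min (f a) (g a) :=
  (Feas.cond (hf.le hg) hf hg).congr fun a => by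
    by_cases h : f a ≤ g a
    · simp [h]
    · simp [h]; omega

@[fun_prop]
theorem Feas.drop {n : α → ℕ} {l : α → List β} (hn : Feas n) (hl : Feas l) :
    Feas fun a => (l a).drop (n a) := by
  have key : ∀ (k : List Unit) (l : List β), k.foldl (fun s _ => s.tail) l = l.drop k.length := by
    intro k
    induction k with
    | nil => simp
    | cons b k ih => intro n; simp [ih]
  refine (Feas.foldl (f := fun _ s _ => s.tail) hn.units hl (by fun_prop) hl.poly_sz ?_).congr
    fun a => by rw [key]; simp
  intro a l' _
  rw [key]
  have h := sz_append ((l a).take l'.length) ((l a).drop l'.length)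
  have := sz_pos ((l a).take l'.length)
  rw [List.take_append_drop] at h
  omega

@[fun_prop]
theorem Feas.getD {n : α → ℕ} {l : α → List β} {d : α → β} (hl : Feas l) (hn : Feas n)
    (hd : Feas d) : Feas fun a => (l a).getD (n a) (d a) :=
  (Feas.headD (hn.drop hl) hd).congr fun a => by
    rw [List.headD_eq_head?_getD, List.head?_drop, List.getD_eq_getElem?_getD]

@[fun_prop]
theorem Feas.range {n : α → ℕ} (hn : Feas n) : Feas fun a => List.range (n a) := by
  have key : ∀ (k : List Unit), k.foldl (fun s _ => s ++ [s.length]) [] = List.range k.length := by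
    intro k
    induction k using List.reverseRecOn with
    | nil => rfl
    | append_singleton k b ih => simp [ih, List.range_succ]
  refine (Feas.foldl (f := fun _ s _ => s ++ [s.length]) (s := fun _ => [])
    (B := fun a => n a * (2 * n a + 1 + 1) + 1) hn.units (.const [])
    (by fun_prop) (by fun_prop) ?_).congr fun a => by rw [key]; simp
  intro a l' h
  rw [key]
  have h₁ := h.length_le
  rw [List.length_replicate] at h₁
  have h₂ := sz_list_le (l := List.range l'.length) (B := 2 * n a + 1) fun m hm => by
    rw [List.mem_range] at hm; rw [sz_nat]; omega
  rw [List.length_range] at h₂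
  exact h₂.trans (Nat.add_le_add_right (Nat.mul_le_mul_right _ h₁) 1)

/-! ### Equality -/

/-- Types with a feasible test for equality. -/
class FeasEq (α : Type) [TEnc α] [DecidableEq α] : Prop where
  feas : Feas fun p : α × α => decide (p.1 = p.2)

@[fun_prop]
theorem Feas.decide_eq [DecidableEq β] [FeasEq β] {f g : α → β} (hf : Feas f) (hg : Feas g) :
    Feas fun a => decide (f a = g a) :=
  (FeasEq.feas (α := β)).comp (hf.prodMk hg)

instance : FeasEq ℕ where
  feas := (Feas.and (Feas.id.fst.le Feas.id.snd) (Feas.id.snd.le Feas.id.fst)).congr fun p => by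
    rw [Bool.eq_iff_iff]
    simp
    omega

instance : FeasEq Bool where
  feas := (Feas.cond Feas.id.fst Feas.id.snd Feas.id.snd.not).congr fun p => by
    rcases p with ⟨_ | _, _ | _⟩ <;> rfl

instance [DecidableEq α] [DecidableEq β] [FeasEq α] [FeasEq β] : FeasEq (α × β) where
  feas := (Feas.and (Feas.decide_eq Feas.id.fst.fst Feas.id.snd.fst)
    (Feas.decide_eq Feas.id.fst.snd Feas.id.snd.snd)).congr fun p => by
      rw [Bool.eq_iff_iff]
      simp [Prod.ext_iff]

instance [DecidableEq α] [FeasEq α] : FeasEq (List α) where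
  feas := by
    -- One pass over the first list, consuming the second alongside, tests whether the first is a
    -- prefix of the second. Comparing lengths completes the test.
    let f : List α × Bool → α → List α × Bool := fun s a =>
      (s.1.tail, lcase s.1 false fun b _ => s.2 && decide (a = b))
    have key : ∀ (l k : List α) (b : Bool), l.foldl f (k, b) =
        (k.drop l.length, b && decide (k.take l.length = l)) := by
      intro l
      induction l with
      | nil => simp
      | cons a l ih =>
        intro k b
        rcases k with _ | ⟨c, k⟩
        · simp [f, ih]
        · simp only [List.foldl_cons, f, lcase_cons, List.tail_cons, ih]
          simp only [List.length_cons, List.drop_succ_cons, List.take_succ_cons, List.cons.injEq,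
            Bool.and_assoc, Bool.decide_and, eq_comm (a := a)]
    have hf : Feas fun p : List α × List α => p.1.foldl f (p.2, true) := by
      refine Feas.foldl (f := fun _ => f) (s := fun p : List α × List α => (p.2, true))
        (l := fun p => p.1) (B := fun p => sz p + 5)
        (by fun_prop) (by fun_prop) (by simp only [f]; fun_prop)
        (PolyBdd.sz_id.add (.const 5)) fun p l' _ => ?_
      rw [key]
      have h := sz_append (p.2.take l'.length) (p.2.drop l'.length)
      have h₁ := sz_pos (p.2.take l'.length)
      have h₂ := sz_bool_le (true && decide (p.2.take l'.length = l'))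
      rw [List.take_append_drop] at h
      simp only [sz_pair] at *
      omega
    refine (Feas.and (hf.snd) (Feas.decide_eq (f := fun p : List α × List α => p.1.length)
      (g := fun p => p.2.length) (by fun_prop) (by fun_prop))).congr fun p => ?_
    rw [key, Bool.eq_iff_iff]
    simp only [Bool.true_and, Bool.and_eq_true, decide_eq_true_eq]
    constructor
    · intro h
      rw [h]; simp
    · rintro ⟨h₁, h₂⟩
      rw [← h₁, h₂, List.take_length]

@[fun_prop]
theorem Feas.mem [DecidableEq β] [FeasEq β] {f : α → β} {l : α → List β} (hf : Feas f)
    (hl : Feas l) : Feas fun a => decide (f a ∈ l a) :=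
  (Feas.any (g := fun a b => decide (f a = b)) hl (by fun_prop)).congr fun a => by
    rw [Bool.eq_iff_iff]
    simp

end Loops

end

/-! ## Running the receiver ahead of the sender -/

namespace TimedChannel

open Relation

variable {N : CTA}

/-- A configuration in which the receiver is `ahead` time units ahead of the sender.  The list
`rem` holds the messages still to be written after the last read, oldest first, and `fin` says that
the receiver has stopped. -/
structure Lag (N : CTA) where
  sLoc : Fin N.senderLocs
  sVal : Fin N.senderClocks → ℕ
  rLoc : Fin N.receiverLocs
  rVal : Fin N.receiverClocks → ℕ
  ahead : ℕ
  rem : List (Fin N.messages × ℕ)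
  fin : Bool

/-- The steps of lagged configurations.  If `free` holds, then the messages written after the
receiver has stopped are arbitrary. -/
inductive LagStep (N : CTA) (free : Bool) : Lag N → Lag N → Prop
  | freeze (s v l w d r) : LagStep N free ⟨s, v, l, w, d, r, false⟩ ⟨s, v, l, w, d, r, true⟩
  -- Time passes separately for the two automata: the sender's tick lowers the lead, the receiver's
  -- tick raises it. The sender can therefore never overtake.
  | senderTick (s v l w d r b) :
      LagStep N free ⟨s, v, l, w, d + 1, r, b⟩ ⟨s, delayVal v 1, l, w, d, r, b⟩
  | receiverTick (s v l w d r) :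
      LagStep N free ⟨s, v, l, w, d, r, false⟩ ⟨s, v, l, delayVal w 1, d + 1, r, false⟩
  | senderNop (v l w d r b) (e) (he : e ∈ N.sender.transitions) (hop : e.op = .nop)
      (hg : e.guard.Sat v) :
      LagStep N free ⟨e.source, v, l, w, d, r, b⟩ ⟨e.target, resetVal v e.reset, l, w, d, r, b⟩
  | receiverNop (s v w d r) (e) (he : e ∈ N.receiver.transitions) (hop : e.op = .nop)
      (hg : e.guard.Sat w) :
      LagStep N free ⟨s, v, e.source, w, d, r, false⟩
        ⟨s, v, e.target, resetVal w e.reset, d, r, false⟩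
  -- The write takes place `d` time units before the read, so the lead is the age that the interval
  -- has to contain.
  | transmit (v w d r) (e) (he : e ∈ N.sender.transitions) (a) (hop : e.op = .write a)
      (hg : e.guard.Sat v) (f) (hf : f ∈ N.receiver.transitions) (I) (hop' : f.op = .read a I)
      (hg' : f.guard.Sat w) (hd : I.Contains d) :
      LagStep N free ⟨e.source, v, f.source, w, d, r, false⟩
        ⟨e.target, resetVal v e.reset, f.target, resetVal w f.reset, d, r, false⟩
  -- The receiver stands at the end of the run, so a message written now reaches the final age `d`;
  -- unless contents are irrelevant, it must be the next one due.
  | write (v l w d r r') (e) (he : e ∈ N.sender.transitions) (a) (hop : e.op = .write a)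
      (hg : e.guard.Sat v) (hr : if free then r' = r else r = (a, d) :: r') :
      LagStep N free ⟨e.source, v, l, w, d, r, true⟩
        ⟨e.target, resetVal v e.reset, l, w, d, r', true⟩

/-- Reachability of a lagged configuration, for a list of messages to be written after the last
read. -/
def LagReach (free : Bool) (r : List (Fin N.messages × ℕ)) (x : Lag N) : Prop :=
  ∃ s ∈ N.sender.initial, ∃ l ∈ N.receiver.initial,
    ReflTransGen (LagStep N free) ⟨s, 0, l, 0, 0, r, false⟩ x

theorem delayVal_delayVal {X : Type} (v : X → ℕ) (s t : ℕ) :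
    delayVal (delayVal v s) t = delayVal v (s + t) := by
  funext x; simp [delayVal, add_assoc]

theorem delayVal_zero {X : Type} (v : X → ℕ) : delayVal v 0 = v := rfl

theorem delayChan_zero {M : Type} (c : List (M × ℕ)) : delayChan c 0 = c := by
  simp [delayChan]

/-! ### The sender on its own -/

/-- The steps of the sender with a countdown of time and a list of messages to be written. -/
inductive SStep (N : CTA) :
    Fin N.senderLocs × (Fin N.senderClocks → ℕ) × ℕ × List (Fin N.messages × ℕ) →
      Fin N.senderLocs × (Fin N.senderClocks → ℕ) × ℕ × List (Fin N.messages × ℕ) → Prop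
  | tick (s v d r) : SStep N (s, v, d + 1, r) (s, delayVal v 1, d, r)
  | nop (v d r) (e) (he : e ∈ N.sender.transitions) (hop : e.op = .nop) (hg : e.guard.Sat v) :
      SStep N (e.source, v, d, r) (e.target, resetVal v e.reset, d, r)
  | write (v d r) (e) (he : e ∈ N.sender.transitions) (a) (hop : e.op = .write a)
      (hg : e.guard.Sat v) :
      SStep N (e.source, v, d, (a, d) :: r) (e.target, resetVal v e.reset, d, r)

/-- The ages in the list refer to the moment at which the countdown ends. Moving that moment `t`
units later raises countdown and ages alike, and messages `q` due afterwards do not interfere. -/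
theorem SStep.later {x y} (h : ReflTransGen (SStep N) x y) (t : ℕ) (q) :
    ReflTransGen (SStep N) (x.1, x.2.1, x.2.2.1 + t, delayChan x.2.2.2 t ++ q)
      (y.1, y.2.1, y.2.2.1 + t, delayChan y.2.2.2 t ++ q) := by
  refine h.lift (fun x => (x.1, x.2.1, x.2.2.1 + t, delayChan x.2.2.2 t ++ q)) ?_
  intro x y h
  cases h with
  | tick s v d r =>
    have := SStep.tick (N := N) s v (d + t) (delayChan r t ++ q)
    rwa [Nat.add_right_comm] at this
  | nop v d r e he hop hg => exact .nop _ _ _ e he hop hg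
  | write v d r e he a hop hg => exact .write _ _ _ e he a hop hg

/-- The messages written later can be split off. -/
theorem SStep.exists_write {x y} (h : ReflTransGen (SStep N) x y) {a t r}
    (hx : x.2.2.2 = (a, t) :: r) (hy : y.2.2.2 = []) :
    ∃ v e, e ∈ N.sender.transitions ∧ e.op = .write a ∧ e.guard.Sat v ∧
      (∀ (free : Bool) (l w q), ReflTransGen (LagStep N free)
        ⟨x.1, x.2.1, l, w, x.2.2.1, q, false⟩ ⟨e.source, v, l, w, t, q, false⟩) ∧
      ReflTransGen (SStep N) (e.target, resetVal v e.reset, t, r) y := by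
  induction h using ReflTransGen.head_induction_on with
  | refl => rw [hx] at hy; cases hy
  | head h h' ih =>
    cases h with
    | tick s v d r =>
      obtain ⟨v', e, he, hop, hg, h₁, h₂⟩ := ih hx
      exact ⟨v', e, he, hop, hg, fun free l w q => (h₁ free l w q).head (.senderTick ..), h₂⟩
    | nop v d r e he hop hg =>
      obtain ⟨v', e', he', hop', hg', h₁, h₂⟩ := ih hx
      exact ⟨v', e', he', hop', hg',
        fun free l w q => (h₁ free l w q).head (.senderNop _ _ _ _ _ _ e he hop hg), h₂⟩
    | write v d r e he b hop hg =>
      simp only [List.cons.injEq, Prod.mk.injEq] at hx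
      obtain ⟨⟨rfl, rfl⟩, rfl⟩ := hx
      exact ⟨v, e, he, hop, hg, fun free l w q => .refl, h'⟩

theorem SStep.lag {x y} (h : ReflTransGen (SStep N) x y) (free : Bool) (l w) (q) :
    ReflTransGen (LagStep N free) ⟨x.1, x.2.1, l, w, x.2.2.1, if free then q else x.2.2.2, true⟩
      ⟨y.1, y.2.1, l, w, y.2.2.1, if free then q else y.2.2.2, true⟩ := by
  refine h.lift (fun x => (⟨x.1, x.2.1, l, w, x.2.2.1, if free then q else x.2.2.2, true⟩ : Lag N))
    ?_
  intro x y h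
  cases h with
  | tick s v d r => exact .senderTick ..
  | nop v d r e he hop hg => exact .senderNop _ _ _ _ _ _ e he hop hg
  | write v d r e he a hop hg => exact .write _ _ _ _ _ _ e he a hop hg (by cases free <;> simp)

/-- The receiver's side of a reachable configuration is reached by a lagged run, which the sender
can complete on its own. -/
def LagBehind (free : Bool) (q : List (Fin N.messages × ℕ)) (γ : Config N) : Prop :=
  ∃ s v d, LagReach free q ⟨s, v, γ.rLoc, γ.rVal, d, q, false⟩ ∧
    ReflTransGen (SStep N) (s, v, d, γ.chan.reverse) (γ.sLoc, γ.sVal, 0, [])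

theorem LagReach.trans {free : Bool} {q} {x y : Lag N} (h : LagReach free q x)
    (h' : ReflTransGen (LagStep N free) x y) : LagReach free q y := by
  obtain ⟨s, hs, l, hl, h⟩ := h
  exact ⟨s, hs, l, hl, h.trans h'⟩

/-- One unit of time is one more tick of the receiver, raising the lead, and one more tick at the
end of the sender's outstanding run. -/
theorem LagBehind.delay {free : Bool} {q} {γ : Config N} (h : LagBehind free q γ) (t : ℕ) :
    LagBehind free q
      ⟨γ.sLoc, delayVal γ.sVal t, γ.rLoc, delayVal γ.rVal t, delayChan γ.chan t⟩ := by
  induction t with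
  | zero => simpa [delayChan_zero, delayVal_zero] using h
  | succ t ih =>
    obtain ⟨s, v, d, h₁, h₂⟩ := ih
    refine ⟨s, v, d + 1, ?_, ?_⟩
    · simp only [← delayVal_delayVal]
      exact h₁.trans (.single (.receiverTick ..))
    · have h₃ := SStep.later h₂ 1 []
      simp only [delayChan, List.map_nil, List.append_nil, Nat.zero_add] at h₃
      have h₄ := h₃.tail (SStep.tick _ _ 0 [])
      simp only [delayVal_delayVal] at h₄
      simpa [delayChan, Function.comp_def, add_assoc] using h₄

/-- Sender steps are appended to the sender's outstanding run, internal receiver steps to the lagged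
run. At a read, the outstanding run is cut at its first write: the channel is FIFO, so this is the
message being read, and the countdown at that point is its age. The part before the write and the
write itself, now a `transmit`, join the lagged run. -/
theorem LagBehind.step {free : Bool} {q} {γ γ' : Config N} (h : LagBehind free q γ)
    (hs : Step N γ γ') : LagBehind free q γ' := by
  cases hs with
  | delay t => exact h.delay t
  | senderNop e he hop hsrc hg =>
    obtain ⟨s, v, d, h₁, h₂⟩ := h
    rw [hsrc] at h₂
    exact ⟨s, v, d, h₁, h₂.tail (.nop _ _ _ e he hop hg)⟩
  | receiverNop e he hop hsrc hg =>
    obtain ⟨s, v, d, h₁, h₂⟩ := h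
    rw [hsrc] at h₁
    exact ⟨s, v, d, h₁.trans (.single (.receiverNop _ _ _ _ _ e he hop hg)), h₂⟩
  | write e he a hop hsrc hg =>
    obtain ⟨s, v, d, h₁, h₂⟩ := h
    rw [hsrc] at h₂
    refine ⟨s, v, d, h₁, ?_⟩
    have h₃ := SStep.later h₂ 0 [(a, 0)]
    simp only [delayChan_zero, List.nil_append, Nat.add_zero] at h₃
    simpa using h₃.tail (.write _ _ _ e he a hop hg)
  | read e he a I hop hsrc hg w t hw ht =>
    obtain ⟨s, v, d, h₁, h₂⟩ := h
    rw [hsrc] at h₁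
    obtain ⟨v', f, hf, hop', hg', h₃, h₄⟩ := SStep.exists_write h₂ (a := a) (t := t)
      (r := w.reverse) (by simp [hw]) rfl
    exact ⟨_, _, _, (h₁.trans (h₃ free _ _ q)).trans
      (.single (.transmit _ _ _ _ f hf a hop' hg' e he I hop hg ht)), h₄⟩

/-- Every reachable configuration is reached by a lagged run. -/
theorem Config.Reachable.lagReach {γ : Config N} (h : γ.Reachable) (free : Bool) :
    LagReach free (if free then [] else γ.chan.reverse)
      ⟨γ.sLoc, γ.sVal, γ.rLoc, γ.rVal, 0, [], true⟩ := by
  generalize hq : (if free then [] else γ.chan.reverse) = q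
  have key : LagBehind free q γ := by
    obtain ⟨γ₀, ⟨h₁, h₂, h₃, h₄, h₅⟩, h⟩ := h
    clear hq
    induction h with
    | refl =>
      refine ⟨γ₀.sLoc, 0, 0, ⟨_, h₁, _, h₃, ?_⟩, ?_⟩
      · rw [h₄]
      · rw [h₅, h₂]; exact .refl
    | tail _ hs ih => exact ih.step hs
  obtain ⟨s, v, d, h₁, h₂⟩ := key
  refine (h₁.trans (.single (.freeze ..))).trans ?_
  have h₃ := SStep.lag h₂ free γ.rLoc γ.rVal []
  cases free <;> simpa [← hq] using h₃

/-! ### The receiver on its own -/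

/-- The steps of the receiver with a countdown of time. -/
inductive RStep (N : CTA) :
    Fin N.receiverLocs × (Fin N.receiverClocks → ℕ) × List (Fin N.messages × ℕ) × ℕ →
      Fin N.receiverLocs × (Fin N.receiverClocks → ℕ) × List (Fin N.messages × ℕ) × ℕ → Prop
  | tick (l w c k) : RStep N (l, w, c, k + 1) (l, delayVal w 1, delayChan c 1, k)
  | nop (w c k) (e) (he : e ∈ N.receiver.transitions) (hop : e.op = .nop) (hg : e.guard.Sat w) :
      RStep N (e.source, w, c, k) (e.target, resetVal w e.reset, c, k)
  | read (w c k) (e) (he : e ∈ N.receiver.transitions) (a I) (hop : e.op = .read a I)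
      (hg : e.guard.Sat w) (t) (ht : I.Contains t) :
      RStep N (e.source, w, c ++ [(a, t)], k) (e.target, resetVal w e.reset, c, k)

theorem RStep.longer {x y} (h : ReflTransGen (RStep N) x y) (t : ℕ) :
    ReflTransGen (RStep N) (x.1, x.2.1, x.2.2.1, x.2.2.2 + t) (y.1, y.2.1, y.2.2.1, y.2.2.2 + t) := by
  refine h.lift (fun x => (x.1, x.2.1, x.2.2.1, x.2.2.2 + t)) ?_
  intro x y h
  cases h with
  | tick l w c k =>
    have := RStep.tick (N := N) l w c (k + t)
    rwa [Nat.add_right_comm] at this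
  | nop w c k e he hop hg => exact .nop _ _ _ e he hop hg
  | read w c k e he a I hop hg u ht => exact .read _ _ _ e he a I hop hg u ht

/-- A newer message does not matter. -/
theorem RStep.newer {x y} (h : ReflTransGen (RStep N) x y) (a) (t : ℕ) :
    y.2.2.2 ≤ x.2.2.2 ∧ ReflTransGen (RStep N) (x.1, x.2.1, (a, t) :: x.2.2.1, x.2.2.2)
      (y.1, y.2.1, (a, t + (x.2.2.2 - y.2.2.2)) :: y.2.2.1, y.2.2.2) := by
  induction h with
  | refl => exact ⟨le_rfl, by simpa using .refl⟩
  | tail _ hs ih =>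
    obtain ⟨hk, ih⟩ := ih
    cases hs with
    | tick l w c k =>
      simp only at hk ih ⊢
      refine ⟨by omega, ih.tail ?_⟩
      have := RStep.tick l w ((a, t + (x.2.2.2 - (k + 1))) :: c) k
      simp only [delayChan, List.map_cons] at this
      rwa [show t + (x.2.2.2 - (k + 1)) + 1 = t + (x.2.2.2 - k) by omega] at this
    | nop w c k e he hop hg => exact ⟨hk, ih.tail (.nop _ _ _ e he hop hg)⟩
    | read w c k e he b I hop hg u ht => exact ⟨hk, ih.tail (.read _ ((a, _) :: c) _ e he b I hop hg u ht)⟩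

theorem Config.Reachable.tail {γ γ' : Config N} (h : γ.Reachable) (h' : Step N γ γ') :
    γ'.Reachable := by
  obtain ⟨γ₀, h₀, h⟩ := h
  exact ⟨γ₀, h₀, h.tail h'⟩

/-- The receiver catches up. -/
theorem RStep.reachable {x l w e} (h : ReflTransGen (RStep N) x (l, w, e, 0)) {s v}
    (hr : Config.Reachable (⟨s, v, x.1, x.2.1, x.2.2.1⟩ : Config N)) :
    (x.2.2.2 = 0 → Config.Reachable (⟨s, v, l, w, e⟩ : Config N)) ∧
    (∀ k, x.2.2.2 = k + 1 → ∃ l' w' c',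
      Config.Reachable (⟨s, delayVal v 1, l', w', c'⟩ : Config N) ∧
        ReflTransGen (RStep N) (l', w', c', k) (l, w, e, 0)) := by
  induction h using ReflTransGen.head_induction_on with
  | refl => exact ⟨fun _ => hr, fun k hk => absurd hk (by simp)⟩
  | head h h' ih =>
    cases h with
    | tick l' w' c k =>
      refine ⟨fun hk => absurd hk (by simp), fun k' hk => ?_⟩
      obtain rfl : k = k' := by simpa using hk
      exact ⟨_, _, _, hr.tail (.delay _ 1), h'⟩
    | nop w' c k f hf hop hg => exact ih (hr.tail (.receiverNop _ f hf hop rfl hg))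
    | read w' c k f hf a I hop hg t ht =>
      exact ih (hr.tail (.read _ f hf a I hop rfl hg c t rfl ht))

/-- The sender's side of a lagged configuration is reachable, and the receiver can complete the
lagged run on its own. -/
def LagAhead (free : Bool) (q : List (Fin N.messages × ℕ)) (x : Lag N) : Prop :=
  ∃ l w c e, Config.Reachable (⟨x.sLoc, x.sVal, l, w, c⟩ : Config N) ∧
    ReflTransGen (RStep N) (l, w, c, x.ahead) (x.rLoc, x.rVal, e, 0) ∧
    (x.fin = false → e = [] ∧ x.rem = q) ∧ (free = false → q = e.reverse ++ x.rem)

/-- Here the actual run follows the sender and the receiver's steps are owed. A sender tick forces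
the receiver to carry out what it owes up to its next tick, which then is a real delay. Until the
receiver stops, its owed run empties the channel; a freshly written message therefore survives it as
the only one, with age equal to the lead, and can be read at its end. -/
theorem LagAhead.step {free : Bool} {q} {x y : Lag N} (h : LagAhead free q x)
    (hs : LagStep N free x y) : LagAhead free q y := by
  obtain ⟨l, w, c, e, h₁, h₂, h₃, h₄⟩ := h
  cases hs with
  | freeze => exact ⟨l, w, c, e, h₁, h₂, by simp, h₄⟩
  | senderTick s v l' w' d r b =>
    obtain ⟨l₁, w₁, c₁, h₅, h₆⟩ := (RStep.reachable h₂ h₁).2 d rfl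
    exact ⟨l₁, w₁, c₁, e, h₅, h₆, h₃, h₄⟩
  | receiverTick s v l' w' d r =>
    obtain ⟨rfl, rfl⟩ := h₃ rfl
    exact ⟨l, w, c, [], h₁, (RStep.longer h₂ 1).tail (.tick _ _ _ _), fun _ => ⟨rfl, rfl⟩, h₄⟩
  | senderNop v l' w' d r b f hf hop hg =>
    exact ⟨l, w, c, e, h₁.tail (.senderNop _ f hf hop rfl hg), h₂, h₃, h₄⟩
  | receiverNop s v w' d r f hf hop hg =>
    exact ⟨l, w, c, e, h₁, h₂.tail (.nop _ _ _ f hf hop hg), h₃, h₄⟩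
  | transmit v w' d r f hf a hop hg g hg₁ I hop' hg' hd =>
    obtain ⟨rfl, rfl⟩ := h₃ rfl
    refine ⟨l, w, _, [], h₁.tail (.write _ f hf a hop rfl hg), ?_, fun _ => ⟨rfl, rfl⟩, h₄⟩
    have h₅ := (RStep.newer h₂ a 0).2
    simp only [Nat.zero_add, Nat.sub_zero] at h₅
    exact h₅.tail (.read _ [] _ g hg₁ a I hop' hg' d hd)
  | write v l' w' d r r' f hf a hop hg hr =>
    refine ⟨l, w, _, (a, d) :: e, h₁.tail (.write _ f hf a hop rfl hg), ?_, by simp, ?_⟩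
    · simpa using (RStep.newer h₂ a 0).2
    · rintro rfl
      simp only [Bool.false_eq_true, if_false] at hr
      simp [h₄ rfl, hr]

/-- With lead zero the receiver carries out its owed steps without any delay. Since nothing remains
to be written, the channel then holds exactly the list fixed at the start. -/
theorem LagReach.reachable {free : Bool} {q} {s v l w b}
    (h : LagReach (N := N) free q ⟨s, v, l, w, 0, [], b⟩) :
    ∃ e, Config.Reachable (⟨s, v, l, w, e⟩ : Config N) ∧ (free = false → q = e.reverse) := by
  obtain ⟨s₀, hs₀, l₀, hl₀, h⟩ := h
  have key : LagAhead free q (⟨s, v, l, w, 0, [], b⟩ : Lag N) := by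
    generalize (⟨s, v, l, w, 0, [], b⟩ : Lag N) = y at h
    induction h with
    | refl =>
      exact ⟨l₀, 0, [], [], ⟨_, ⟨hs₀, rfl, hl₀, rfl, rfl⟩, .refl⟩, .refl, fun _ => ⟨rfl, rfl⟩,
        fun _ => rfl⟩
    | tail _ hs ih => exact ih.step hs
  obtain ⟨l', w', c, e, h₁, h₂, -, h₄⟩ := key
  exact ⟨e, (RStep.reachable h₂ h₁).1 rfl, fun hf => by simpa using h₄ hf⟩

/-- The list of the messages a target configuration leaves in the channel, oldest first. -/
def Target.pending : Target N → List (Fin N.messages × ℕ)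
  | .configuration γ => γ.chan.reverse
  | _ => []

/-- Whether the contents of the channel do not matter for a target. -/
def Target.free : Target N → Bool
  | .configuration _ => false
  | _ => true

/-- The target is met up to the contents of the channel. -/
def Target.LagMetBy : Target N → Lag N → Prop
  | .senderLocation l, x => x.sLoc = l
  | .receiverLocation l, x => x.rLoc = l
  | .locations l l', x => x.sLoc = l ∧ x.rLoc = l'
  | .configuration γ, x => x.sLoc = γ.sLoc ∧ x.sVal = γ.sVal ∧ x.rLoc = γ.rLoc ∧ x.rVal = γ.rVal

/-- Reachability in terms of lagged runs. -/
theorem exists_reachable_iff {T : Target N} : (∃ γ : Config N, γ.Reachable ∧ T.MetBy γ) ↔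
    ∃ y : Lag N, LagReach T.free T.pending y ∧ y.ahead = 0 ∧ y.rem = [] ∧
      y.fin = true ∧ T.LagMetBy y := by
  constructor
  · rintro ⟨γ, hr, hm⟩
    refine ⟨⟨γ.sLoc, γ.sVal, γ.rLoc, γ.rVal, 0, [], true⟩, ?_, rfl, rfl, rfl, ?_⟩
    · have h := hr.lagReach T.free
      cases T with
      | configuration γ' =>
        have hm' : γ = γ' := hm
        subst hm'
        simpa [Target.free, Target.pending] using h
      | _ => simpa [Target.free, Target.pending] using h
    · cases T with
      | configuration γ' =>
        have hm' : γ = γ' := hm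
        subst hm'
        exact ⟨rfl, rfl, rfl, rfl⟩
      | _ => exact hm
  · rintro ⟨⟨s, v, l, w, d, r, b⟩, hr, hd, hrem, -, hm⟩
    simp only at hd hrem
    subst hd hrem
    obtain ⟨e, he, hf⟩ := hr.reachable
    refine ⟨_, he, ?_⟩
    cases T with
    | configuration γ' =>
      obtain ⟨s', v', l', w', c⟩ := γ'
      obtain ⟨h₁, h₂, h₃, h₄⟩ := hm
      simp only at h₁ h₂ h₃ h₄
      subst h₁ h₂ h₃ h₄
      have := hf rfl
      simp only [Target.pending, List.reverse_inj] at this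
      rw [this]
      rfl
    | _ => exact hm

end TimedChannel

section

/-! ## Counters above a threshold -/

open Relation

/-- An increasing sequence of subsets of a finite set that stays constant once it has been constant
for one step reaches its limit after as many steps as there are elements. -/
theorem subset_of_stabilizes {α : Type*} {S : Set α} (hS : S.Finite) {R : ℕ → Set α}
    (hR : Monotone R) (hsub : ∀ n, R n ⊆ S) (hst : ∀ n, R n = R (n + 1) → R (n + 1) = R (n + 2))
    {N : ℕ} (hN : S.ncard ≤ N) (n : ℕ) : R n ⊆ R N := by
  -- Otherwise the first `S.ncard + 1` inclusions are all strict, and the last set has more elements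
  -- than `S`.
  obtain ⟨m, hm, he⟩ : ∃ m ≤ S.ncard, R m = R (m + 1) := by
    by_contra! h
    have key : ∀ n ≤ S.ncard + 1, n ≤ (R n).ncard := by
      intro n
      induction n with
      | zero => simp
      | succ n ih =>
        intro hn
        have h₁ : R n ⊂ R (n + 1) := (hR n.le_succ).ssubset_of_ne (h n (by omega))
        have h₂ := Set.ncard_lt_ncard h₁ (hS.subset (hsub _))
        have := ih (by omega)
        omega
    have h₁ := key _ le_rfl
    have h₂ := Set.ncard_le_ncard (hsub (S.ncard + 1)) hS
    omega
  have h₁ : ∀ k, R (m + k) = R m ∧ R (m + k + 1) = R m := by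
    intro k
    induction k with
    | zero => exact ⟨rfl, he.symm⟩
    | succ k ih =>
      refine ⟨ih.2, ?_⟩
      rw [← ih.2]
      exact (hst (m + k) (by rw [ih.1, ih.2])).symm
  rcases le_total n N with h | h
  · exact hR h
  · obtain ⟨k, rfl⟩ := Nat.exists_eq_add_of_le ((hm.trans hN).trans h)
    rw [(h₁ k).1]
    exact hR (hm.trans hN)

section Counter

variable {Q : Type*}

/-- Steps with counter values at most `h`. -/
def BoundedStep (step : Q × ℕ → Q × ℕ → Prop) (h : ℕ) (a b : Q × ℕ) : Prop :=
  step a b ∧ a.2 ≤ h ∧ b.2 ≤ h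

theorem BoundedStep.mono {step : Q × ℕ → Q × ℕ → Prop} {h h' : ℕ} (hh : h ≤ h') {a b}
    (hab : ReflTransGen (BoundedStep step h) a b) : ReflTransGen (BoundedStep step h') a b :=
  hab.lift (fun a => a) fun _ _ h => ⟨h.1, h.2.1.trans hh, h.2.2.trans hh⟩

theorem exists_boundedStep {step : Q × ℕ → Q × ℕ → Prop} {a b} (hab : ReflTransGen step a b) :
    ∃ h, ReflTransGen (BoundedStep step h) a b := by
  induction hab with
  | refl => exact ⟨0, .refl⟩
  | @tail b c _ hs ih =>
    obtain ⟨h, ih⟩ := ih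
    exact ⟨h + b.2 + c.2, (BoundedStep.mono (by omega) ih).tail ⟨hs, by omega, by omega⟩⟩

theorem BoundedStep.shift {step : Q × ℕ → Q × ℕ → Prop}
    (hshift : ∀ q d q' d', step (q, d) (q', d') → step (q, d + 1) (q', d' + 1)) {h : ℕ} {a b}
    (hab : ReflTransGen (BoundedStep step h) a b) :
    ReflTransGen (BoundedStep step (h + 1)) (a.1, a.2 + 1) (b.1, b.2 + 1) := by
  refine hab.lift (fun a => (a.1, a.2 + 1)) ?_
  rintro ⟨q, d⟩ ⟨q', d'⟩ ⟨h₁, h₂, h₃⟩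
  exact ⟨hshift _ _ _ _ h₁, by simpa using h₂, by simpa using h₃⟩

/-- In a one-counter system without tests, runs from level zero to level zero need only quadratic
counter values. -/
theorem bounded_of_shift {step : Q × ℕ → Q × ℕ → Prop} {G : Set Q} (hG : G.Finite)
    (hclosed : ∀ q d q' d', step (q, d) (q', d') → q ∈ G → q' ∈ G)
    (hunit : ∀ q d q' d', step (q, d) (q', d') → d' ≤ d + 1 ∧ d ≤ d' + 1)
    (hshift : ∀ q d q' d', step (q, d) (q', d') ↔ step (q, d + 1) (q', d' + 1))
    {u v : Q} (hu : u ∈ G) (h : ReflTransGen step (u, 0) (v, 0)) :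
    ReflTransGen (BoundedStep step (G.ncard ^ 2)) (u, 0) (v, 0) := by
  -- `R h` collects the pairs joined by a run from level zero to level zero of height at most `h`.
  -- These sets lie in `G ×ˢ G`, so by `subset_of_stabilizes` it suffices that they stay constant
  -- once they repeat.
  let R : ℕ → Set (Q × Q) := fun h =>
    {p | p.1 ∈ G ∧ ReflTransGen (BoundedStep step h) (p.1, 0) (p.2, 0)}
  have hmem : ∀ {h a b}, ReflTransGen (BoundedStep step h) a b → a.1 ∈ G → b.1 ∈ G := by
    intro h a b hab ha
    induction hab with
    | refl => exact ha
    | @tail b c _ hs ih => exact hclosed _ _ _ _ hs.1 ih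
  have hmono : Monotone R := fun h h' hh p hp => ⟨hp.1, BoundedStep.mono hh hp.2⟩
  have hcard : (G ×ˢ G).ncard ≤ G.ncard ^ 2 := by rw [Set.ncard_prod, sq]
  obtain ⟨n, hn⟩ := exists_boundedStep h
  refine (subset_of_stabilizes (hG.prod hG) hmono (fun h p hp => ⟨hp.1, hmem hp.2 hp.1⟩)
    (fun h he => ?_) hcard n (show (u, v) ∈ R n from ⟨hu, hn⟩)).2
  refine (hmono (Nat.le_succ _)).antisymm ?_
  rintro ⟨u, v⟩ ⟨hu, hp⟩
  refine ⟨hu, ?_⟩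
  -- Invariant along a run of height `h + 2`: at level zero, the run so far can be redone with
  -- height `h + 1`; at a positive level, the current excursion is remembered by its first step and
  -- its interior, lowered by one.
  have key : ∀ b, ReflTransGen (BoundedStep step (h + 2)) (u, 0) b →
      (b.2 = 0 → ReflTransGen (BoundedStep step (h + 1)) (u, 0) b) ∧
      (∀ k, b.2 = k + 1 → ∃ w w', ReflTransGen (BoundedStep step (h + 1)) (u, 0) (w, 0) ∧
        step (w, 0) (w', 1) ∧ ReflTransGen (BoundedStep step (h + 1)) (w', 0) (b.1, k)) := by
    intro b hb
    induction hb with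
    | refl => exact ⟨fun _ => .refl, fun k hk => absurd hk (by simp)⟩
    | @tail b c _ hs ih =>
      obtain ⟨w, k⟩ := b
      obtain ⟨z, j⟩ := c
      obtain ⟨hs, hk, hj⟩ := hs
      simp only at hk hj ih ⊢
      rcases k with _ | k
      · have h₁ := ih.1 rfl
        refine ⟨?_, ?_⟩
        · rintro rfl
          exact h₁.tail ⟨hs, by simp, by simp⟩
        · rintro k rfl
          obtain rfl : k = 0 := by have := (hunit _ _ _ _ hs).1; omega
          exact ⟨w, z, h₁, hs, .refl⟩
      · obtain ⟨x, x', h₁, h₂, h₃⟩ := ih.2 k rfl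
        refine ⟨?_, ?_⟩
        · rintro rfl
          obtain rfl : k = 0 := by have := (hunit _ _ _ _ hs).2; omega
          have hx' : x' ∈ G := hclosed _ _ _ _ h₂ (hmem h₁ hu)
          have h₄ : (x', w) ∈ R (h + 1) := ⟨hx', h₃⟩
          -- The interior of a completed excursion has height `h + 1` after lowering. Since `R h = R
          -- (h + 1)`, one of height `h` replaces it, which raised again has height `h + 1`.
          rw [← he] at h₄
          have h₅ := BoundedStep.shift (fun q d q' d' => (hshift q d q' d').1) h₄.2
          exact ((h₁.tail ⟨h₂, by simp, by simp⟩).trans h₅).tail ⟨hs, by simp, by simp⟩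
        · rintro j' rfl
          exact ⟨x, x', h₁, h₂, h₃.tail ⟨(hshift _ _ _ _).2 hs, by simp at hk ⊢; omega,
            by simp at hj ⊢; omega⟩⟩
  exact (key _ hp).1 rfl

/-- In a one-counter system that cannot distinguish counter values above `L`, runs between
configurations with counter value zero need only counter values quadratically above `L`. -/
theorem bounded_of_shift_above {step : Q × ℕ → Q × ℕ → Prop} {G : Set Q} (hG : G.Finite) (L : ℕ)
    (hclosed : ∀ q d q' d', step (q, d) (q', d') → q ∈ G → q' ∈ G)
    (hunit : ∀ q d q' d', step (q, d) (q', d') → d' ≤ d + 1 ∧ d ≤ d' + 1)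
    (hshift : ∀ q d q' d', L ≤ d → L ≤ d' →
      (step (q, d) (q', d') ↔ step (q, d + 1) (q', d' + 1)))
    {u v : Q} (hu : u ∈ G) (h : ReflTransGen step (u, 0) (v, 0)) :
    ReflTransGen (BoundedStep step (L + G.ncard ^ 2)) (u, 0) (v, 0) := by
  -- Measured from level `L`, the system satisfies the hypotheses of `bounded_of_shift`, so
  -- excursions from level `L` back to level `L` can be lowered.
  let up : Q × ℕ → Q × ℕ → Prop := fun a b => step (a.1, L + a.2) (b.1, L + b.2)
  set D := L + G.ncard ^ 2 with hD
  have hup : ∀ {w x}, w ∈ G → ReflTransGen up (w, 0) (x, 0) →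
      ReflTransGen (BoundedStep step D) (w, L) (x, L) := by
    intro w x hw hwx
    have h₁ := bounded_of_shift (step := up) hG (fun q d q' d' => hclosed _ _ _ _)
      (fun q d q' d' h => by have := hunit _ _ _ _ h; omega)
      (fun q d q' d' => hshift _ _ _ _ (by omega) (by omega)) hw hwx
    refine h₁.lift (fun a => (a.1, L + a.2)) ?_
    rintro a b ⟨h₁, h₂, h₃⟩
    exact ⟨h₁, by simp only; omega, by simp only; omega⟩
  have hmem : ∀ {b}, ReflTransGen (BoundedStep step D) (u, 0) b → b.1 ∈ G := by
    intro b hb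
    induction hb with
    | refl => exact hu
    | @tail b c _ hs ih => exact hclosed _ _ _ _ hs.1 ih
  -- Below `L` the run so far is already bounded; from `L` on, only the part up to the last entry
  -- into level `L` is, and the current excursion is kept as a run of `up`.
  have key : ∀ b, ReflTransGen step (u, 0) b →
      (b.2 < L → ReflTransGen (BoundedStep step D) (u, 0) b) ∧
      (∀ i, b.2 = L + i → ∃ w, ReflTransGen (BoundedStep step D) (u, 0) (w, L) ∧
        ReflTransGen up (w, 0) (b.1, i)) := by
    intro b hb
    induction hb with
    | refl =>
      refine ⟨fun _ => .refl, fun i hi => ?_⟩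
      obtain ⟨rfl, rfl⟩ : L = 0 ∧ i = 0 := by simp only at hi; omega
      exact ⟨u, .refl, .refl⟩
    | @tail b c _ hs ih =>
      obtain ⟨w, d⟩ := b
      obtain ⟨z, d'⟩ := c
      have hd := hunit _ _ _ _ hs
      simp only at ih ⊢
      rcases lt_or_ge d L with hdL | hdL
      · have h₁ := ih.1 hdL
        refine ⟨fun hd' => h₁.tail ⟨hs, by simp only; omega, by simp only; omega⟩, ?_⟩
        rintro i rfl
        obtain rfl : i = 0 := by omega
        exact ⟨z, h₁.tail ⟨hs, by simp only; omega, by simp only; omega⟩, .refl⟩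
      · obtain ⟨i, rfl⟩ := Nat.exists_eq_add_of_le hdL
        obtain ⟨x, h₁, h₂⟩ := ih.2 i rfl
        refine ⟨fun hd' => ?_, ?_⟩
        · obtain rfl : i = 0 := by omega
          exact (h₁.trans (hup (hmem h₁) h₂)).tail ⟨hs, by simp only; omega, by simp only; omega⟩
        · rintro j rfl
          exact ⟨x, h₁, h₂.tail hs⟩
  -- For `L = 0` the final configuration is itself at the threshold, so the whole run is one
  -- excursion.
  rcases Nat.eq_zero_or_pos L with hL | hL
  · obtain ⟨w, h₁, h₂⟩ := (key _ h).2 0 (by simp [hL])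
    have h₃ := h₁.trans (hup (hmem h₁) h₂)
    rwa [hL] at h₃
  · exact (key _ h).1 hL

end Counter

end

/-! ## The search on numerical data -/

namespace TimedChannel

open Relation

/-- Transitions as numerical data: source, guard, operation, clocks reset, target. -/
abbrev RTrans (ω : Type) := ℕ × List (ℕ × ℕ × ℕ) × ω × List ℕ × ℕ

/-- Age intervals as numerical data. -/
abbrev RInterval := ℕ × ℕ × Option ℕ × ℕ

/-- Control states as numerical data: locations and clock values of the sender and the receiver,
messages to be written, and whether the receiver has stopped. -/
abbrev RCtrl := (ℕ × List ℕ) × (ℕ × List ℕ) × List (ℕ × ℕ) × Bool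

/-- States as numerical data: a control state and the lead of the receiver. -/
abbrev RState := RCtrl × ℕ

/-- Comparison of numbers, the operator given by its code. -/
def cmpB (o v k : ℕ) : Bool :=
  bif decide (o = 0) then decide (v < k) else bif decide (o = 1) then decide (v ≤ k) else
    bif decide (o = 2) then decide (v = k) else bif decide (o = 3) then decide (k < v) else
      decide (k ≤ v)

def guardB (v : List ℕ) (g : List (ℕ × ℕ × ℕ)) : Bool :=
  g.all fun c => cmpB c.2.1 (v.getD c.1 0) c.2.2

def containsB (I : RInterval) (t : ℕ) : Bool :=
  (bif decide (I.2.1 = 1) then decide (I.1 ≤ t) else decide (I.1 < t)) &&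
    I.2.2.1.elim true fun u => bif decide (I.2.2.2 = 1) then decide (t ≤ u) else decide (t < u)

def resetB (v Y : List ℕ) : List ℕ :=
  (List.range v.length).map fun i => bif decide (i ∈ Y) then 0 else v.getD i 0

/-- Only clocks are truncated; the lead is kept exactly, because the sender has to make up for all
of it. -/
def tickB (cap : ℕ) (a : ℕ × List ℕ) : ℕ × List ℕ := (a.1, a.2.map fun n => min (n + 1) cap)

/-- The operations an automaton can perform, and the local states they lead to. -/
def moves {ω : Type} (T : List (RTrans ω)) (a : ℕ × List ℕ) : List (ω × ℕ × List ℕ) :=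
  (T.filter fun e => decide (e.1 = a.1) && guardB a.2 e.2.1).map fun e =>
    (e.2.2.1, e.2.2.2.2, resetB a.2 e.2.2.2.1)

/-- The effect of writing `m` once the receiver has stopped. -/
def writeB (free : Bool) (m : ℕ) (A : ℕ × List ℕ) (s : RState) : List RState :=
  bif free then [((A, s.1.2), s.2)] else
    lcase s.1.2.2.1 [] fun p r =>
      bif decide (p = (m, s.2)) then [((A, s.1.2.1, r, s.1.2.2.2), s.2)] else []

/-- The effect of a message `m` passing from the sender to the receiver. -/
def transmitB (rT : List (RTrans (Option (ℕ × RInterval)))) (m : ℕ) (A : ℕ × List ℕ)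
    (s : RState) : List RState :=
  (moves rT s.1.2.1).flatMap fun f => f.1.elim [] fun o =>
    bif decide (m = o.1) && containsB o.2 s.2 then [((A, f.2, s.1.2.2), s.2)] else []

/-- The successors of a state, with clocks capped at `cap` and leads bounded by `D`. -/
def succs (sT : List (RTrans (Option ℕ))) (rT : List (RTrans (Option (ℕ × RInterval))))
    (cap D : ℕ) (free : Bool) (s : RState) : List RState :=
  (bif s.1.2.2.2 then [] else [((s.1.1, s.1.2.1, s.1.2.2.1, true), s.2)]) ++
  (ncase s.2 [] fun d => [((tickB cap s.1.1, s.1.2), d)]) ++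
  (bif s.1.2.2.2 || decide (D ≤ s.2) then [] else
    [((s.1.1, tickB cap s.1.2.1, s.1.2.2), s.2 + 1)]) ++
  ((moves sT s.1.1).flatMap fun e => e.1.elim [((e.2, s.1.2), s.2)] fun m =>
    bif s.1.2.2.2 then writeB free m e.2 s else transmitB rT m e.2 s) ++
  (bif s.1.2.2.2 then [] else
    (moves rT s.1.2.1).flatMap fun f => f.1.elim [((s.1.1, f.2, s.1.2.2), s.2)] fun _ => [])

/-! ### From automata to numerical data -/

def cmpCode : Cmp → ℕ
  | .lt => 0
  | .le => 1
  | .eq => 2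
  | .gt => 3
  | .ge => 4

def rawAtom {k : ℕ} (c : Atom (Fin k)) : ℕ × ℕ × ℕ := (c.clock.val, cmpCode c.op, c.bound)

def rawBool (b : Bool) : ℕ := if b then 1 else 0

def rawInterval (I : AgeInterval) : RInterval :=
  (I.lower, rawBool I.lowerClosed, I.upper, rawBool I.upperClosed)

def rawSend {m : ℕ} : SendOp (Fin m) → Option ℕ
  | .nop => none
  | .write a => some a.val

def rawRecv {m : ℕ} : RecvOp (Fin m) → Option (ℕ × RInterval)
  | .nop => none
  | .read a I => some (a.val, rawInterval I)

def rawTrans {n k : ℕ} {Op ω : Type} (f : Op → ω) (e : Transition (Fin n) (Fin k) Op) : RTrans ω :=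
  (e.source.val, e.guard.map rawAtom, f e.op, e.reset.map Fin.val, e.target.val)

def rawMsg {m : ℕ} (p : Fin m × ℕ) : ℕ × ℕ := (p.1.val, p.2)

def capVal {k : ℕ} (cap : ℕ) (v : Fin k → ℕ) : List ℕ := List.ofFn fun i => min (v i) cap

theorem rawMsg_injective {m : ℕ} : Function.Injective (rawMsg (m := m)) := by
  rintro ⟨a, s⟩ ⟨b, t⟩ h
  simp only [rawMsg, Prod.mk.injEq, Fin.val_inj] at h
  simp [h]

/-- The numerical data of a lagged configuration. -/
def Lag.abs {N : CTA} (cap : ℕ) (y : Lag N) : RState :=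
  (((y.sLoc.val, capVal cap y.sVal), (y.rLoc.val, capVal cap y.rVal), y.rem.map rawMsg, y.fin),
    y.ahead)

/-- The inequality `k < cap` is strict, so even the truncated value `cap` lies above `k`, as the
true value does. -/
theorem cmpB_cmpCode {o : Cmp} {v k cap : ℕ} (h : k < cap) :
    cmpB (cmpCode o) (min v cap) k = true ↔ o.Holds v k := by
  cases o <;> simp [cmpB, cmpCode, Cmp.Holds] <;> omega

theorem getD_capVal {k cap : ℕ} (v : Fin k → ℕ) (i : Fin k) :
    (capVal cap v).getD i.val 0 = min (v i) cap := by
  simp [capVal, List.getD_eq_getElem?_getD]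

theorem guardB_iff {k cap : ℕ} (v : Fin k → ℕ) (g : Guard (Fin k)) (h : ∀ c ∈ g, c.bound < cap) :
    guardB (capVal cap v) (g.map rawAtom) = true ↔ g.Sat v := by
  simp only [guardB, List.all_map, List.all_eq_true, Guard.Sat]
  refine forall₂_congr fun c hc => ?_
  simp only [Function.comp, rawAtom, getD_capVal]
  exact cmpB_cmpCode (h c hc)

theorem resetB_capVal {k cap : ℕ} (v : Fin k → ℕ) (Y : List (Fin k)) :
    resetB (capVal cap v) (Y.map Fin.val) = capVal cap (resetVal v Y) := by
  apply List.ext_getElem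
  · simp [resetB, capVal]
  · intro i h₁ h₂
    have hi : i < k := by simpa [capVal] using h₂
    simp only [resetB, List.getElem_map, List.getElem_range, capVal, List.getElem_ofFn, resetVal]
    have hm : i ∈ Y.map Fin.val ↔ (⟨i, hi⟩ : Fin k) ∈ Y := by
      simp only [List.mem_map]
      constructor
      · rintro ⟨a, ha, rfl⟩; exact ha
      · intro h; exact ⟨_, h, rfl⟩
    by_cases h : (⟨i, hi⟩ : Fin k) ∈ Y
    · simp [hm.2 h, h]
    · simp [mt hm.1 h, h, hi, List.getD_eq_getElem?_getD]

/-- Truncation commutes with ticks, as with resets, so the numerical system simulates the lagged one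
exactly. -/
theorem tickB_capVal {k cap : ℕ} (l : ℕ) (v : Fin k → ℕ) :
    tickB cap (l, capVal cap v) = (l, capVal cap (delayVal v 1)) := by
  simp only [tickB, capVal, List.map_ofFn, Prod.mk.injEq, true_and]
  congr 1
  funext i
  simp [delayVal]
  omega

theorem containsB_iff (I : AgeInterval) (t : ℕ) :
    containsB (rawInterval I) t = true ↔ I.Contains t := by
  obtain ⟨l, p, u, q⟩ := I
  cases p <;> cases u <;> cases q <;> simp [containsB, rawInterval, rawBool, AgeInterval.Contains]

theorem mem_moves {n k cap : ℕ} {Op ω : Type} {f : Op → ω}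
    {T : List (Transition (Fin n) (Fin k) Op)} (hT : ∀ e ∈ T, ∀ c ∈ e.guard, c.bound < cap)
    (l : Fin n) (v : Fin k → ℕ) (m : ω × ℕ × List ℕ) :
    m ∈ moves (T.map (rawTrans f)) (l.val, capVal cap v) ↔ ∃ e ∈ T, e.source = l ∧
      e.guard.Sat v ∧ m = (f e.op, e.target.val, capVal cap (resetVal v e.reset)) := by
  simp only [moves, List.mem_map, List.mem_filter, Bool.and_eq_true, decide_eq_true_eq]
  constructor
  · rintro ⟨_, ⟨⟨e, he, rfl⟩, h₁, h₂⟩, rfl⟩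
    refine ⟨e, he, Fin.ext h₁, (guardB_iff v _ (hT e he)).1 h₂, ?_⟩
    simp [rawTrans, resetB_capVal]
  · rintro ⟨e, he, rfl, h₂, rfl⟩
    refine ⟨_, ⟨⟨e, he, rfl⟩, rfl, (guardB_iff v _ (hT e he)).2 h₂⟩, ?_⟩
    simp [rawTrans, resetB_capVal]

/-- All constants of the automata are below `cap`. -/
structure CTA.Below (N : CTA) (cap : ℕ) : Prop where
  sender : ∀ e ∈ N.sender.transitions, ∀ c ∈ e.guard, c.bound < cap
  receiver : ∀ e ∈ N.receiver.transitions, ∀ c ∈ e.guard, c.bound < cap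
  interval : ∀ e ∈ N.receiver.transitions, ∀ a I, e.op = .read a I →
    I.lower < cap ∧ ∀ u ∈ I.upper, u < cap

/-- The transitions of the sender as numerical data. -/
def CTA.rawS (N : CTA) : List (RTrans (Option ℕ)) := N.sender.transitions.map (rawTrans rawSend)

/-- The transitions of the receiver as numerical data. -/
def CTA.rawR (N : CTA) : List (RTrans (Option (ℕ × RInterval))) :=
  N.receiver.transitions.map (rawTrans rawRecv)

theorem LagStep.ahead_le {N : CTA} {free : Bool} {x y : Lag N} (h : LagStep N free x y) :
    y.ahead ≤ x.ahead + 1 ∧ x.ahead ≤ y.ahead + 1 := by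
  cases h <;> simp <;> omega

/-- This keeps the control states finite: of the pending list only the position reached matters. -/
theorem LagStep.rem_suffix {N : CTA} {free : Bool} {x y : Lag N} (h : LagStep N free x y) :
    y.rem <:+ x.rem := by
  cases h with
  | write v l w d r r' e he a hop hg hr =>
    cases free
    · simp only [Bool.false_eq_true, if_false] at hr
      simp only [hr]
      exact List.suffix_cons _ _
    · simp only [if_true] at hr
      simp only [hr]
      exact List.suffix_rfl
  | _ => exact List.suffix_rfl

/-- The numerical successors are the data of the lagged successors. -/
theorem mem_succs_abs {N : CTA} {cap : ℕ} (hN : N.Below cap) (D : ℕ) (free : Bool) (y : Lag N)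
    (s : RState) : s ∈ succs N.rawS N.rawR cap D free (y.abs cap) ↔
      ∃ z, LagStep N free y z ∧ z.abs cap = s ∧ (z.ahead ≤ y.ahead ∨ z.ahead ≤ D) := by
  obtain ⟨l, v, l', w, d, r, b⟩ := y
  simp only [succs, List.mem_append, or_assoc, Lag.abs, tickB_capVal, List.mem_flatMap]
  constructor
  · rintro (h | h | h | ⟨m, hm, h⟩ | h)
    · cases b
      · simp only [cond_false, List.mem_singleton] at h
        exact ⟨_, .freeze .., h.symm, .inl le_rfl⟩
      · simp at h
    · cases d with
      | zero => simp [ncase] at h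
      | succ d =>
        simp only [ncase, List.mem_singleton] at h
        exact ⟨_, .senderTick .., h.symm, .inl (by simp)⟩
    -- This is the receiver's tick, the only step that raises the lead and so the only one
    -- restricted by `D`.
    · cases b
      · by_cases hd : D ≤ d
        · simp [hd] at h
        · simp only [hd, decide_false, Bool.or_false, cond_false, List.mem_singleton] at h
          exact ⟨_, .receiverTick .., h.symm, .inr (by simp only; omega)⟩
      · simp at h
    · obtain ⟨e, he, rfl, hg, rfl⟩ := (mem_moves hN.sender l v m).1 hm
      cases hop : e.op with
      | nop =>
        simp only [hop, rawSend, Option.elim_none, List.mem_singleton] at h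
        exact ⟨_, .senderNop _ _ _ _ _ _ e he hop hg, h.symm, .inl le_rfl⟩
      | write a =>
        simp only [hop, rawSend, Option.elim_some] at h
        cases b
        · simp only [cond_false, transmitB, List.mem_flatMap] at h
          obtain ⟨m', hm', h⟩ := h
          obtain ⟨f, hf, rfl, hg', rfl⟩ := (mem_moves hN.receiver l' w m').1 hm'
          cases hop' : f.op with
          | nop => simp [hop', rawRecv] at h
          | read a' I =>
            simp only [hop', rawRecv, Option.elim_some] at h
            by_cases hc : a = a' ∧ I.Contains d
            · obtain ⟨rfl, hd⟩ := hc
              simp only [(containsB_iff I d).2 hd, decide_true, Bool.and_self, cond_true,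
                List.mem_singleton] at h
              exact ⟨_, .transmit _ _ _ _ e he a hop hg f hf I hop' hg' hd, h.symm, .inl le_rfl⟩
            · have : (decide (a.val = a'.val) && containsB (rawInterval I) d) = false := by
                rw [Bool.eq_false_iff]
                intro hc'
                simp only [Bool.and_eq_true, decide_eq_true_eq, containsB_iff, Fin.val_inj] at hc'
                exact hc hc'
              simp [this] at h
        · simp only [cond_true, writeB] at h
          cases free
          · cases r with
            | nil => simp at h
            | cons p r =>
              simp only [cond_false, List.map_cons, lcase_cons] at h
              by_cases hp : p = (a, d)
              · subst hp
                simp only [rawMsg, decide_true, cond_true, List.mem_singleton] at h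
                exact ⟨_, .write _ _ _ _ _ r e he a hop hg (by simp), h.symm, .inl le_rfl⟩
              · have : rawMsg p ≠ (a.val, d) := fun h' => hp (rawMsg_injective h')
                simp [this] at h
          · simp only [cond_true, List.mem_singleton] at h
            exact ⟨_, .write _ _ _ _ _ r e he a hop hg (by simp), h.symm, .inl le_rfl⟩
    · cases b
      · simp only [cond_false, List.mem_flatMap] at h
        obtain ⟨m', hm', h⟩ := h
        obtain ⟨f, hf, rfl, hg', rfl⟩ := (mem_moves hN.receiver l' w m').1 hm'
        cases hop' : f.op with
        | nop =>
          simp only [hop', rawRecv, Option.elim_none, List.mem_singleton] at h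
          exact ⟨_, .receiverNop _ _ _ _ _ f hf hop' hg', h.symm, .inl le_rfl⟩
        | read a' I => simp [hop', rawRecv] at h
      · simp at h
  · rintro ⟨z, h, rfl, hD⟩
    cases h with
    | freeze => left; simp
    | senderTick => right; left; simp [ncase]
    | receiverTick =>
      right; right; left
      have : ¬ D ≤ d := by simp only at hD; omega
      simp [this]
    | senderNop _ _ _ _ _ _ e he hop hg =>
      right; right; right; left
      refine ⟨_, (mem_moves hN.sender _ v _).2 ⟨e, he, rfl, hg, rfl⟩, ?_⟩
      simp [hop, rawSend]
    | receiverNop _ _ _ _ _ e he hop hg =>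
      right; right; right; right
      simp only [cond_false, List.mem_flatMap]
      refine ⟨_, (mem_moves hN.receiver _ w _).2 ⟨e, he, rfl, hg, rfl⟩, ?_⟩
      simp [hop, rawRecv]
    | transmit _ _ _ _ e he a hop hg f hf I hop' hg' hd =>
      right; right; right; left
      refine ⟨_, (mem_moves hN.sender _ v _).2 ⟨e, he, rfl, hg, rfl⟩, ?_⟩
      simp only [hop, rawSend, Option.elim_some, cond_false, transmitB, List.mem_flatMap]
      refine ⟨_, (mem_moves hN.receiver _ w _).2 ⟨f, hf, rfl, hg', rfl⟩, ?_⟩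
      simp [hop', rawRecv, (containsB_iff I d).2 hd]
    | write _ _ _ _ _ r' e he a hop hg hr =>
      right; right; right; left
      refine ⟨_, (mem_moves hN.sender _ v _).2 ⟨e, he, rfl, hg, rfl⟩, ?_⟩
      simp only [hop, rawSend, Option.elim_some, cond_true, writeB]
      cases free
      · simp only [Bool.false_eq_true, if_false] at hr
        subst hr
        simp [rawMsg]
      · simp only [if_true] at hr
        subst hr
        simp

end TimedChannel

/-! ### The threshold for the lead, the number of control states, and the search criterion -/

namespace TimedChannel

open Relation

variable {N : CTA}

/-- Increase the lead of the receiver by one. -/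
def Lag.up (y : Lag N) : Lag N := { y with ahead := y.ahead + 1 }

/-- Both ages exceed every finite endpoint, so only whether the interval is unbounded matters. -/
theorem AgeInterval.contains_iff_of_le {I : AgeInterval} {cap s t : ℕ}
    (hI : I.lower < cap ∧ ∀ u ∈ I.upper, u < cap) (hs : cap ≤ s) (ht : cap ≤ t) :
    I.Contains s ↔ I.Contains t := by
  obtain ⟨l, p, u, q⟩ := I
  obtain ⟨h₁, h₂⟩ := hI
  simp only at h₁ h₂
  refine and_congr ?_ ?_
  · cases p <;> simp <;> omega
  · refine forall₂_congr fun u hu => ?_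
    have := h₂ u hu
    cases q <;> simp <;> omega

/-- Leads of at least `cap` cannot be distinguished. -/
theorem LagStep.up_iff {cap : ℕ} (hN : N.Below cap) {free : Bool} {x y : Lag N}
    (hx : cap ≤ x.ahead) (hr : ∀ p ∈ x.rem, p.2 < cap) :
    LagStep N free x y ↔ LagStep N free x.up y.up := by
  constructor
  · intro h
    cases h with
    | freeze => exact .freeze ..
    | senderTick => exact .senderTick ..
    | receiverTick => exact .receiverTick ..
    | senderNop _ _ _ _ _ _ e he hop hg => exact .senderNop _ _ _ _ _ _ e he hop hg
    | receiverNop _ _ _ _ _ e he hop hg => exact .receiverNop _ _ _ _ _ e he hop hg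
    | transmit _ _ _ _ e he a hop hg f hf I hop' hg' hd =>
      exact .transmit _ _ _ _ e he a hop hg f hf I hop' hg'
        ((AgeInterval.contains_iff_of_le (hN.interval f hf a I hop') hx
          (le_trans hx (Nat.le_succ _))).1 hd)
    | write _ _ _ d r r' e he a hop hg h =>
      refine .write _ _ _ _ _ _ e he a hop hg ?_
      cases free
      · simp only [Bool.false_eq_true, if_false] at h
        -- A write that must match the pending list needs a final age `d` below `cap`; at leads from
        -- `cap` on it is impossible.
        have := hr (a, d) (by simp [h])
        simp only at this hx
        omega
      · exact h
  · intro h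
    obtain ⟨s, v, l, w, d, r, b⟩ := x
    obtain ⟨s', v', l', w', d', r', b'⟩ := y
    simp only [Lag.up] at h hx hr
    generalize hd₁ : d + 1 = d₁ at h
    generalize hd₂ : d' + 1 = d₂ at h
    cases h with
    | freeze => obtain rfl : d = d' := by omega
                exact .freeze ..
    | senderTick => obtain rfl : d = d' + 1 := by omega
                    exact .senderTick ..
    | receiverTick => obtain rfl : d' = d + 1 := by omega
                      exact .receiverTick ..
    | senderNop _ _ _ _ _ _ e he hop hg =>
      obtain rfl : d = d' := by omega
      exact .senderNop _ _ _ _ _ _ e he hop hg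
    | receiverNop _ _ _ _ _ e he hop hg =>
      obtain rfl : d = d' := by omega
      exact .receiverNop _ _ _ _ _ e he hop hg
    | transmit _ _ _ _ e he a hop hg f hf I hop' hg' hd =>
      obtain rfl : d = d' := by omega
      exact .transmit _ _ _ _ e he a hop hg f hf I hop' hg'
        ((AgeInterval.contains_iff_of_le (hN.interval f hf a I hop') hx (by omega)).2 hd)
    | write _ _ _ _ _ _ e he a hop hg h =>
      obtain rfl : d = d' := by omega
      refine .write _ _ _ _ _ _ e he a hop hg ?_
      cases free
      · simp only [Bool.false_eq_true, if_false] at h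
        have := hr (a, d₁) (by simp [h])
        simp only at this
        omega
      · exact h

/-- The control states of the lagged configurations in which the messages still to be written are a
suffix of `q`. -/
def ctrls (N : CTA) (cap : ℕ) (q : List (Fin N.messages × ℕ)) : Set RCtrl :=
  {c | ∃ y : Lag N, y.rem <:+ q ∧ (y.abs cap).1 = c}

/-- A control state is determined by the two locations, the truncated clock values, the length of
the prefix removed from `q`, and the stopping flag. -/
theorem ctrls_finite_card (N : CTA) (cap : ℕ) (q : List (Fin N.messages × ℕ)) :
    (ctrls N cap q).Finite ∧ (ctrls N cap q).ncard ≤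
      N.senderLocs * (cap + 1) ^ N.senderClocks * (N.receiverLocs * (cap + 1) ^ N.receiverClocks) *
        ((q.length + 1) * 2) := by
  let F : ((Fin N.senderLocs × (Fin N.senderClocks → Fin (cap + 1))) ×
      (Fin N.receiverLocs × (Fin N.receiverClocks → Fin (cap + 1)))) ×
        (Fin (q.length + 1) × Bool) → RCtrl := fun t =>
    ((t.1.1.1.val, List.ofFn fun i => (t.1.1.2 i).val),
      (t.1.2.1.val, List.ofFn fun i => (t.1.2.2 i).val),
      (q.drop t.2.1.val).map rawMsg, t.2.2)
  have hsub : ctrls N cap q ⊆ F '' Set.univ := by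
    rintro _ ⟨y, hy, rfl⟩
    obtain ⟨p, hp⟩ := hy
    have hlen : p.length < q.length + 1 := by rw [← hp, List.length_append]; omega
    refine ⟨(((y.sLoc, fun i => ⟨min (y.sVal i) cap, by omega⟩),
      (y.rLoc, fun i => ⟨min (y.rVal i) cap, by omega⟩)), (⟨p.length, hlen⟩, y.fin)), trivial, ?_⟩
    simp [F, Lag.abs, capVal, ← hp]
  have hfin : (F '' Set.univ).Finite := Set.finite_univ.image F
  refine ⟨hfin.subset hsub, (Set.ncard_le_ncard hsub hfin).trans
    ((Set.ncard_image_le Set.finite_univ).trans ?_)⟩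
  rw [Set.ncard_univ, Nat.card_eq_fintype_card]
  simp

/-- Targets as numerical data. -/
abbrev RTarget := Option ℕ × Option ℕ × Option (List ℕ × List ℕ)

/-- The numerical data of a target. -/
def Target.raw : Target N → RTarget
  | .senderLocation l => (some l.val, none, none)
  | .receiverLocation l => (none, some l.val, none)
  | .locations l l' => (some l.val, some l'.val, none)
  | .configuration γ =>
    (some γ.sLoc.val, some γ.rLoc.val, some (List.ofFn γ.sVal, List.ofFn γ.rVal))

/-- Whether a state meets a target. -/
def goalB (t : RTarget) (s : RState) : Bool :=
  decide (s.2 = 0) && (decide (s.1.2.2.1.length = 0) && (s.1.2.2.2 &&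
    ((t.1.elim true fun l => decide (s.1.1.1 = l)) &&
      ((t.2.1.elim true fun l => decide (s.1.2.1.1 = l)) &&
        (t.2.2.elim true fun v => decide (s.1.1.2 = v.1) && decide (s.1.2.1.2 = v.2))))))

/-- All constants of the target are below `cap`. -/
def Target.Below (T : Target N) (cap : ℕ) : Prop :=
  match T with
  | .configuration γ => (∀ i, γ.sVal i < cap) ∧ (∀ i, γ.rVal i < cap) ∧ ∀ p ∈ γ.chan, p.2 < cap
  | _ => True

/-- Values below `cap` arise only from themselves under truncation. Hence target configurations can
be recognised exactly. -/
theorem capVal_eq_ofFn_iff {k cap : ℕ} {v w : Fin k → ℕ} (hw : ∀ i, w i < cap) :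
    capVal cap v = List.ofFn w ↔ v = w := by
  rw [capVal, List.ofFn_inj]
  constructor
  · intro h
    funext i
    have h₁ : min (v i) cap = w i := congrFun h i
    have h₂ := hw i
    omega
  · rintro rfl
    funext i
    have := hw i
    change min (v i) cap = v i
    omega

theorem goalB_iff {T : Target N} {cap : ℕ} (hT : T.Below cap) (y : Lag N) :
    goalB T.raw (y.abs cap) = true ↔
      y.ahead = 0 ∧ y.rem = [] ∧ y.fin = true ∧ T.LagMetBy y := by
  have key : ∀ s : RState, goalB T.raw s = true ↔ s.2 = 0 ∧ s.1.2.2.1 = [] ∧ s.1.2.2.2 = true ∧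
      (T.raw.1.elim true fun l => decide (s.1.1.1 = l)) = true ∧
      (T.raw.2.1.elim true fun l => decide (s.1.2.1.1 = l)) = true ∧
      (T.raw.2.2.elim true fun v => decide (s.1.1.2 = v.1) && decide (s.1.2.1.2 = v.2)) = true := by
    intro s
    simp [goalB]
  rw [key]
  refine and_congr_right fun _ => and_congr (by simp [Lag.abs]) (and_congr_right fun _ => ?_)
  cases T with
  | configuration γ =>
    obtain ⟨h₁, h₂, -⟩ := hT
    simp [Target.raw, Lag.abs, Target.LagMetBy, Fin.val_inj, capVal_eq_ofFn_iff h₁,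
      capVal_eq_ofFn_iff h₂]
    tauto
  | _ => simp [Target.raw, Lag.abs, Target.LagMetBy, Fin.val_inj]

/-- The initial states. -/
def initsB (sI rI : List ℕ) (sC rC : ℕ) (q : List (ℕ × ℕ)) : List RState :=
  sI.flatMap fun s => rI.map fun l =>
    (((s, List.replicate sC 0), (l, List.replicate rC 0), q, false), 0)

/-- The initial states for a target. -/
def initStates (T : Target N) : List RState :=
  initsB (N.sender.initial.map Fin.val) (N.receiver.initial.map Fin.val) N.senderClocks
    N.receiverClocks (T.pending.map rawMsg)

theorem mem_initStates {T : Target N} {cap : ℕ} {s : RState} : s ∈ initStates T ↔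
    ∃ a ∈ N.sender.initial, ∃ b ∈ N.receiver.initial,
      Lag.abs (N := N) cap ⟨a, 0, b, 0, 0, T.pending, false⟩ = s := by
  have h : ∀ k, capVal cap (0 : Fin k → ℕ) = List.replicate k 0 := by
    intro k
    simp [capVal]
  simp only [initStates, initsB, List.mem_flatMap, List.mem_map, Lag.abs, h]
  constructor
  · rintro ⟨_, ⟨a, ha, rfl⟩, _, ⟨b, hb, rfl⟩, rfl⟩
    exact ⟨a, ha, b, hb, rfl⟩
  · rintro ⟨a, ha, b, hb, rfl⟩
    exact ⟨_, ⟨a, ha, rfl⟩, _, ⟨b, hb, rfl⟩, rfl⟩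

theorem Target.pending_below {T : Target N} {cap : ℕ} (hT : T.Below cap) :
    ∀ p ∈ T.pending, p.2 < cap := by
  cases T with
  | configuration γ => simpa [Target.pending] using hT.2.2
  | _ => simp [Target.pending]

/-- States reached from the initial states by numerical successors. -/
def SearchReach (T : Target N) (cap D : ℕ) (s : RState) : Prop :=
  ∃ s₀ ∈ initStates T, ReflTransGen (fun a b => b ∈ succs N.rawS N.rawR cap D T.free a) s₀ s

theorem SearchReach.exists_lag {T : Target N} {cap D : ℕ} (hN : N.Below cap) {s : RState}
    (h : SearchReach T cap D s) :
    ∃ y, LagReach T.free T.pending y ∧ y.rem <:+ T.pending ∧ y.abs cap = s ∧ s.2 ≤ D := by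
  obtain ⟨s₀, h₀, h⟩ := h
  obtain ⟨a, ha, b, hb, rfl⟩ := (mem_initStates (cap := cap)).1 h₀
  induction h with
  | refl =>
    exact ⟨_, ⟨a, ha, b, hb, .refl⟩, List.suffix_rfl, rfl, Nat.zero_le _⟩
  | tail _ hs ih =>
    obtain ⟨y, h₁, h₂, rfl, h₃⟩ := ih
    obtain ⟨z, h₄, rfl, h₅⟩ := (mem_succs_abs hN D T.free y _).1 hs
    exact ⟨z, h₁.trans (.single h₄), h₄.rem_suffix.trans h₂, rfl, by
      change y.ahead ≤ D at h₃
      change z.ahead ≤ D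
      omega⟩

/-- Reachability in terms of the search on numerical data. -/
theorem exists_reachable_iff_search {T : Target N} {cap D : ℕ} (hN : N.Below cap)
    (hT : T.Below cap) (hD : cap + (ctrls N cap T.pending).ncard ^ 2 ≤ D) :
    (∃ γ : Config N, γ.Reachable ∧ T.MetBy γ) ↔
      ∃ s, SearchReach T cap D s ∧ goalB T.raw s = true := by
  rw [exists_reachable_iff]
  constructor
  · rintro ⟨y, ⟨a, ha, b, hb, hy⟩, hg⟩
    refine ⟨y.abs cap, ⟨_, (mem_initStates (cap := cap)).2 ⟨a, ha, b, hb, rfl⟩, ?_⟩, (goalB_iff hT y).2 hg⟩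
    -- The projection of the lagged steps to numerical data, with no bound on the lead. The pending
    -- list is confined to suffixes of `T.pending`, which gives finitely many control states and
    -- final ages below `cap`.
    let step : RState → RState → Prop := fun s t => ∃ x z : Lag N, LagStep N T.free x z ∧
      x.rem <:+ T.pending ∧ x.abs cap = s ∧ z.abs cap = t
    have h₁ : ∀ y, ReflTransGen (LagStep N T.free) ⟨a, 0, b, 0, 0, T.pending, false⟩ y →
        y.rem <:+ T.pending ∧
        ReflTransGen step (Lag.abs (N := N) cap ⟨a, 0, b, 0, 0, T.pending, false⟩)
          (y.abs cap) := by
      intro y hy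
      induction hy with
      | refl => exact ⟨List.suffix_rfl, .refl⟩
      | tail _ hs ih => exact ⟨hs.rem_suffix.trans ih.1, ih.2.tail ⟨_, _, hs, ih.1, rfl, rfl⟩⟩
    have h₂ := (h₁ y hy).2
    have hrem : ∀ x : Lag N, x.rem <:+ T.pending → ∀ p ∈ x.rem, p.2 < cap := fun x hx p hp =>
      Target.pending_below hT p (hx.subset hp)
    have h₃ : ReflTransGen (BoundedStep step (cap + (ctrls N cap T.pending).ncard ^ 2))
        (Lag.abs (N := N) cap ⟨a, 0, b, 0, 0, T.pending, false⟩) ((y.abs cap).1, 0) := by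
      refine bounded_of_shift_above (ctrls_finite_card N cap T.pending).1 cap ?_ ?_ ?_ ?_ ?_
      · rintro q d q' d' ⟨x, z, h, hx, h₁, h₂⟩ _
        exact ⟨z, h.rem_suffix.trans hx, by rw [h₂]⟩
      · rintro q d q' d' ⟨x, z, h, hx, h₁, h₂⟩
        have e₁ : x.ahead = d := congrArg Prod.snd h₁
        have e₂ : z.ahead = d' := congrArg Prod.snd h₂
        have := h.ahead_le
        omega
      · intro q d q' d' hd hd'
        constructor
        · rintro ⟨x, z, h, hx, h₁, h₂⟩
          have e₁ : x.ahead = d := congrArg Prod.snd h₁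
          have e₂ : z.ahead = d' := congrArg Prod.snd h₂
          refine ⟨x.up, z.up, (LagStep.up_iff hN (by omega) (hrem x hx)).1 h, hx, ?_, ?_⟩
          · exact Prod.ext (congrArg Prod.fst h₁ :) (by simp [Lag.up, Lag.abs, e₁])
          · exact Prod.ext (congrArg Prod.fst h₂ :) (by simp [Lag.up, Lag.abs, e₂])
        · rintro ⟨x, z, h, hx, h₁, h₂⟩
          have e₁ : x.ahead = d + 1 := congrArg Prod.snd h₁
          have e₂ : z.ahead = d' + 1 := congrArg Prod.snd h₂
          obtain ⟨x, rfl, ex⟩ : ∃ x' : Lag N, x'.up = x ∧ x'.ahead = d :=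
            ⟨{ x with ahead := d }, by simp [Lag.up, ← e₁], rfl⟩
          obtain ⟨z, rfl, ez⟩ : ∃ z' : Lag N, z'.up = z ∧ z'.ahead = d' :=
            ⟨{ z with ahead := d' }, by simp [Lag.up, ← e₂], rfl⟩
          refine ⟨x, z, (LagStep.up_iff hN (by omega) (hrem x hx)).2 h, hx, ?_, ?_⟩
          · exact Prod.ext (congrArg Prod.fst h₁ :) (by simp [Lag.abs, ex])
          · exact Prod.ext (congrArg Prod.fst h₂ :) (by simp [Lag.abs, ez])
      · exact ⟨_, List.suffix_rfl, rfl⟩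
      · have e : (y.abs cap).2 = 0 := hg.1
        rw [show ((y.abs cap).1, 0) = y.abs cap from Prod.ext rfl e.symm]
        exact h₂
    have e : ((y.abs cap).1, 0) = y.abs cap := Prod.ext rfl hg.1.symm
    rw [e] at h₃
    refine h₃.lift (fun s => s) ?_
    rintro s t ⟨⟨x, z, h, hx, rfl, rfl⟩, h₁, h₂⟩
    exact (mem_succs_abs hN D T.free x _).2 ⟨z, h, rfl, .inr (h₂.trans hD)⟩
  · rintro ⟨s, hs, hg⟩
    obtain ⟨y, h₁, -, rfl, -⟩ := hs.exists_lag hN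
    exact ⟨y, h₁, (goalB_iff hT y).1 hg⟩

end TimedChannel

section

open StackMachine TEnc

/-! ### Exhaustive search -/

section Search

variable {σ : Type} [DecidableEq σ]

/-- Add the elements of `l` that are missing in `V`. -/
def addNew (V l : List σ) : List σ := l.foldl (fun V s => bif decide (s ∈ V) then V else s :: V) V

/-- `n` rounds of adding successors, starting from `l`. -/
def search (f : σ → List σ) (l : List σ) (n : ℕ) : List σ :=
  (List.replicate n ()).foldl (fun V _ => addNew V (V.flatMap f)) (addNew [] l)

theorem mem_addNew (V l : List σ) (s : σ) : s ∈ addNew V l ↔ s ∈ V ∨ s ∈ l := by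
  induction l generalizing V with
  | nil => simp [addNew]
  | cons a l ih =>
    have e : addNew V (a :: l) = addNew (bif decide (a ∈ V) then V else a :: V) l := rfl
    rw [e, ih]
    by_cases h : a ∈ V
    · simp only [h, decide_true, cond_true, List.mem_cons]
      constructor
      · tauto
      · rintro (h' | rfl | h') <;> tauto
    · simp only [h, decide_false, cond_false, List.mem_cons]
      tauto

theorem nodup_addNew {V : List σ} (h : V.Nodup) (l : List σ) : (addNew V l).Nodup := by
  induction l generalizing V with
  | nil => exact h
  | cons a l ih =>
    by_cases h' : a ∈ V
    · exact ih (V := bif decide (a ∈ V) then V else a :: V) (by simpa [h'] using h)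
    · exact ih (V := bif decide (a ∈ V) then V else a :: V) (by simp [h', h])

theorem search_succ (f : σ → List σ) (l : List σ) (n : ℕ) :
    search f l (n + 1) = addNew (search f l n) ((search f l n).flatMap f) := by
  simp only [search, List.replicate_succ', List.foldl_append, List.foldl_cons, List.foldl_nil]

theorem nodup_search (f : σ → List σ) (l : List σ) (n : ℕ) : (search f l n).Nodup := by
  induction n with
  | zero => exact nodup_addNew List.nodup_nil l
  | succ n ih =>
    rw [search_succ]
    exact nodup_addNew ih _

theorem mem_search_succ (f : σ → List σ) (l : List σ) (n : ℕ) (s : σ) :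
    s ∈ search f l (n + 1) ↔ s ∈ search f l n ∨ ∃ t ∈ search f l n, s ∈ f t := by
  rw [search_succ, mem_addNew, List.mem_flatMap]

/-- The elements reached from those of `l` by `f`. -/
def reachSet (f : σ → List σ) (l : List σ) : Set σ :=
  {s | ∃ s₀ ∈ l, Relation.ReflTransGen (fun a b => b ∈ f a) s₀ s}

theorem mem_reachSet_of_mem_search {f : σ → List σ} {l : List σ} {n : ℕ} {s : σ}
    (h : s ∈ search f l n) : s ∈ reachSet f l := by
  induction n generalizing s with
  | zero => exact ⟨s, by simpa [search, mem_addNew] using h, .refl⟩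
  | succ n ih =>
    rw [mem_search_succ] at h
    rcases h with h | ⟨t, ht, h⟩
    · exact ih h
    · obtain ⟨s₀, h₀, h₁⟩ := ih ht
      exact ⟨s₀, h₀, h₁.tail h⟩

/-- As sets, the rounds increase, and each is determined by the preceding one. Hence they stop
changing at the first repetition, and `subset_of_stabilizes` applies. -/
theorem mem_search_iff {f : σ → List σ} {l : List σ} {n : ℕ} (hf : (reachSet f l).Finite)
    (hn : (reachSet f l).ncard ≤ n) {s : σ} : s ∈ search f l n ↔ s ∈ reachSet f l := by
  refine ⟨mem_reachSet_of_mem_search, ?_⟩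
  rintro ⟨s₀, h₀, h⟩
  have key : ∀ {t}, Relation.ReflTransGen (fun a b => b ∈ f a) s₀ t → ∃ m, t ∈ search f l m := by
    intro t h
    induction h with
    | refl => exact ⟨0, by simpa [search, mem_addNew] using h₀⟩
    | tail _ h ih =>
      obtain ⟨m, hm⟩ := ih
      exact ⟨m + 1, (mem_search_succ ..).2 (.inr ⟨_, hm, h⟩)⟩
  obtain ⟨m, hm⟩ := key h
  refine subset_of_stabilizes (R := fun n => {s | s ∈ search f l n}) hf ?_ ?_ ?_ hn m hm
  · exact monotone_nat_of_le_succ fun n s hs => (mem_search_succ ..).2 (.inl hs)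
  · exact fun n s hs => mem_reachSet_of_mem_search hs
  · intro n h
    have h' : ∀ s, s ∈ search f l n ↔ s ∈ search f l (n + 1) := fun s => Set.ext_iff.1 h s
    ext s
    change s ∈ search f l (n + 1) ↔ s ∈ search f l (n + 1 + 1)
    rw [mem_search_succ, mem_search_succ f l (n + 1)]
    simp only [h']

/-- The lists have no repetitions. This bounds the accumulator of the search loop uniformly in the
number of rounds. -/
theorem length_search_le {f : σ → List σ} {l : List σ} {n : ℕ} (hf : (reachSet f l).Finite) :
    (search f l n).length ≤ (reachSet f l).ncard := by
  rw [← List.toFinset_card_of_nodup (nodup_search f l n), ← Set.ncard_coe_finset]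
  refine Set.ncard_le_ncard (fun s hs => ?_) hf
  exact mem_reachSet_of_mem_search (by simpa using hs)

variable {α : Type} [TEnc α] [TEnc σ]

theorem sz_addNew_le (V l : List σ) : sz (addNew V l) ≤ sz V + sz l := by
  induction l generalizing V with
  | nil => simp [addNew]
  | cons a l ih =>
    have h := ih (bif decide (a ∈ V) then V else a :: V)
    have e : addNew V (a :: l) = addNew (bif decide (a ∈ V) then V else a :: V) l := rfl
    rw [e]
    by_cases h' : a ∈ V
    · simp only [h', decide_true, cond_true, sz_cons] at *
      omega
    · simp only [h', decide_false, cond_false, sz_cons] at *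
      omega

@[fun_prop]
theorem Feas.addNew [FeasEq σ] {V l : α → List σ} (hV : Feas V) (hl : Feas l) :
    Feas fun a => addNew (V a) (l a) := by
  refine Feas.foldl (f := fun _ V s => bif decide (s ∈ V) then V else s :: V)
    (B := fun a => sz (V a) + sz (l a)) hl hV (by fun_prop) (by fun_prop) fun a l' h => ?_
  have h₁ := sz_addNew_le (V a) l'
  have h₂ := sz_prefix_le h
  rw [_root_.addNew] at h₁
  omega

theorem Feas.search [FeasEq σ] {f : α → σ → List σ} {l : α → List σ} {n : α → ℕ}
    (hf : Feas fun p : α × σ => f p.1 p.2) (hl : Feas l) (hn : Feas n) {B : α → ℕ}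
    (hB : PolyBdd B) (h : ∀ a m, sz (search (f a) (l a) m) ≤ B a) :
    Feas fun a => search (f a) (l a) (n a) := by
  refine Feas.foldl (f := fun a V _ => _root_.addNew V (V.flatMap (f a))) (B := B) hn.units
    (by fun_prop) ?_ hB fun a l' h' => ?_
  · refine Feas.addNew (by fun_prop) (Feas.flatMap (by fun_prop) ?_)
    exact hf.comp (f := fun p : (α × List σ × Unit) × σ => (p.1.1, p.2)) (by fun_prop)
  · have e : l' = List.replicate l'.length () := List.eq_replicate_of_mem fun _ _ => rfl
    rw [e]
    exact h a l'.length

end Search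

end

open StackMachine TEnc

namespace TimedChannel

instance : DecidableEq RState := instDecidableEqProd

/-! ### The search is polynomial in its parameters -/

section Feasible

variable {α ω : Type} [TEnc α] [TEnc ω]

@[fun_prop]
theorem feas_cmpB {o v k : α → ℕ} (ho : Feas o) (hv : Feas v) (hk : Feas k) :
    Feas fun a => cmpB (o a) (v a) (k a) := by
  unfold cmpB
  fun_prop

@[fun_prop]
theorem feas_guardB {v : α → List ℕ} {g : α → List (ℕ × ℕ × ℕ)} (hv : Feas v) (hg : Feas g) :
    Feas fun a => guardB (v a) (g a) := by
  unfold guardB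
  fun_prop

@[fun_prop]
theorem feas_containsB {I : α → RInterval} {t : α → ℕ} (hI : Feas I) (ht : Feas t) :
    Feas fun a => containsB (I a) (t a) := by
  unfold containsB
  fun_prop

@[fun_prop]
theorem feas_resetB {v Y : α → List ℕ} (hv : Feas v) (hY : Feas Y) :
    Feas fun a => resetB (v a) (Y a) := by
  unfold resetB
  fun_prop

@[fun_prop]
theorem feas_tickB {cap : α → ℕ} {x : α → ℕ × List ℕ} (hc : Feas cap) (hx : Feas x) :
    Feas fun a => tickB (cap a) (x a) := by
  unfold tickB
  fun_prop

@[fun_prop]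
theorem feas_moves {T : α → List (RTrans ω)} {x : α → ℕ × List ℕ} (hT : Feas T) (hx : Feas x) :
    Feas fun a => moves (T a) (x a) := by
  unfold moves
  fun_prop

@[fun_prop]
theorem feas_writeB {free : α → Bool} {m : α → ℕ} {A : α → ℕ × List ℕ} {s : α → RState}
    (hf : Feas free) (hm : Feas m) (hA : Feas A) (hs : Feas s) :
    Feas fun a => writeB (free a) (m a) (A a) (s a) := by
  unfold writeB
  fun_prop

@[fun_prop]
theorem feas_transmitB {T : α → List (RTrans (Option (ℕ × RInterval)))} {m : α → ℕ}
    {A : α → ℕ × List ℕ} {s : α → RState} (hT : Feas T) (hm : Feas m) (hA : Feas A)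
    (hs : Feas s) : Feas fun a => transmitB (T a) (m a) (A a) (s a) := by
  unfold transmitB
  fun_prop

@[fun_prop]
theorem feas_succs {S : α → List (RTrans (Option ℕ))}
    {T : α → List (RTrans (Option (ℕ × RInterval)))} {cap D : α → ℕ} {free : α → Bool}
    {s : α → RState} (hS : Feas S) (hT : Feas T) (hcap : Feas cap) (hD : Feas D) (hf : Feas free)
    (hs : Feas s) : Feas fun a => succs (S a) (T a) (cap a) (D a) (free a) (s a) := by
  unfold succs
  fun_prop

@[fun_prop]
theorem feas_goalB {t : α → RTarget} {s : α → RState} (ht : Feas t) (hs : Feas s) :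
    Feas fun a => goalB (t a) (s a) := by
  unfold goalB
  fun_prop

@[fun_prop]
theorem feas_initsB {s r : α → List ℕ} {m n : α → ℕ} {q : α → List (ℕ × ℕ)} (hs : Feas s)
    (hr : Feas r) (hm : Feas m) (hn : Feas n) (hq : Feas q) :
    Feas fun a => initsB (s a) (r a) (m a) (n a) (q a) := by
  have h : ∀ k, List.replicate k 0 = (List.range k).map fun _ => 0 := by simp
  simp only [initsB, h]
  fun_prop

end Feasible

variable {N : CTA}

theorem mem_reachSet_iff {T : Target N} {cap D : ℕ} {s : RState} :
    s ∈ reachSet (succs N.rawS N.rawR cap D T.free) (initStates T) ↔ SearchReach T cap D s :=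
  Iff.rfl

/-- A state found by the search is a control state from `ctrls` together with a lead at most `D`. -/
theorem reachSet_finite_card {T : Target N} {cap D : ℕ} (hN : N.Below cap) :
    (reachSet (succs N.rawS N.rawR cap D T.free) (initStates T)).Finite ∧
      (reachSet (succs N.rawS N.rawR cap D T.free) (initStates T)).ncard ≤
        (ctrls N cap T.pending).ncard * (D + 1) := by
  have hsub : reachSet (succs N.rawS N.rawR cap D T.free) (initStates T) ⊆
      ctrls N cap T.pending ×ˢ ((Finset.range (D + 1) : Finset ℕ) : Set ℕ) := by
    intro s hs
    obtain ⟨y, -, h₂, rfl, h₃⟩ := SearchReach.exists_lag hN hs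
    refine ⟨⟨y, h₂, rfl⟩, ?_⟩
    simp only [Finset.coe_range, Set.mem_Iio]
    omega
  have hfin := (ctrls_finite_card N cap T.pending).1.prod (Finset.finite_toSet (Finset.range (D + 1)))
  refine ⟨hfin.subset hsub, (Set.ncard_le_ncard hsub hfin).trans ?_⟩
  rw [Set.ncard_prod, Set.ncard_coe_finset, Finset.card_range]

theorem sz_capVal_le {k cap : ℕ} (v : Fin k → ℕ) : sz (capVal cap v) ≤ k * (2 * cap + 2) + 1 := by
  have h := sz_list_le (l := capVal cap v) (B := 2 * cap + 1) fun n hn => by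
    simp only [capVal, List.mem_ofFn] at hn
    obtain ⟨i, rfl⟩ := hn
    rw [sz_nat]
    omega
  simpa [capVal] using h

theorem sz_suffix_le {α : Type} [TEnc α] {l l' : List α} (h : l' <:+ l) : sz l' ≤ sz l := by
  obtain ⟨k, rfl⟩ := h
  have := sz_append k l'
  have := sz_pos k
  omega

theorem SearchReach.sz_le {T : Target N} {cap D : ℕ} (hN : N.Below cap) {s : RState}
    (h : SearchReach T cap D s) : sz s ≤ 2 * N.senderLocs + 2 * N.receiverLocs +
      (N.senderClocks + N.receiverClocks) * (2 * cap + 2) + sz (T.pending.map rawMsg) + 2 * D +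
        20 := by
  obtain ⟨y, -, h₂, rfl, h₃⟩ := SearchReach.exists_lag hN h
  have e₁ := sz_capVal_le (cap := cap) y.sVal
  have e₂ := sz_capVal_le (cap := cap) y.rVal
  have e₃ := sz_suffix_le (h₂.map rawMsg)
  have e₄ := sz_bool_le y.fin
  have e₅ := y.sLoc.isLt
  have e₆ := y.rLoc.isLt
  change y.ahead ≤ D at h₃
  simp only [Lag.abs, sz_pair, sz_nat, Nat.add_mul]
  omega

/-- The search for a target. -/
def decideB (T : Target N) (cap D n : ℕ) : Bool :=
  (search (succs N.rawS N.rawR cap D T.free) (initStates T) n).any (goalB T.raw)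

theorem decideB_iff {T : Target N} {cap D n : ℕ} (hN : N.Below cap) (hT : T.Below cap)
    (hD : cap + (ctrls N cap T.pending).ncard ^ 2 ≤ D)
    (hn : (ctrls N cap T.pending).ncard * (D + 1) ≤ n) :
    decideB T cap D n = true ↔ ∃ γ : Config N, γ.Reachable ∧ T.MetBy γ := by
  obtain ⟨h₁, h₂⟩ := reachSet_finite_card (D := D) (T := T) hN
  rw [exists_reachable_iff_search hN hT hD, decideB, List.any_eq_true]
  simp only [mem_search_iff h₁ (h₂.trans hn), mem_reachSet_iff]

/-- At every moment the search holds at most `n a` distinct states, each of size polynomial in the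
parameters (`SearchReach.sz_le`); this is the accumulator bound. Of `N` and `T`, which have no trees
themselves, only the numerical data have to be computable. -/
theorem feas_decideB {α : Type} [TEnc α] {N : α → CTA} {T : ∀ a, Target (N a)} {cap D n : α → ℕ}
    (hcap : Feas cap) (hD : Feas D) (hn : Feas n) (hS : Feas fun a => (N a).rawS)
    (hR : Feas fun a => (N a).rawR) (hfree : Feas fun a => (T a).free)
    (hinit : Feas fun a => initStates (T a)) (hpend : Feas fun a => (T a).pending.map rawMsg)
    (hraw : Feas fun a => (T a).raw)
    (h₁ : PolyBdd fun a => (N a).senderLocs) (h₂ : PolyBdd fun a => (N a).receiverLocs)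
    (h₃ : PolyBdd fun a => (N a).senderClocks) (h₄ : PolyBdd fun a => (N a).receiverClocks)
    (hN : ∀ a, (N a).Below (cap a))
    (hcard : ∀ a, (ctrls (N a) (cap a) (T a).pending).ncard * (D a + 1) ≤ n a) :
    Feas fun a => decideB (T a) (cap a) (D a) (n a) := by
  have hpend' := hpend.poly_sz
  unfold decideB
  refine Feas.any (Feas.search
    (f := fun a => succs (N a).rawS (N a).rawR (cap a) (D a) (T a).free)
    (B := fun a => n a * (2 * (N a).senderLocs + 2 * (N a).receiverLocs +
      ((N a).senderClocks + (N a).receiverClocks) * (2 * cap a + 2) +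
        sz ((T a).pending.map rawMsg) + 2 * D a + 20 + 1) + 1) ?_ hinit hn ?_ fun a m => ?_) ?_
  · exact feas_succs (hS.comp Feas.id.fst) (hR.comp Feas.id.fst) (hcap.comp Feas.id.fst)
      (hD.comp Feas.id.fst) (hfree.comp Feas.id.fst) Feas.id.snd
  · fun_prop
  · obtain ⟨e₁, e₂⟩ := reachSet_finite_card (D := D a) (T := T a) (hN a)
    refine (sz_list_le fun s hs => SearchReach.sz_le (hN a)
      (mem_reachSet_of_mem_search hs)).trans ?_
    exact Nat.add_le_add_right (Nat.mul_le_mul_right _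
      ((length_search_le e₁).trans (e₂.trans (hcard a)))) 1
  · exact feas_goalB (hraw.comp Feas.id.fst) Feas.id.snd

end TimedChannel

section

open StackMachine TEnc

/-! ### Reading sequences of numbers -/

section Parse

variable {α β γ : Type} [TEnc α] [TEnc β] [TEnc γ]

/-- An element presented by the sequence of numbers `f val`, followed by further numbers. -/
structure Coded (f : α → List ℕ) where
  val : α
  rest : List ℕ

/-- The tree shows only the raw sequence of numbers. A feasible function on `Coded f` thus has to
work from this sequence, while its specification may speak of the element presented. -/
instance {δ : Type} (f : δ → List ℕ) : TEnc (Coded f) where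
  enc x := enc (f x.val ++ x.rest)

theorem sz_coded {δ : Type} {f : δ → List ℕ} (x : Coded f) : sz x = sz (f x.val ++ x.rest) := rfl

@[fun_prop]
theorem Feas.tokens {δ : Type} {f : δ → List ℕ} {x : α → Coded f} (hx : Feas x) :
    Feas fun a => f (x a).val ++ (x a).rest := hx.of_enc_eq fun _ => rfl

/-- Elements can be read from the sequences of numbers that present them. -/
structure Parses (f : α → List ℕ) : Prop where
  feas : Feas fun x : Coded f => (x.val, x.rest)
  -- The margin two is what survives concatenation: appending loses one from the two code sizes and
  -- the pair constructor adds one.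
  le : ∀ a, sz a + 2 ≤ sz (f a)

theorem Parses.read {f : β → List ℕ} (hf : Parses f) {x : α → β} {r : α → List ℕ}
    (h : Feas fun a => f (x a) ++ r a) : Feas fun a => (x a, r a) :=
  hf.feas.comp (f := fun a => (⟨x a, r a⟩ : Coded f)) (h.of_enc_eq fun _ => rfl)

def serNat (n : ℕ) : List ℕ := [n]

def serPair (f : α → List ℕ) (g : β → List ℕ) (p : α × β) : List ℕ := f p.1 ++ g p.2

def serOption (f : α → List ℕ) (o : Option α) : List ℕ := o.elim [0] fun a => 1 :: f a

/-- The list `n :: r` and the pair `(n, r)` have the same tree, so nothing has to be done. -/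
theorem parses_nat : Parses serNat where
  feas := Feas.id.of_enc_eq fun _ => rfl
  le n := by simp [serNat]

theorem Parses.pair {f : α → List ℕ} {g : β → List ℕ} (hf : Parses f) (hg : Parses g) :
    Parses (serPair f g) where
  feas := by
    have h₁ : Feas fun x : Coded (serPair f g) => (x.val.1, g x.val.2 ++ x.rest) :=
      hf.read (Feas.id.tokens.congr fun x => by simp [serPair])
    have h₂ := hg.read h₁.snd
    exact (h₁.fst.prodMk h₂.fst).prodMk h₂.snd
  le p := by
    have h₁ := hf.le p.1
    have h₂ := hg.le p.2
    have h₃ := sz_append (f p.1) (g p.2)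
    simp only [serPair, sz_pair]
    omega

theorem Parses.option {f : α → List ℕ} (hf : Parses f) : Parses (serOption f) where
  feas := by
    let b : Coded (serOption f) → Bool := fun x =>
      decide ((serOption f x.val ++ x.rest).headD 0 = 1)
    have hb : ∀ x, b x = x.val.isSome := by
      rintro ⟨_ | a, r⟩ <;> simp [b, serOption]
    have ht : Feas fun x : Coded (serOption f) => (serOption f x.val ++ x.rest).tail := by fun_prop
    refine Feas.cond_restrict (b := b) (by fun_prop) ?_ ?_
    · refine ((Feas.const none).prodMk (ht.restrict _)).congr ?_
      rintro ⟨⟨_ | a, r⟩, h⟩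
      · rfl
      · simp [hb] at h
    · have h₁ : ∀ x : {x // b x = true}, x.1.val.isSome = true := fun x => (hb x.1).symm.trans x.2
      have h₂ := hf.read (x := fun x : {x // b x = true} => x.1.val.get (h₁ x))
        (r := fun x => x.1.rest) ((ht.restrict _).congr fun ⟨⟨o, r⟩, h⟩ => by
          cases o
          · simp [hb] at h
          · rfl)
      exact (h₂.fst.some.prodMk h₂.snd).congr fun x => by simp
  le o := by
    cases o with
    | none => simp [serOption]
    | some a =>
      have := hf.le a
      simp [serOption]
      omega

-- The loop moves one element at a time from the code to a reversed accumulator. The whole sequence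
-- of numbers serves as its fuel: it is at least as long as the list, and superfluous rounds do
-- nothing. The bound on `f` has no margin here, so that empty codes of units are admitted; unary
-- sizes are read this way.
open TimedChannel in
theorem parses_codeList {f : α → List ℕ} (hf : Feas fun x : Coded f => (x.val, x.rest))
    (hle : ∀ a, sz a ≤ sz (f a)) : Parses (codeList f) := by
  have le : ∀ l : List α, sz l + 2 ≤ sz (codeList f l) := by
    intro l
    induction l with
    | nil => simp [codeList]
    | cons a l ih =>
      have h₁ := hle a
      have h₂ := sz_append (f a) (codeList f l)
      simp only [codeList, sz_cons, sz_nat]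
      omega
  refine ⟨?_, le⟩
  let step : List α × Coded (codeList f) → List α × Coded (codeList f) := fun s =>
    lcase s.2.val s fun a t => (a :: s.1, ⟨t, s.2.rest⟩)
  have key : ∀ (k : List ℕ) acc l r, k.foldl (fun s _ => step s) (acc, ⟨l, r⟩) =
      ((l.take k.length).reverse ++ acc, ⟨l.drop k.length, r⟩) := by
    intro k
    induction k with
    | nil => simp
    | cons n k ih =>
      rintro acc (_ | ⟨a, l⟩) r
      · rw [List.foldl_cons]
        exact (ih acc [] r).trans (by simp)
      · rw [List.foldl_cons]
        exact (ih (a :: acc) l r).trans (by simp)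
  have hstep : Feas step := by
    let b : List α × Coded (codeList f) → Bool := fun s =>
      decide ((codeList f s.2.val ++ s.2.rest).headD 0 = 1)
    have hb : ∀ s, b s = true ↔ s.2.val ≠ [] := by
      rintro ⟨acc, ⟨_ | ⟨a, l⟩, r⟩⟩ <;> simp [b, codeList]
    refine Feas.cond_restrict (b := b) (by fun_prop) ?_ ?_
    · refine (Feas.id.restrict _).congr fun ⟨⟨acc, ⟨l, r⟩⟩, h⟩ => ?_
      have : l = [] := by
        by_contra h'
        rw [(hb _).2 h'] at h
        simp at h
      subst this
      rfl
    · have h₀ : ∀ x : {x // b x = true}, x.1.2.val ≠ [] := fun x => (hb x.1).1 x.2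
      have h₁ := hf.comp (f := fun x : {x // b x = true} =>
        (⟨x.1.2.val.head (h₀ x), codeList f x.1.2.val.tail ++ x.1.2.rest⟩ : Coded f))
        ((Feas.restrict (f := fun s : List α × Coded (codeList f) =>
          (codeList f s.2.val ++ s.2.rest).tail) (by fun_prop) _).of_enc_eq
          fun ⟨⟨acc, ⟨l, r⟩⟩, h⟩ => by
            cases l with
            | nil => simp [hb] at h
            | cons a l =>
              change enc (f a ++ (codeList f l ++ r)) = enc ((f a ++ codeList f l) ++ r)
              rw [List.append_assoc])
      have h₂ : Feas fun x : {x // b x = true} =>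
          (⟨x.1.2.val.tail, x.1.2.rest⟩ : Coded (codeList f)) := h₁.snd.of_enc_eq fun _ => rfl
      have h₃ : Feas fun x : {x // b x = true} => x.1.1 := Feas.restrict (by fun_prop) _
      refine ((h₁.fst.cons h₃).prodMk h₂).congr fun ⟨⟨acc, ⟨l, r⟩⟩, h⟩ => ?_
      cases l with
      | nil => simp [hb] at h
      | cons a l => rfl
  have hfold : Feas fun x : Coded (codeList f) =>
      (codeList f x.val ++ x.rest).foldl (fun s _ => step s) ([], x) := by
    refine Feas.foldl (f := fun _ s _ => step s) (B := fun x => sz x + sz x + 1)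
      (s := fun x => (([] : List α), x)) (by fun_prop) (by fun_prop)
      (hstep.comp (f := fun p : Coded (codeList f) × (List α × Coded (codeList f)) × ℕ => p.2.1)
        (by fun_prop)) ((PolyBdd.sz_id.add PolyBdd.sz_id).add (.const 1)) fun x l' _ => ?_
    rw [key]
    have h₁ := sz_append (x.val.take l'.length) (x.val.drop l'.length)
    have h₂ := le x.val
    have h₃ : ∀ k (l : List α), sz (codeList f (l.drop k)) ≤ sz (codeList f l) := by
      intro k
      induction k with
      | zero => simp
      | succ k ih =>
        rintro (_ | ⟨a, l⟩)
        · simp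
        · have h₁ := ih l
          have h₂ := sz_append (f a) (codeList f l)
          have h₃ := sz_pos (f a)
          simp only [List.drop_succ_cons, codeList, sz_cons, sz_nat]
          omega
    have h₄ := h₃ l'.length x.val
    have h₅ := sz_append (codeList f (x.val.drop l'.length)) x.rest
    have h₆ := sz_append (codeList f x.val) x.rest
    have h₇ := sz_pos (x.val.drop l'.length)
    have h₈ := sz_pos x.rest
    rw [List.take_append_drop] at h₁
    simp only [sz_pair, sz_coded, List.append_nil, sz_reverse]
    omega
  refine ((hfold.fst.reverse).prodMk hfold.snd.tokens.tail).congr fun x => ?_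
  have h₁ : x.val.length ≤ (codeList f x.val ++ x.rest).length := by
    have : ∀ l : List α, l.length ≤ (codeList f l).length := by
      intro l
      induction l with
      | nil => simp
      | cons a l ih => simp [codeList]; omega
    have := this x.val
    rw [List.length_append]
    omega
  have h₂ := key (codeList f x.val ++ x.rest) [] x.val x.rest
  rw [List.take_of_length_le h₁, List.drop_of_length_le h₁] at h₂
  rw [show ((⟨x.val, x.rest⟩ : Coded (codeList f)) = x) from rfl] at h₂
  rw [h₂]
  simp [codeList]

open TimedChannel in
theorem Parses.list {f : α → List ℕ} (hf : Parses f) : Parses (codeList f) :=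
  parses_codeList hf.feas fun a => (Nat.le_add_right _ 2).trans (hf.le a)

-- A unary size is the code of a list of units, each with empty code.
open TimedChannel in
theorem parses_codeSize : Parses codeSize where
  feas := by
    have h := parses_codeList (f := fun _ : Unit => []) (Feas.of_enc_eq (f := fun x =>
      ((), ([] : List ℕ) ++ x.rest)) ((Feas.const ()).prodMk
        (Feas.tokens (f := fun _ : Unit => []) Feas.id)) fun _ => rfl) (fun _ => le_rfl)
    have e : ∀ n, codeList (fun _ : Unit => []) (List.replicate n ()) = codeSize n := by
      intro n
      induction n with
      | zero => rfl
      | succ n ih =>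
        simp only [List.replicate_succ, codeList, List.nil_append, codeSize, List.cons_append] at *
        rw [ih]
    have h₁ := h.read (x := fun x : Coded codeSize => List.replicate x.val ())
      (r := fun x => x.rest) (Feas.id.tokens.congr fun x => by rw [e])
    exact (h₁.fst.length_units.congr fun x => by simp).prodMk h₁.snd
  le n := by
    have h : sz (codeSize n) = 4 * n + 3 := by
      induction n with
      | zero => simp [codeSize]
      | succ n ih =>
        simp only [codeSize, List.replicate_succ, List.cons_append, sz_cons, sz_nat] at *
        omega
    rw [sz_nat]
    omega

end Parse

end

section

open StackMachine TEnc TimedChannel Computability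

/-! ### Reading numbers written in binary -/

/-- Prepend a digit to a list of numbers: a binary digit to its first number, or a separator. -/
def pushDigit (l : List ℕ) (o : Option Bool) : List ℕ :=
  o.elim (0 :: l) fun b => (l.headD 0 + l.headD 0 + bif b then 1 else 0) :: l.tail

/-- Binary codes put the least significant digit first, so the reversed string presents the digits
in the order of Horner's scheme. The separator following a number comes before it in this order and
opens it with the value `0`. -/
theorem foldl_pushDigit_bits (bits : List Bool) (l : List ℕ) :
    (bits.map some).reverse.foldl pushDigit (0 :: l) =
      bits.foldr (fun b n => n + n + bif b then 1 else 0) 0 :: l := by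
  induction bits with
  | nil => rfl
  | cons b bits ih =>
    rw [List.map_cons, List.reverse_cons, List.foldl_append, ih]
    rfl

theorem foldr_encodePosNum (n : PosNum) :
    (encodePosNum n).foldr (fun b n => n + n + bif b then 1 else 0) 0 = (n : ℕ) := by
  induction n with
  | one => rfl
  | bit0 n ih => simp [encodePosNum, ih]
  | bit1 n ih => simp [encodePosNum, ih]

theorem foldr_encodeNat (n : ℕ) :
    (encodeNat n).foldr (fun b n => n + n + bif b then 1 else 0) 0 = n := by
  rw [encodeNat]
  conv_rhs => rw [← Num.to_of_nat n]
  cases (n : Num) with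
  | zero => rfl
  | pos m => exact foldr_encodePosNum m

theorem writeNumbers_cons (n : ℕ) (l : List ℕ) :
    writeNumbers (n :: l) = (encodeNat n).map some ++ none :: writeNumbers l := by
  simp [writeNumbers]

theorem length_writeNumbers_cons (n : ℕ) (l : List ℕ) :
    (writeNumbers (n :: l)).length = (encodeNat n).length + 1 + (writeNumbers l).length := by
  rw [writeNumbers_cons, List.length_append, List.length_map, List.length_cons]
  omega

theorem foldl_pushDigit_writeNumbers (l : List ℕ) :
    (writeNumbers l).reverse.foldl pushDigit [] = l := by
  induction l with
  | nil => rfl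
  | cons n l ih =>
    rw [writeNumbers_cons, List.reverse_append, List.reverse_cons, List.foldl_append, List.foldl_append, ih]
    change ((encodeNat n).map some).reverse.foldl pushDigit (0 :: l) = _
    rw [foldl_pushDigit_bits, foldr_encodeNat]

theorem foldr_digits_lt (bits : List Bool) :
    bits.foldr (fun b n => n + n + bif b then 1 else 0) 0 < 2 ^ bits.length := by
  induction bits with
  | nil => simp
  | cons b bits ih =>
    simp only [List.foldr_cons, List.length_cons, pow_succ]
    cases b <;> simp <;> omega

/-- A number is below two to the power of its number of digits, and the separator's factor two
absorbs the addition. The sum is used to obtain a bound above all constants. -/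
theorem sum_lt_two_pow_length_writeNumbers (l : List ℕ) :
    l.sum < 2 ^ (writeNumbers l).length := by
  induction l with
  | nil => simp
  | cons n l ih =>
    have h := foldr_digits_lt (encodeNat n)
    rw [foldr_encodeNat] at h
    rw [length_writeNumbers_cons, List.sum_cons, pow_add, pow_succ]
    have h₁ := Nat.le_mul_of_pos_right (2 ^ (encodeNat n).length)
      (Nat.two_pow_pos (writeNumbers l).length)
    have h₂ := Nat.le_mul_of_pos_left (2 ^ (writeNumbers l).length)
      (Nat.two_pow_pos (encodeNat n).length)
    linarith

theorem length_le_length_writeNumbers (l : List ℕ) : l.length ≤ (writeNumbers l).length := by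
  induction l with
  | nil => simp
  | cons n l ih =>
    rw [length_writeNumbers_cons, List.length_cons]
    omega

/-- Each symbol at most doubles the unary size, up to a constant, so all intermediate results of the
decoding are within the padding. -/
theorem sz_foldl_pushDigit (k : List (Option Bool)) :
    sz (k.foldl pushDigit []) + 4 ≤ 5 * 2 ^ k.length := by
  induction k using List.reverseRecOn with
  | nil => simp
  | append_singleton k o ih =>
    rw [List.foldl_append, List.length_append, List.length_singleton, pow_succ]
    simp only [List.foldl_cons, List.foldl_nil]
    generalize k.foldl pushDigit [] = l at *
    rcases o with _ | b
    · simp only [pushDigit, Option.elim_none, sz_cons, sz_nat]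
      omega
    · rcases l with _ | ⟨n, l⟩ <;> cases b <;> simp [pushDigit] at * <;> omega

/-- The sequence of numbers written in a reversed string can be read in time polynomial in any bound
for `2 ^ n`, where `n` is the length of the string. -/
theorem Feas.numbers {α : Type} [TEnc α] {l : α → List ℕ} {s : α → List (Option Bool)} (hs : Feas s)
    (hl : ∀ a, s a = (writeNumbers (l a)).reverse) {B : α → ℕ} (hB : PolyBdd B)
    (h : ∀ a, 2 ^ (s a).length ≤ B a) : Feas l := by
  refine (Feas.foldl (f := fun _ => pushDigit) (s := fun _ => []) (B := fun a => 5 * B a) hs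
    (.const []) (by unfold pushDigit; fun_prop) (by fun_prop) fun a l' h' => ?_).congr fun a => by
      rw [hl, foldl_pushDigit_writeNumbers]
  have h₁ := sz_foldl_pushDigit l'
  have h₂ := Nat.pow_le_pow_right (n := 2) (by norm_num) h'.length_le
  have h₃ := h a
  omega

end

open StackMachine TEnc

/-! ### Reading instances -/

namespace TimedChannel

theorem codeList_map {α β : Type} (f : β → List ℕ) (g : α → β) (l : List α) :
    codeList f (l.map g) = codeList (fun a => f (g a)) l := by
  induction l with
  | nil => rfl
  | cons a l ih => simp only [List.map_cons, codeList, ih]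

/-- The functions `ser…` rebuild the codes of instances on numerical data from `serPair`,
`serOption` and `codeList`, so that their parsers are assembled from those of the parts. -/
def serAtom : ℕ × ℕ × ℕ → List ℕ := serPair serNat (serPair serNat serNat)

def serInterval : RInterval → List ℕ :=
  serPair serNat (serPair serNat (serPair (serOption serNat) serNat))

def serSend : Option ℕ → List ℕ := serOption serNat

def serRecv : Option (ℕ × RInterval) → List ℕ := serOption (serPair serNat serInterval)

def serTrans {ω : Type} (f : ω → List ℕ) : RTrans ω → List ℕ :=
  serPair serNat (serPair (codeList serAtom) (serPair f (serPair (codeList serNat) serNat)))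

/-- Automata as numerical data. -/
abbrev RAutomaton (ω : Type) := List ℕ × List ℕ × List (RTrans ω)

def rawAutomaton {n k : ℕ} {Op ω : Type} (f : Op → ω) (A : TimedAutomaton (Fin n) (Fin k) Op) :
    RAutomaton ω :=
  (A.initial.map Fin.val, A.final.map Fin.val, A.transitions.map (rawTrans f))

def serAutomaton {ω : Type} (f : ω → List ℕ) : RAutomaton ω → List ℕ :=
  serPair (codeList serNat) (serPair (codeList serNat) (codeList (serTrans f)))

/-- Communicating automata as numerical data. -/
abbrev RCTA := ℕ × ℕ × ℕ × ℕ × ℕ × RAutomaton (Option ℕ) × RAutomaton (Option (ℕ × RInterval))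

def CTA.raw (N : CTA) : RCTA :=
  (N.senderLocs, N.senderClocks, N.receiverLocs, N.receiverClocks, N.messages,
    rawAutomaton rawSend N.sender, rawAutomaton rawRecv N.receiver)

def serCTA : RCTA → List ℕ :=
  serPair codeSize (serPair codeSize (serPair codeSize (serPair codeSize (serPair codeSize
    (serPair (serAutomaton serSend) (serAutomaton serRecv))))))

def serMsg : ℕ × ℕ → List ℕ := serPair serNat serNat

/-- Configurations as numerical data. -/
abbrev RConfig := ℕ × List ℕ × ℕ × List ℕ × List (ℕ × ℕ)

def Config.raw {N : CTA} (γ : Config N) : RConfig :=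
  (γ.sLoc.val, List.ofFn γ.sVal, γ.rLoc.val, List.ofFn γ.rVal, γ.chan.map rawMsg)

def serConfig : RConfig → List ℕ :=
  serPair serNat (serPair (codeList serNat) (serPair serNat (serPair (codeList serNat)
    (codeList serMsg))))

theorem serAtom_raw {k : ℕ} (c : Atom (Fin k)) : serAtom (rawAtom c) = codeAtom c := by
  obtain ⟨x, o, b⟩ := c
  cases o <;> rfl

theorem serInterval_raw (I : AgeInterval) : serInterval (rawInterval I) = codeInterval I := by
  obtain ⟨l, p, u, q⟩ := I
  cases u <;> rfl

theorem serSend_raw {m : ℕ} (o : SendOp (Fin m)) : serSend (rawSend o) = codeSendOp o := by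
  cases o <;> rfl

theorem serRecv_raw {m : ℕ} (o : RecvOp (Fin m)) : serRecv (rawRecv o) = codeRecvOp o := by
  cases o with
  | nop => rfl
  | read a I =>
    change 1 :: ([a.val] ++ serInterval (rawInterval I)) = _
    rw [serInterval_raw]
    rfl

theorem serAutomaton_raw {n k : ℕ} {Op ω : Type} {f : Op → ω} {g : ω → List ℕ}
    {h : Op → List ℕ} (hg : ∀ o, g (f o) = h o) (A : TimedAutomaton (Fin n) (Fin k) Op) :
    serAutomaton g (rawAutomaton f A) = codeAutomaton h A := by
  have h₁ : ∀ e, serTrans g (rawTrans f e) = codeTransition (n := n) (k := k) h e := by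
    intro e
    simp only [serTrans, rawTrans, codeTransition, serPair, codeList_map, serAtom_raw, hg]
    rfl
  simp only [serAutomaton, rawAutomaton, codeAutomaton, serPair, codeList_map, h₁]
  rfl

theorem serCTA_raw (N : CTA) : serCTA N.raw = codeCTA N := by
  simp only [serCTA, CTA.raw, codeCTA, serPair, serAutomaton_raw serSend_raw,
    serAutomaton_raw serRecv_raw]

theorem serConfig_raw {N : CTA} (γ : Config N) : serConfig γ.raw = codeConfig γ := by
  simp only [serConfig, Config.raw, codeConfig, serPair, codeList_map]
  rfl

theorem parses_trans {ω : Type} [TEnc ω] {f : ω → List ℕ} (hf : Parses f) :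
    Parses (serTrans f) :=
  parses_nat.pair ((parses_nat.pair (parses_nat.pair parses_nat)).list.pair
    (hf.pair (parses_nat.list.pair parses_nat)))

theorem parses_automaton {ω : Type} [TEnc ω] {f : ω → List ℕ} (hf : Parses f) :
    Parses (serAutomaton f) :=
  parses_nat.list.pair (parses_nat.list.pair (parses_trans hf).list)

theorem parses_interval : Parses serInterval :=
  parses_nat.pair (parses_nat.pair (parses_nat.option.pair parses_nat))

theorem parses_CTA : Parses serCTA :=
  parses_codeSize.pair (parses_codeSize.pair (parses_codeSize.pair (parses_codeSize.pair
    (parses_codeSize.pair ((parses_automaton parses_nat.option).pair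
      (parses_automaton (parses_nat.pair parses_interval).option))))))

theorem parses_config : Parses serConfig :=
  parses_nat.pair (parses_nat.list.pair (parses_nat.pair (parses_nat.list.pair
    (parses_nat.pair parses_nat).list)))

section Instances

variable {α : Type} [TEnc α] {N : α → CTA} {T : ∀ a, Target (N a)}

/-- What the search needs to know about a target. -/
def Target.view {N : CTA} (T : Target N) : RTarget × Bool × List (ℕ × ℕ) :=
  (T.raw, T.free, T.pending.map rawMsg)

/-- The view of a target that is not a configuration. -/
def locationView (l : List ℕ) : RTarget × Bool × List (ℕ × ℕ) :=
  ((bif decide (l.headD 0 = 1) then none else some (l.getD 1 0),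
    bif decide (l.headD 0 = 1) then some (l.getD 1 0) else
      bif decide (l.headD 0 = 2) then some (l.getD 2 0) else none, none), true, [])

theorem Target.view_eq_locationView {N : CTA} {T : Target N}
    (h : decide ((codeTarget T).headD 0 = 3) = false) :
    T.view = locationView (codeTarget T) := by
  cases T with
  | configuration γ => simp [codeTarget] at h
  | _ => rfl

/-- The leading tag `3` marks configurations, which are parsed as numerical data. For the other
targets the required numbers stand at fixed positions. -/
theorem feas_view (h : Feas fun a => codeTarget (T a)) : Feas fun a => (T a).view := by
  refine Feas.cond_restrict (b := fun a => decide ((codeTarget (T a)).headD 0 = 3)) (by fun_prop)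
    ?_ ?_
  · exact (Feas.restrict (f := fun a => locationView (codeTarget (T a)))
      (by unfold locationView; fun_prop) _).congr fun x => Target.view_eq_locationView x.2
  · let b : α → Bool := fun a => decide ((codeTarget (T a)).headD 0 = 3)
    have key : ∀ x : {a // b a = true}, ∃ γ, T x.1 = .configuration γ := by
      rintro ⟨a, ha⟩
      simp only [b] at ha
      dsimp only
      generalize T a = t at *
      cases t with
      | configuration γ => exact ⟨γ, rfl⟩
      | _ => simp [codeTarget] at ha
    choose γ hγ using key
    have h₁ : Feas fun x : {a // b a = true} => ((γ x).raw, ([] : List ℕ)) := by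
      refine parses_config.read ((Feas.restrict (f := fun a => (codeTarget (T a)).tail)
        (by fun_prop) _).congr fun x => ?_)
      rw [hγ, serConfig_raw, List.append_nil]
      rfl
    refine (Feas.comp (g := fun c : RConfig => (((some c.1, some c.2.2.1,
      some (c.2.1, c.2.2.2.1)), false, c.2.2.2.2.reverse) : RTarget × Bool × List (ℕ × ℕ)))
      (by fun_prop) h₁.fst).congr fun x => ?_
    rw [hγ]
    simp [Target.view, Target.raw, Target.free, Target.pending, Config.raw]

/-- The data of an instance can be read from its sequence of numbers. -/
theorem feas_raw_view (h : Feas fun a => codeCTA (N a) ++ codeTarget (T a)) :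
    Feas fun a => ((N a).raw, (T a).view) := by
  have h₁ : Feas fun a => ((N a).raw, codeTarget (T a)) :=
    parses_CTA.read (h.congr fun a => by rw [serCTA_raw])
  exact h₁.fst.prodMk (feas_view h₁.snd)

end Instances

/-! ### The sizes of instances -/

theorem mem_codeList {α : Type} {f : α → List ℕ} {l : List α} {a : α} {n : ℕ} (ha : a ∈ l)
    (hn : n ∈ f a) : n ∈ codeList f l := by
  induction l with
  | nil => simp at ha
  | cons b l ih =>
    rcases List.mem_cons.1 ha with rfl | ha
    · simp [codeList, hn]
    · simp [codeList, ih ha]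

theorem length_le_length_codeList {α : Type} (f : α → List ℕ) (l : List α) :
    l.length ≤ (codeList f l).length := by
  induction l with
  | nil => simp
  | cons a l ih => simp only [codeList, List.length_cons, List.length_append]; omega

theorem CTA.below_of_codeCTA {N : CTA} {cap : ℕ} (h : ∀ n ∈ codeCTA N, n < cap) :
    N.Below cap := by
  simp only [codeCTA, codeAutomaton, List.mem_append] at h
  constructor
  · intro e he c hc
    refine h _ (.inr (.inr (.inr (.inr (.inr (.inl (.inr (.inr (mem_codeList he ?_)))))))))
    simp only [codeTransition, List.mem_append]
    exact .inr (.inl (mem_codeList hc (by simp [codeAtom])))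
  · intro e he c hc
    refine h _ (.inr (.inr (.inr (.inr (.inr (.inr (.inr (.inr (mem_codeList he ?_)))))))))
    simp only [codeTransition, List.mem_append]
    exact .inr (.inl (mem_codeList hc (by simp [codeAtom])))
  · intro e he a I hop
    have h₁ : ∀ n ∈ codeInterval I, n < cap := by
      intro n hn
      refine h _ (.inr (.inr (.inr (.inr (.inr (.inr (.inr (.inr (mem_codeList he ?_)))))))))
      simp only [codeTransition, List.mem_append, hop, codeRecvOp, List.mem_cons]
      exact .inr (.inr (.inl (.inr (.inr hn))))
    refine ⟨h₁ _ (by simp [codeInterval]), fun u hu => h₁ _ ?_⟩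
    rw [Option.mem_def] at hu
    simp [codeInterval, codeUpper, hu]

theorem Target.below_of_codeTarget {N : CTA} {T : Target N} {cap : ℕ}
    (h : ∀ n ∈ codeTarget T, n < cap) : T.Below cap := by
  cases T with
  | configuration γ =>
    simp only [codeTarget, codeConfig, codeVal, List.mem_cons, List.mem_append] at h
    refine ⟨fun i => ?_, fun i => ?_, fun p hp => ?_⟩
    · exact h _ (.inr (.inr (.inl (mem_codeList (List.mem_ofFn.2 ⟨i, rfl⟩) (by simp)))))
    · exact h _ (.inr (.inr (.inr (.inr (.inl
        (mem_codeList (List.mem_ofFn.2 ⟨i, rfl⟩) (by simp)))))))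
    · exact h _ (.inr (.inr (.inr (.inr (.inr (mem_codeList hp (by simp)))))))
  | _ => trivial

/-- This is where unary sizes count: the numbers of clocks are exponents in the number of control
states, so they must be bounded by the length of the input. -/
theorem length_codeInstance_ge (x : ReachInstance) :
    x.net.senderLocs ≤ (codeInstance x).length ∧ x.net.senderClocks ≤ (codeInstance x).length ∧
      x.net.receiverLocs ≤ (codeInstance x).length ∧
      x.net.receiverClocks ≤ (codeInstance x).length ∧
      x.target.pending.length ≤ (codeInstance x).length := by
  have h : ∀ n, (codeSize n).length = n + 1 := by simp [codeSize]
  have h' : x.target.pending.length ≤ (codeTarget x.target).length := by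
    cases x.target with
    | configuration γ =>
      have := length_le_length_codeList (fun p => codeFin p.1 ++ [p.2]) γ.chan
      simp only [Target.pending, codeTarget, codeConfig, List.length_reverse, List.length_cons,
        List.length_append]
      omega
    | _ => simp [Target.pending]
  simp only [codeInstance, codeCTA, List.length_append, h]
  omega

end TimedChannel

section

open StackMachine TEnc

/-! ### Exponential time -/

/-- An instance of a decision problem, presented by its string and by a number exponential in a
polynomial of the length of the string. -/
structure Padded {α : Type} (e : Computability.Encoding α (Option Bool)) (c : ℕ) where
  val : α

namespace Padded

variable {α : Type} {e : Computability.Encoding α (Option Bool)} {c : ℕ}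

/-- The number added to an instance. -/
def pad (x : Padded e c) : ℕ := 2 ^ (c * ((e.encode x.val).length + 1) ^ 2)

/-- The string is reversed because loading the input stack reverses it. -/
instance : TEnc (Padded e c) where
  enc x := enc ((e.encode x.val).reverse, x.pad)

theorem feas_string : Feas fun x : Padded e c => (e.encode x.val).reverse :=
  (Feas.id.of_enc_eq (g := fun x : Padded e c => ((e.encode x.val).reverse, x.pad))
    fun _ => rfl).fst

theorem feas_pad : Feas fun x : Padded e c => x.pad :=
  (Feas.id.of_enc_eq (g := fun x : Padded e c => ((e.encode x.val).reverse, x.pad))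
    fun _ => rfl).snd

end Padded

theorem loadTree_enc (l k : List (Option Bool)) :
    loadTree l (enc k) = enc (l.reverse ++ k) := by
  induction l generalizing k with
  | nil => rfl
  | cons s l ih =>
    have h : BTree.node (symTree s) (enc k) = enc (s :: k) := by
      rcases s with _ | _ | _ <;> rfl
    rw [loadTree, h, ih]
    simp

theorem sz_string_le (l : List (Option Bool)) : sz l ≤ 6 * l.length + 1 := by
  have h := sz_list_le (l := l) (B := 5) fun s _ => by
    rcases s with _ | b
    · simp
    · have := sz_bool_le b
      rw [sz_some]
      omega
  omega

/-- A single power dominates the sizes of the string, of the unary padding and of the list of `c *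
(n + 1) ^ 2` units driving the doubling. Polynomial costs then become powers of this one number. -/
theorem linear_le_two_pow (c n : ℕ) : 2 * (c * (n + 1) ^ 2) + 6 * n +
    2 * 2 ^ (c * (n + 1) ^ 2) + 16 ≤ 2 ^ ((c + 8) * (n + 1) ^ 2) := by
  set E := (n + 1) ^ 2 with hE
  have h₁ : n + 1 ≤ E := by rw [hE]; nlinarith
  have h₂ : E < 2 ^ E := Nat.lt_two_pow_self
  have h₃ : c * E < 2 ^ (c * E) := Nat.lt_two_pow_self
  have h₄ : 2 ^ 7 * 2 ^ E ≤ 2 ^ (8 * E) := by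
    rw [← pow_add]
    exact Nat.pow_le_pow_right (by norm_num) (by omega)
  rw [add_mul, pow_add]
  have h₅ := Nat.mul_le_mul_left (2 ^ (c * E)) h₄
  have h₆ := Nat.le_mul_of_pos_right (2 ^ (c * E)) (Nat.two_pow_pos E)
  have h₇ := Nat.le_mul_of_pos_left (2 ^ E) (Nat.two_pow_pos (c * E))
  have h₈ : 2 ^ (c * E) * (2 ^ 7 * 2 ^ E) = 128 * (2 ^ (c * E) * 2 ^ E) := by ring
  omega

theorem pow_add_pow_add_le {Z : ℕ} (hZ : 4 ≤ Z) (j k : ℕ) : Z ^ j + Z ^ k + 4 ≤ Z ^ (j + k + 2) := by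
  have h₁ : Z ^ j ≤ Z ^ (j + k) := Nat.pow_le_pow_right (by omega) (by omega)
  have h₂ : Z ^ k ≤ Z ^ (j + k) := Nat.pow_le_pow_right (by omega) (by omega)
  have h₃ : 1 ≤ Z ^ (j + k) := Nat.one_le_pow _ _ (by omega)
  have h₄ : 4 ^ 2 ≤ Z ^ 2 := Nat.pow_le_pow_left hZ 2
  have h₅ := Nat.mul_le_mul_left (Z ^ (j + k)) h₄
  rw [pow_add]
  omega

theorem two_pow_mul_two_le {a b : ℕ} (h : a < b) : 2 ^ a * 2 ≤ 2 ^ b := by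
  rw [← pow_succ]
  exact Nat.pow_le_pow_right (by norm_num) h

/-- A program computing the tree of an instance with its padding. -/
theorem exists_runs_padded (c : ℕ) : ∃ p k, ∀ l : List (Option Bool),
    Runs p [enc l.reverse] [enc (l.reverse, 2 ^ (c * (l.length + 1) ^ 2))]
      ((2 ^ ((c + 8) * (l.length + 1) ^ 2)) ^ k) := by
  obtain ⟨p, T, ⟨j, hT⟩, hp⟩ : Feas fun l : List (Option Bool) =>
      (List.replicate (c * ((l.length + 1) * (l.length + 1))) (), ((l, 1), ())) :=
    (Feas.units (by fun_prop)).prodMk (by fun_prop)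
  -- The padding is made by repeated doubling. Its size is exponential in the input, so the loop is
  -- not covered by `Feas.foldl` and is bounded through its accumulators directly.
  obtain ⟨q, k, hq⟩ := exists_runs_foldl (α := Unit) (σ := List (Option Bool) × ℕ) (β := Unit)
    (f := fun _ s _ => (s.1, s.2 + s.2)) (by fun_prop)
  refine ⟨.seq p q, j + k + 2, fun l => ?_⟩
  have hfold : ∀ u : List Unit,
      u.foldl (fun (s : List (Option Bool) × ℕ) _ => (s.1, s.2 + s.2)) (l.reverse, 1) =
        (l.reverse, 2 ^ u.length) := by
    intro u
    induction u using List.reverseRecOn with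
    | nil => rfl
    | append_singleton u b ih =>
      rw [List.foldl_append, ih, List.length_append, List.length_singleton, pow_succ]
      simp only [List.foldl_cons, List.foldl_nil, Prod.mk.injEq, true_and]
      omega
  have h₀ := linear_le_two_pow c l.length
  have e₁ : c * ((l.length + 1) * (l.length + 1)) = c * (l.length + 1) ^ 2 := by rw [sq]
  have h₁ := hp l.reverse
  simp only [List.length_reverse, e₁] at h₁
  generalize (l.length + 1) ^ 2 = E at *
  have h₂ := hq () (List.replicate (c * E) ()) (l.reverse, 1)
    (6 * l.length + 1 + (2 * 2 ^ (c * E) + 1) + 1) fun u hu => by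
      have h₃ := hu.length_le
      rw [List.length_replicate] at h₃
      have h₄ := Nat.pow_le_pow_right (n := 2) (by norm_num) h₃
      have h₅ := sz_string_le l
      rw [hfold, sz_pair, sz_reverse, sz_nat]
      omega
  rw [hfold, List.length_replicate] at h₂
  refine (h₁.seq h₂).mono ?_
  have h₃ := hT l.reverse
  have h₄ := sz_string_le l
  rw [sz_reverse] at h₃
  have e₂ : sz (List.replicate (c * E) ()) = 2 * (c * E) + 1 := sz_nat (c * E)
  rw [e₂, sz_unit]
  generalize 2 ^ ((c + 8) * E) = Z at *
  have h₅ : (sz l + 2) ^ j ≤ Z ^ j := Nat.pow_le_pow_left (by omega) j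
  have h₆ : (2 * (c * E) + 1 + 1 + (6 * l.length + 1 + (2 * 2 ^ (c * E) + 1) + 1) + 2) ^ k ≤
      Z ^ k := Nat.pow_le_pow_left (by omega) k
  have h₇ := pow_add_pow_add_le (Z := Z) (by omega) j k
  omega

/-- Decision problems that are feasible on padded instances are in `EXPTIME`. -/
theorem inEXPTIME_of_feas {α : Type} {e : Computability.Encoding α (Option Bool)} {c : ℕ}
    {P : α → Prop} {F : Padded e c → Bool} (hF : Feas F) (h : ∀ x, F x = true ↔ P x.val) :
    InEXPTIME e P := by
  obtain ⟨p, k, hp⟩ := exists_runs_padded c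
  obtain ⟨q, T, ⟨j, hT⟩, hq⟩ := hF
  refine inEXPTIME_of_exec e P (.seq p q)
    -- With `Z` the power from `linear_le_two_pow`, padding costs at most `Z ^ k` and the decision
    -- at most `Z ^ j`; the extra exponent `3` absorbs the remaining summands.
    (Polynomial.C (c + 8) * (Polynomial.X + 1) ^ 2 * Polynomial.C (k + j + 3)) fun a => ?_
  have h₁ := hp (e.encode a)
  have h₂ := hq (⟨a⟩ : Padded e c)
  obtain ⟨t, ht, h₃⟩ := (h₁.seq h₂).exec
  refine ⟨enc (F ⟨a⟩), t, ?_, ?_, ?_⟩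
  · rw [show loadTree (e.encode a) .leaf = enc (e.encode a).reverse by
      rw [← List.append_nil (e.encode a).reverse]
      exact loadTree_enc (e.encode a) []]
    exact h₃
  · rw [← h ⟨a⟩]
    cases F (⟨a⟩ : Padded e c) <;> simp [enc, BTree.isNode]
  · have h₄ := hT (⟨a⟩ : Padded e c)
    have h₅ : sz (⟨a⟩ : Padded e c) =
        sz (e.encode a) + (2 * 2 ^ (c * ((e.encode a).length + 1) ^ 2) + 1) + 1 := by
      rw [← sz_reverse (e.encode a), ← sz_nat]
      rfl
    have h₆ := sz_string_le (e.encode a)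
    have h₇ := linear_le_two_pow c (e.encode a).length
    have h₈ := sz_bool_le (F (⟨a⟩ : Padded e c))
    simp only [Polynomial.eval_mul, Polynomial.eval_C, Polynomial.eval_pow, Polynomial.eval_add,
      Polynomial.eval_X, Polynomial.eval_one]
    rw [pow_mul]
    change (e.encode a).length + sz (F (⟨a⟩ : Padded e c)) + t + 4 ≤ _
    generalize 2 ^ ((c + 8) * ((e.encode a).length + 1) ^ 2) = Z at *
    have h₉ : (sz (⟨a⟩ : Padded e c) + 2) ^ j ≤ Z ^ j := Nat.pow_le_pow_left (by omega) j
    have h₁₀ := pow_add_pow_add_le (Z := Z) (by omega) k j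
    have h₁₁ : Z ^ 1 ≤ Z ^ (k + j + 2) := Nat.pow_le_pow_right (by omega) (by omega)
    have h₁₂ : Z ^ (k + j + 2) * 4 ≤ Z ^ (k + j + 2) * Z := Nat.mul_le_mul_left _ (by omega)
    rw [pow_one] at h₁₁
    rw [show k + j + 3 = k + j + 2 + 1 from rfl, pow_succ]
    omega

/-! ### The reachability problem -/

namespace TimedChannel

/-- A number above all constants of an instance. -/
def ReachInstance.cap (x : ReachInstance) : ℕ := (codeInstance x).sum + 1

theorem ReachInstance.lt_cap {x : ReachInstance} {n : ℕ} (h : n ∈ codeInstance x) : n < x.cap :=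
  Nat.lt_succ_of_le (List.le_sum_of_mem h)

theorem ReachInstance.cap_le (x : ReachInstance) : x.cap ≤ 2 ^ (writeInstance x).length :=
  sum_lt_two_pow_length_writeNumbers _

theorem ReachInstance.net_below (x : ReachInstance) : x.net.Below x.cap :=
  CTA.below_of_codeCTA fun _ h => x.lt_cap (by simp [codeInstance, h])

theorem ReachInstance.target_below (x : ReachInstance) : x.target.Below x.cap :=
  Target.below_of_codeTarget fun _ h => x.lt_cap (by simp [codeInstance, h])

/-- For a string of length `n`, locations contribute at most `2 ^ n` per automaton, clock values at
most `2 ^ ((n + 1) * n)` per automaton, and the pending list with the flag at most `2 ^ (n + 1)`. -/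
theorem ReachInstance.ncard_ctrls_le (x : ReachInstance) :
    (ctrls x.net x.cap x.target.pending).ncard ≤ 2 ^ (5 * ((writeInstance x).length + 1) ^ 2) := by
  obtain ⟨h₁, h₂, h₃, h₄, h₅⟩ := length_codeInstance_ge x
  have h₆ : (codeInstance x).length ≤ (writeInstance x).length := length_le_length_writeNumbers _
  have h₇ := x.cap_le
  refine (ctrls_finite_card _ _ _).2.trans ?_
  generalize (writeInstance x).length = n at *
  have h₈ : n < 2 ^ n := Nat.lt_two_pow_self
  have h₉ : x.cap + 1 ≤ 2 ^ (n + 1) := by rw [pow_succ]; omega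
  have key : ∀ k ≤ n, (x.cap + 1) ^ k ≤ 2 ^ ((n + 1) * n) := fun k hk => by
    rw [pow_mul]
    exact (Nat.pow_le_pow_left h₉ k).trans (Nat.pow_le_pow_right (Nat.two_pow_pos _) hk)
  calc _ ≤ 2 ^ n * 2 ^ ((n + 1) * n) * (2 ^ n * 2 ^ ((n + 1) * n)) * (2 ^ n * 2) := by
        exact Nat.mul_le_mul (Nat.mul_le_mul
          (Nat.mul_le_mul (by omega) (key _ (h₂.trans h₆)))
          (Nat.mul_le_mul (by omega) (key _ (h₄.trans h₆)))) (Nat.mul_le_mul_right 2 (by omega))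
    _ = 2 ^ (3 * n + 1 + 2 * ((n + 1) * n)) := by ring
    _ ≤ _ := Nat.pow_le_pow_right (by norm_num) (by nlinarith)

/-- The padding also serves as the bound `D` for the lead. It has to exceed the square of the number
of control states, which is at most `2 ^ (10 * (n + 1) ^ 2)`, plus `cap`; the constant `16` leaves
room. -/
abbrev PaddedInstance := Padded instanceEncoding 16

namespace PaddedInstance

variable (x : PaddedInstance)

theorem two_pow_le_pad : 2 ^ (writeInstance x.val).length ≤ x.pad := by
  refine Nat.pow_le_pow_right (by norm_num) ?_
  change (writeInstance x.val).length ≤ 16 * ((writeInstance x.val).length + 1) ^ 2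
  nlinarith

theorem cap_add_sq_le_pad :
    x.val.cap + (ctrls x.val.net x.val.cap x.val.target.pending).ncard ^ 2 ≤ x.pad := by
  have h₁ := x.val.cap_le
  have h₂ := x.val.ncard_ctrls_le
  rw [show x.pad = 2 ^ (16 * ((writeInstance x.val).length + 1) ^ 2) from rfl]
  generalize (writeInstance x.val).length = n at *
  have h₄ : 2 ^ n ≤ 2 ^ (10 * (n + 1) ^ 2) := Nat.pow_le_pow_right (by norm_num) (by nlinarith)
  have hE : 0 < (n + 1) ^ 2 := Nat.pow_pos n.succ_pos
  generalize (n + 1) ^ 2 = E at *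
  have h₅ := Nat.pow_le_pow_left h₂ 2
  rw [← pow_mul, show 5 * E * 2 = 10 * E by ring] at h₅
  have h₆ : 2 ^ (10 * E) * 2 ≤ 2 ^ (16 * E) := two_pow_mul_two_le (by omega)
  omega

theorem ncard_mul_le :
    (ctrls x.val.net x.val.cap x.val.target.pending).ncard * (x.pad + 1) ≤ x.pad * x.pad := by
  have h₂ := x.val.ncard_ctrls_le
  rw [show x.pad = 2 ^ (16 * ((writeInstance x.val).length + 1) ^ 2) from rfl]
  generalize (writeInstance x.val).length = n at *
  have hE : 0 < (n + 1) ^ 2 := Nat.pow_pos n.succ_pos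
  generalize (n + 1) ^ 2 = E at *
  have h₄ : 2 ^ (5 * E) * 2 ≤ 2 ^ (16 * E) := two_pow_mul_two_le (by omega)
  have h₅ := Nat.two_pow_pos (16 * E)
  nlinarith

end PaddedInstance

theorem feas_codeInstance : Feas fun x : PaddedInstance => codeInstance x.val :=
  Feas.numbers Padded.feas_string (fun _ => rfl) Padded.feas_pad.polyBdd fun x => by
    rw [List.length_reverse]
    exact x.two_pow_le_pad

theorem feas_cap : Feas fun x : PaddedInstance => x.val.cap :=
  (Feas.length_units (Feas.flatMap (g := fun _ n => List.replicate n ()) feas_codeInstance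
    (Feas.units Feas.id.snd))).succ.congr fun x => by simp [ReachInstance.cap]

/-- The padding bounds the lead and its square the number of rounds. Everything else the search
needs is a projection of the parsed data. -/
theorem feas_decision : Feas fun x : PaddedInstance =>
    decideB x.val.target x.val.cap x.pad (x.pad * x.pad) := by
  have h := feas_raw_view feas_codeInstance
  have hN := h.fst
  have hT := h.snd
  exact feas_decideB feas_cap Padded.feas_pad (Padded.feas_pad.mul Padded.feas_pad)
    hN.snd.snd.snd.snd.snd.fst.snd.snd hN.snd.snd.snd.snd.snd.snd.snd.snd hT.snd.fst
    (feas_initsB hN.snd.snd.snd.snd.snd.fst.fst hN.snd.snd.snd.snd.snd.snd.fst hN.snd.fst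
      hN.snd.snd.snd.fst hT.snd.snd) hT.snd.snd hT.fst hN.fst.polyBdd hN.snd.snd.fst.polyBdd
    hN.snd.fst.polyBdd hN.snd.snd.snd.fst.polyBdd (fun x => x.val.net_below)
    PaddedInstance.ncard_mul_le

end TimedChannel

end

theorem theorem3 : InEXPTIME TimedChannel.instanceEncoding TimedChannel.Reachability :=
  inEXPTIME_of_feas TimedChannel.feas_decision fun x =>
    TimedChannel.decideB_iff x.val.net_below x.val.target_below
      (TimedChannel.PaddedInstance.cap_add_sq_le_pad x) (TimedChannel.PaddedInstance.ncard_mul_le x)
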